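/- For integers $a\le b$ let $[a,b]=\{a,a+1,\dots,b\}$, let $[n]=[1,n]$, and let $\binom{[n]}{k}$ be the family of all $k$-subsets of $[n]$. A family $\mathcal F\subseteq\binom{[n]}{k}$ is *$d$-wise intersecting* if $F_1\cap\dots\cap F_d\neq\emptyset$ for all (not necessarily distinct) $F_1,\dots,F_d\in\mathcal F$; it is *non-trivial* if no element of $[n]$ belongs to all its members; and a $d$-wise intersecting $\mathcal F\subseteq\binom{[n]}{k}$ is *maximal* if $\mathcal F\cup\{A\}$ is not $d$-wise intersecting for every $A\in\binom{[n]}{k}\setminus\mathcal F$. Write $\mathcal F\cong\mathcal F'$ if some permutation of $[n]$ carries $\mathcal F$ onto $\mathcal F'$. A maximal non-trivial $d$-wise intersecting family $\mathcal F\subseteq\binom{[n]}{k}$ is called *$m$-th largest* if exactly $m-1$ distinct integers larger than $|\mathcal F|$ occur as sizes of maximal non-trivial $d$-wise intersecting families $\mathcal F'\subseteq\binom{[n]}{k}$. On the ground set $[n]$ define $$\begin{aligned}\mathcal H(k,d,l)=&\{F\in\tbinom{[n]}{k}:[d-1]\subseteq F,\ F\cap[d,d+l-1]\ne\emptyset\}\cup\{F\in\tbinom{[n]}{k}:|[d-1]\cap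 F|=d-2,\ [d,d+l-1]\subseteq F\},\\ \mathcal G(k,d)=&\{F\in\tbinom{[n]}{k}:[d-1]\subseteq F,\ F\cap[d,k-1]\ne\emptyset\}\cup\{[2,k]\cup\{i\}:i\in[k+2,n]\}\\&\cup\{F\in\tbinom{[n]}{k}:[d-1]\cup[k,k+1]\subseteq F\}\cup\{[2,k-1]\cup\{k+1,i\}:i\in[k+2,n]\}\\&\cup\{F\in\tbinom{[n]}{k}:|[d-1]\cap F|=d-2,\ [d,k+1]\subseteq F\},\\ \mathcal S(k,3)=&\{F\in\tbinom{[n]}{k}:[2]\subseteq F,\ F\cap[3,k-1]\ne\emptyset\}\cup\{F\in\tbinom{[n]}{k}:[2]\cup[k,k+2]\subseteq F\}\\&\cup\bigcup_{i=1}^{2}\{F\in\tbinom{[n]}{k}:\{i\}\cup[3,k-1]\subseteq F,\ |[k,k+2]\cap F|=2\},\\ \mathcal S_1(k,3)=&\{F\in\tbinom{[n]}{k}:[2]\subseteq F,\ F\cap[3,k-1]\ne\emptyset\}\cup\{F\in\tbinom{[n]}{k}:[2]\cup[k,k+2]\subseteq F\}\\&\cup\{[2,k]\cup\{i\}:i\in[k+1,n]\}\cup\{[2,k+2]\setminus\{k\},\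 [k+1]\setminus\{2\},\ [k+2]\setminus\{2,k+1\}\}.\end{aligned}$$ **Corollary.** Let $k\ge 5$ and $n>n_1(k,3)=3+2(k-3)^2\,(k^{k-3}-1)^k\,k!$, and let $\mathcal F\subseteq\binom{[n]}{k}$. Then $\mathcal F$ is a fifth largest maximal non-trivial $3$-wise intersecting family if and only if 1. $\mathcal F\cong\mathcal S_1(5,3)$, when $k=5$; 2. $\mathcal F\cong\mathcal G(6,3)$, when $k=6$; 3. $\mathcal F\cong\mathcal H(7,3,4)$, when $k=7$; 4. $\mathcal F\cong\mathcal S(k,3)$, when $k\ge 8$. -/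

import Mathlib

open Finset

/-- `[n] = {1, …, n}`; more generally `Finset.Icc a b` is `[a, b]`. The family of all `k`-subsets
of `[n]`. -/
def kSubsets (n k : ℕ) : Finset (Finset ℕ) := (Icc 1 n).powersetCard k

/-- `d`-wise intersecting: any `d` members (repetitions allowed) have a common element. -/
def DWiseIntersecting (d : ℕ) (𝓕 : Finset (Finset ℕ)) : Prop :=
  ∀ A : Fin d → Finset ℕ, (∀ i, A i ∈ 𝓕) → ∃ x, ∀ i, x ∈ A i

/-- Trivial: all members contain a common element of `[n]`. -/
def TrivialFamily (n : ℕ) (𝓕 : Finset (Finset ℕ)) : Prop :=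
  ∃ x ∈ Icc 1 n, ∀ A ∈ 𝓕, x ∈ A

/-- `𝓕 ⊆ ([n] choose k)` is a maximal non-trivial `d`-wise intersecting family. -/
structure IsMaxNontrivial (n k d : ℕ) (𝓕 : Finset (Finset ℕ)) : Prop where
  uniform : 𝓕 ⊆ kSubsets n k
  intersecting : DWiseIntersecting d 𝓕
  nontrivial : ¬ TrivialFamily n 𝓕
  maximal : ∀ A ∈ kSubsets n k, A ∉ 𝓕 → ¬ DWiseIntersecting d (insert A 𝓕)

/-- `𝓕` is an `m`-th largest maximal non-trivial `d`-wise intersecting `k`-uniform family on `[n]`: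
it is such a family, and its size is the `m`-th in the decreasing list of the distinct sizes of
such families, that is, exactly `m - 1` of these sizes exceed it. -/
def IsNthLargest (m n k d : ℕ) (𝓕 : Finset (Finset ℕ)) : Prop :=
  IsMaxNontrivial n k d 𝓕 ∧
    {s : ℕ | 𝓕.card < s ∧ ∃ 𝓖, IsMaxNontrivial n k d 𝓖 ∧ 𝓖.card = s}.ncard + 1 = m

/-- Isomorphism of families of subsets of `[n]`. A permutation of `[n]` is given as a permutation
of `ℕ` that fixes everything outside `[n]`. -/
def FamilyIso (n : ℕ) (𝓕 𝓖 : Finset (Finset ℕ)) : Prop :=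
  ∃ π : Equiv.Perm ℕ, (∀ x, x ∉ Icc 1 n → π x = x) ∧ 𝓕.image (fun A => A.image π) = 𝓖

/-- The family `𝓗(k, d, l)` on `[n]`. -/
def familyH (n k d l : ℕ) : Finset (Finset ℕ) :=
  {F ∈ kSubsets n k | Icc 1 (d - 1) ⊆ F ∧ (F ∩ Icc d (d + l - 1)).Nonempty} ∪
  {F ∈ kSubsets n k | (Icc 1 (d - 1) ∩ F).card = d - 2 ∧ Icc d (d + l - 1) ⊆ F}

/-- The family `𝓖(k, d)` on `[n]`. -/
def familyG (n k d : ℕ) : Finset (Finset ℕ) :=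
  {F ∈ kSubsets n k | Icc 1 (d - 1) ⊆ F ∧ (F ∩ Icc d (k - 1)).Nonempty} ∪
  (Icc (k + 2) n).image (fun i => Icc 2 k ∪ {i}) ∪
  {F ∈ kSubsets n k | Icc 1 (d - 1) ∪ Icc k (k + 1) ⊆ F} ∪
  (Icc (k + 2) n).image (fun i => Icc 2 (k - 1) ∪ {k + 1, i}) ∪
  {F ∈ kSubsets n k | (Icc 1 (d - 1) ∩ F).card = d - 2 ∧ Icc d (k + 1) ⊆ F}

/-- The family `𝓢(k, 3)` on `[n]`. -/
def familyS (n k : ℕ) : Finset (Finset ℕ) :=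
  {F ∈ kSubsets n k | Icc 1 2 ⊆ F ∧ (F ∩ Icc 3 (k - 1)).Nonempty} ∪
  {F ∈ kSubsets n k | Icc 1 2 ∪ Icc k (k + 2) ⊆ F} ∪
  (Icc 1 2).biUnion (fun i =>
    {F ∈ kSubsets n k | {i} ∪ Icc 3 (k - 1) ⊆ F ∧ (Icc k (k + 2) ∩ F).card = 2})

/-- The family `𝓢₁(k, 3)` on `[n]`. -/
def familyS₁ (n k : ℕ) : Finset (Finset ℕ) :=
  {F ∈ kSubsets n k | Icc 1 2 ⊆ F ∧ (F ∩ Icc 3 (k - 1)).Nonempty} ∪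
  {F ∈ kSubsets n k | Icc 1 2 ∪ Icc k (k + 2) ⊆ F} ∪
  (Icc (k + 1) n).image (fun i => Icc 2 k ∪ {i}) ∪
  {Icc 2 (k + 2) \ {k}, Icc 1 (k + 1) \ {2}, Icc 1 (k + 2) \ {2, k + 1}}

/-- `n₁(k, d) = d + 2 (k - d)² (k^(k-d) - 1)^k k!`, used for `k ≥ d` only. -/
def nOne (k d : ℕ) : ℕ :=
  d + 2 * (k - d) ^ 2 * (k ^ (k - d) - 1) ^ k * k.factorial

/-! Let `𝓕` be a maximal non-trivial 3-wise intersecting family. Call a set of at most `k` points a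
transversal if it meets `A ∩ B` for all members `A`, `B`. By maximality every `k`-set containing a
transversal is a member. Since `n` is large, transversals extend to members by fresh points, so any
three transversals share a point and, by non-triviality, any two share two points
(`transversal_inter_three`, `transversal_inter_ne`). Hence transversals have at least three points.
If there are `t` transversal triples, a branching argument gives `|𝓕| ≤ t * C(n-3, k-3) + k^4 *
C(n-4, k-4)` (`card_le_of_triples`), and for `t ≤ k - 4` this is less than the fifth size.

Let `t ≥ k - 3 ≥ 2`. The triples pairwise share two points, so either three of them live on four
points, which forces `𝓗(k,3,2)`, or all contain two fixed points `u`, `v`, and the third points form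
a set `X` (`exists_starAt`). In the second case a member missing one of `u`, `v` contains the other
and all of `X`. If every member through `u` and `v` meets `X`, the family is `𝓗(k,3,|X|)`. Otherwise
`|X| = k - 3`, and removing `X` and `u` (or `v`) from the members that miss `v` (or `u`) leaves the
edges of two cross-intersecting graphs with no vertex common to all edges.
`CrossPair.classification` lists such pairs: one graph with a single edge gives `𝓖`; otherwise
disjoint edges in exactly one graph give `𝓢₁`, in neither `𝓢`, and in both a family smaller than
`𝓢`. Inclusion in a model family suffices each time, since maximality turns it into equality
(`eq_of_subset`).

All the models are instances of one construction, whose maximality follows from a duality between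
the conditions on its members (`StarData.isMaxNontrivial`). It remains to rank them by size. The
leading term is `l * C(n-3, k-3)` for `𝓗(k,3,l)` with `l ≥ 3`, `4 * C(n-3, k-3)` for `𝓗(k,3,2)`, and
`(k-3) * C(n-3, k-3)` for `𝓖`, `𝓢`, `𝓢₁`. Thus `𝓗(k,3,2)` slides from first place at `k = 5` out of
the top five at `k = 8`. Ties are decided by lower-order terms, and this is why the answer depends
on `k`. -/

/-! ### Basic facts on uniform and 3-wise intersecting families -/

theorem mem_kSubsets {n k : ℕ} {A : Finset ℕ} :
    A ∈ kSubsets n k ↔ A ⊆ Icc 1 n ∧ A.card = k := by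
  simp [kSubsets, mem_powersetCard]

theorem dWiseIntersecting_three {𝓕 : Finset (Finset ℕ)} :
    DWiseIntersecting 3 𝓕 ↔ ∀ A ∈ 𝓕, ∀ B ∈ 𝓕, ∀ C ∈ 𝓕, ∃ x, x ∈ A ∧ x ∈ B ∧ x ∈ C := by
  constructor
  · intro h A hA B hB C hC
    obtain ⟨x, hx⟩ := h ![A, B, C] (by intro i; fin_cases i <;> simpa)
    exact ⟨x, hx 0, hx 1, hx 2⟩
  · intro h A hA
    obtain ⟨x, h0, h1, h2⟩ := h _ (hA 0) _ (hA 1) _ (hA 2)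
    exact ⟨x, by intro i; fin_cases i <;> assumption⟩

/-- The filler points are taken outside `P ∪ W`, so inside `W` the resulting set is exactly `P ∩ W`.
This makes intersections with prescribed sets computable. -/
theorem exists_kSubset_avoiding {n k : ℕ} {P : Finset ℕ} (W : Finset ℕ) (hP : P ⊆ Icc 1 n)
    (hk : P.card ≤ k) (hn : W.card + k ≤ n) :
    ∃ A ∈ kSubsets n k, P ⊆ A ∧ ∀ x ∈ A, x ∈ W → x ∈ P := by
  have h1 : k - P.card ≤ (Icc 1 n \ (P ∪ W)).card := by
    have h2 := le_card_sdiff (P ∪ W) (Icc 1 n)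
    have h3 := card_union_le P W
    simp at h2
    omega
  obtain ⟨Q, hQ, hc⟩ := exists_subset_card_eq h1
  refine ⟨P ∪ Q, mem_kSubsets.2 ⟨?_, ?_⟩, subset_union_left, ?_⟩
  · exact union_subset hP (hQ.trans sdiff_subset)
  · rw [card_union_of_disjoint, hc]
    · omega
    · rw [disjoint_left]
      intro x hx hxQ
      have := hQ hxQ
      simp at this
      tauto
  · intro x hx hW
    rcases mem_union.1 hx with h | h
    · exact h
    · have := hQ h
      simp at this
      tauto

/-- Thanks to this, the structural classification only ever has to prove one inclusion. -/
theorem IsMaxNontrivial.eq_of_subset {n k : ℕ} {𝓕 𝓖 : Finset (Finset ℕ)}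
    (h : IsMaxNontrivial n k 3 𝓕) (hs : 𝓕 ⊆ 𝓖) (hu : 𝓖 ⊆ kSubsets n k)
    (hi : DWiseIntersecting 3 𝓖) : 𝓕 = 𝓖 := by
  refine hs.antisymm fun A hA => ?_
  by_contra hn
  refine h.maximal A (hu hA) hn fun B hB => hi B fun i => ?_
  rcases mem_insert.1 (hB i) with h' | h'
  · rwa [h']
  · exact hs h'

/-! ### Star families: a common model, and its maximality -/

open Classical in
/-- The members of the family are the `k`-subsets of `[n]` which contain `u`, `v` and either meet
`X` or satisfy `q`, or contain `u` and `X` and satisfy `p₁`, or contain `v` and `X` and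
satisfy `p₂`. -/
noncomputable def starFamily (n k u v : ℕ) (X : Finset ℕ) (q p₁ p₂ : Finset ℕ → Prop) :
    Finset (Finset ℕ) :=
  {F ∈ kSubsets n k | (u ∈ F ∧ v ∈ F ∧ ((F ∩ X).Nonempty ∨ q F)) ∨ (u ∈ F ∧ X ⊆ F ∧ p₁ F) ∨
    (v ∈ F ∧ X ⊆ F ∧ p₂ F)}

theorem mem_starFamily {n k u v : ℕ} {X : Finset ℕ} {q p₁ p₂ : Finset ℕ → Prop} {F : Finset ℕ} :
    F ∈ starFamily n k u v X q p₁ p₂ ↔ F ∈ kSubsets n k ∧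
      ((u ∈ F ∧ v ∈ F ∧ ((F ∩ X).Nonempty ∨ q F)) ∨ (u ∈ F ∧ X ⊆ F ∧ p₁ F) ∨
      (v ∈ F ∧ X ⊆ F ∧ p₂ F)) := by
  simp [starFamily]

theorem starFamily_subset (n k u v : ℕ) (X : Finset ℕ) (q p₁ p₂ : Finset ℕ → Prop) :
    starFamily n k u v X q p₁ p₂ ⊆ kSubsets n k := fun _ h => (mem_starFamily.1 h).1

/-- If neither `u` nor `v` is common to the three sets, one of them misses `u` and another misses
`v`, so both contain `X`. The third set meets `X`, or contains `X`, or satisfies `q`; only in the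
last case is `h` needed. -/
theorem starFamily_intersecting {n k u v : ℕ} {X : Finset ℕ} {q p₁ p₂ : Finset ℕ → Prop}
    (hX : X.Nonempty) (h : ∀ A B C, q A → p₁ B → p₂ C → ∃ x, x ∈ A ∧ x ∈ B ∧ x ∈ C) :
    DWiseIntersecting 3 (starFamily n k u v X q p₁ p₂) := by
  intro A hA
  simp only [mem_starFamily] at hA
  by_cases hu : ∀ i, u ∈ A i
  · exact ⟨u, hu⟩
  by_cases hv : ∀ i, v ∈ A i
  · exact ⟨v, hv⟩
  push Not at hu hv
  obtain ⟨i, hi⟩ := hu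
  obtain ⟨j, hj⟩ := hv
  have h2 : v ∈ A i ∧ X ⊆ A i ∧ p₂ (A i) := by have := (hA i).2; tauto
  have h1 : u ∈ A j ∧ X ⊆ A j ∧ p₁ (A j) := by have := (hA j).2; tauto
  have hij : i ≠ j := by rintro rfl; exact hi h1.1
  -- The remaining one of the three indices.
  obtain ⟨m, hm⟩ : ∃ m, ∀ t, t = i ∨ t = j ∨ t = m := by
    revert hij; clear * -; revert i j; decide
  obtain ⟨x, hxi, hxj, hxm⟩ : ∃ x, x ∈ A i ∧ x ∈ A j ∧ x ∈ A m := by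
    obtain ⟨y, hy⟩ := hX
    rcases (hA m).2 with ⟨-, -, ⟨x, hx⟩ | hq⟩ | ⟨-, hx, -⟩ | ⟨-, hx, -⟩
    · rw [mem_inter] at hx
      exact ⟨x, h2.2.1 hx.2, h1.2.1 hx.2, hx.1⟩
    · obtain ⟨x, hx, hx1, hx2⟩ := h _ _ _ hq h1.2.2 h2.2.2
      exact ⟨x, hx2, hx1, hx⟩
    · exact ⟨y, h2.2.1 hy, h1.2.1 hy, hx hy⟩
    · exact ⟨y, h2.2.1 hy, h1.2.1 hy, hx hy⟩
  refine ⟨x, fun t => ?_⟩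
  rcases hm t with rfl | rfl | rfl <;> assumption

/-- The conditions on the parameters of a star family that do not involve the predicates. -/
structure StarConfig (n k u v : ℕ) (X S : Finset ℕ) : Prop where
  u_mem : u ∈ Icc 1 n
  v_mem : v ∈ Icc 1 n
  ne : u ≠ v
  X_sub : X ⊆ Icc 1 n
  S_sub : S ⊆ Icc 1 n
  u_X : u ∉ X
  v_X : v ∉ X
  u_S : u ∉ S
  v_S : v ∉ S
  S_X : Disjoint S X
  S_card : S.card + 2 ≤ k
  X_card : 2 ≤ X.card
  X_card_le : X.card + 1 ≤ k
  n_large : 6 * k ≤ n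

/-- Conditions on the data of a star family that make it a maximal non-trivial `3`-wise
intersecting family: `p₁` and `p₂` are dual to each other on `S`. -/
structure StarData (n k u v : ℕ) (X S : Finset ℕ) (q p₁ p₂ : Finset ℕ → Prop) : Prop
    extends StarConfig n k u v X S where
  q_mono : ∀ A B, A ⊆ B → q A → q B
  p₁_mono : ∀ A B, A ⊆ B → p₁ A → p₁ B
  p₂_mono : ∀ A B, A ⊆ B → p₂ A → p₂ B
  inter : ∀ A B C, q A → p₁ B → p₂ C → ∃ x, x ∈ A ∧ x ∈ B ∧ x ∈ C
  not_q : ¬ q ∅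
  dual_q : ∀ A, ¬ q A → ∃ t₁ t₂, t₁ ⊆ S ∧ t₂ ⊆ S ∧ t₁.card + X.card + 1 ≤ k ∧
    t₂.card + X.card + 1 ≤ k ∧ p₁ t₁ ∧ p₂ t₂ ∧ ∀ x ∈ A, x ∈ t₁ → x ∉ t₂
  dual_p₁ : ∀ A, ¬ p₁ A → q S ∧ ∃ t, t ⊆ S ∧ t.card + X.card + 1 ≤ k ∧ p₂ t ∧ Disjoint t A
  dual_p₂ : ∀ A, ¬ p₂ A → q S ∧ ∃ t, t ⊆ S ∧ t.card + X.card + 1 ≤ k ∧ p₁ t ∧ Disjoint t A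

namespace StarData

variable {n k u v : ℕ} {X S : Finset ℕ} {q p₁ p₂ : Finset ℕ → Prop}

theorem symm (h : StarData n k u v X S q p₁ p₂) : StarData n k v u X S q p₂ p₁ where
  u_mem := h.v_mem
  v_mem := h.u_mem
  ne := h.ne.symm
  X_sub := h.X_sub
  S_sub := h.S_sub
  u_X := h.v_X
  v_X := h.u_X
  u_S := h.v_S
  v_S := h.u_S
  S_X := h.S_X
  S_card := h.S_card
  X_card := h.X_card
  X_card_le := h.X_card_le
  n_large := h.n_large
  q_mono := h.q_mono
  p₁_mono := h.p₂_mono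
  p₂_mono := h.p₁_mono
  inter A B C hA hB hC := by
    obtain ⟨x, h1, h2, h3⟩ := h.inter A C B hA hC hB
    exact ⟨x, h1, h3, h2⟩
  not_q := h.not_q
  dual_q A hA := by
    obtain ⟨t₁, t₂, h1, h2, h3, h4, h5, h6, h7⟩ := h.dual_q A hA
    exact ⟨t₂, t₁, h2, h1, h4, h3, h6, h5, fun x hx h8 h9 => h7 x hx h9 h8⟩
  dual_p₁ := h.dual_p₂
  dual_p₂ := h.dual_p₁

theorem comm (n k u v : ℕ) (X : Finset ℕ) (q p₁ p₂ : Finset ℕ → Prop) :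
    starFamily n k u v X q p₁ p₂ = starFamily n k v u X q p₂ p₁ := by
  ext F
  simp only [mem_starFamily]
  tauto

/-- Produces members missing `u` whose trace on `S` lies in a chosen `t` and whose trace on `W` is
controlled. With `exists_mem_of_X` and `exists_mem_of_q` these are the witnesses against adding a
new set. -/
theorem exists_mem_right (h : StarData n k u v X S q p₁ p₂) {t : Finset ℕ} (htS : t ⊆ S)
    (ht : t.card + X.card + 1 ≤ k) (hp : p₂ t) (W : Finset ℕ) (hW : W.card ≤ 3 * k) :
    ∃ C ∈ starFamily n k u v X q p₁ p₂, u ∉ C ∧ v ∈ C ∧ X ⊆ C ∧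
      (∀ x ∈ C, x ∈ W → x = v ∨ x ∈ X ∨ x ∈ t) ∧ (∀ x ∈ C, x ∈ S → x ∈ t) := by
  have hk : (insert v (X ∪ t)).card ≤ k := by
    have := card_insert_le v (X ∪ t)
    have := card_union_le X t
    omega
  have hWc : (insert u (W ∪ S)).card + k ≤ n := by
    have := card_insert_le u (W ∪ S)
    have := card_union_le W S
    have := h.S_card
    have := h.n_large
    omega
  obtain ⟨C, hC, hPC, hav⟩ := exists_kSubset_avoiding (insert u (W ∪ S))
    (insert_subset h.v_mem (union_subset h.X_sub (htS.trans h.S_sub))) hk hWc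
  have hv : v ∈ C := hPC (by simp)
  have hX : X ⊆ C := fun x hx => hPC (by simp [hx])
  have ht' : t ⊆ C := fun x hx => hPC (by simp [hx])
  refine ⟨C, mem_starFamily.2 ⟨hC, Or.inr (Or.inr ⟨hv, hX, h.p₂_mono _ _ ht' hp⟩)⟩, ?_, hv, hX,
    ?_, ?_⟩
  · intro hu
    have := hav u hu (by simp)
    simp only [mem_insert, mem_union] at this
    rcases this with h1 | h1 | h1
    · exact h.ne h1
    · exact h.u_X h1
    · exact h.u_S (htS h1)
  · intro x hx hxW
    simpa using hav x hx (by simp [hxW])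
  · intro x hx hxS
    have := hav x hx (by simp [hxS])
    simp only [mem_insert, mem_union] at this
    rcases this with h1 | h1 | h1
    · exact absurd (h1 ▸ hxS) h.v_S
    · exact absurd h1 (disjoint_left.1 h.S_X hxS)
    · exact h1

theorem exists_mem_of_X (h : StarData n k u v X S q p₁ p₂) {x : ℕ} (hx : x ∈ X) (W : Finset ℕ)
    (hW : W.card ≤ 3 * k) :
    ∃ D ∈ starFamily n k u v X q p₁ p₂, ∀ y ∈ D, y ∈ W → y = u ∨ y = v ∨ y = x := by
  have := h.S_card
  have := h.X_card
  have := h.X_card_le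
  have := h.n_large
  obtain ⟨D, hD, hPD, hav⟩ := exists_kSubset_avoiding (P := {u, v, x}) (k := k) (n := n) W
    (by simp only [insert_subset_iff, singleton_subset_iff]
        exact ⟨h.u_mem, h.v_mem, h.X_sub hx⟩)
    (card_le_three.trans (by omega)) (by omega)
  refine ⟨D, mem_starFamily.2 ⟨hD, Or.inl ⟨hPD (by simp), hPD (by simp), Or.inl ⟨x, ?_⟩⟩⟩, ?_⟩
  · exact mem_inter.2 ⟨hPD (by simp), hx⟩
  · intro y hy hyW
    simpa using hav y hy hyW

theorem exists_mem_of_q (h : StarData n k u v X S q p₁ p₂) (hq : q S) (W : Finset ℕ)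
    (hW : W.card ≤ 3 * k) :
    ∃ D ∈ starFamily n k u v X q p₁ p₂, ∀ y ∈ D, y ∈ W → y = u ∨ y = v ∨ y ∈ S := by
  have h1 := card_insert_le u (insert v S)
  have h2 := card_insert_le v S
  have := h.S_card
  have := h.n_large
  obtain ⟨D, hD, hPD, hav⟩ := exists_kSubset_avoiding (P := insert u (insert v S)) (k := k) (n := n)
    W (insert_subset h.u_mem (insert_subset h.v_mem h.S_sub)) (by omega) (by omega)
  refine ⟨D, mem_starFamily.2 ⟨hD, Or.inl ⟨hPD (by simp), hPD (by simp), Or.inr ?_⟩⟩, ?_⟩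
  · exact h.q_mono _ _ (fun y hy => hPD (by simp [hy])) hq
  · intro y hy hyW
    simpa using hav y hy hyW

theorem exists_missing_u (h : StarData n k u v X S q p₁ p₂) :
    ∃ C ∈ starFamily n k u v X q p₁ p₂, u ∉ C := by
  -- The empty set fails `q`, so `dual_q` supplies at least one admissible `t₂`.
  obtain ⟨t₁, t₂, -, h2, -, h4, -, h6, -⟩ := h.dual_q ∅ h.not_q
  obtain ⟨C, hC, hu, -⟩ := h.exists_mem_right h2 h4 h6 ∅ (by simp)
  exact ⟨C, hC, hu⟩

theorem exists_missing_v (h : StarData n k u v X S q p₁ p₂) :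
    ∃ C ∈ starFamily n k u v X q p₁ p₂, v ∉ C := by
  rw [comm]
  exact h.symm.exists_missing_u

theorem separate_aux (h : StarData n k u v X S q p₁ p₂) {A : Finset ℕ} (hA : A ∈ kSubsets n k)
    (hn : A ∉ starFamily n k u v X q p₁ p₂) (hu : u ∈ A) (hv : v ∉ A) :
    ∃ C ∈ starFamily n k u v X q p₁ p₂, ∃ D ∈ starFamily n k u v X q p₁ p₂,
      ∀ x ∈ A, x ∈ C → x ∉ D := by
  have hc := (mem_kSubsets.1 hA).2
  by_cases hX : X ⊆ A
  · have hp : ¬ p₁ A := fun hp => hn (mem_starFamily.2 ⟨hA, Or.inr (Or.inl ⟨hu, hX, hp⟩)⟩)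
    obtain ⟨hq, t, htS, htc, hp2, hd⟩ := h.dual_p₁ A hp
    obtain ⟨C, hC, huC, hvC, hXC, hCW, hCS⟩ := h.exists_mem_right htS htc hp2 A (by omega)
    obtain ⟨D, hD, hDW⟩ := h.exists_mem_of_q hq A (by omega)
    refine ⟨C, hC, D, hD, fun x hxA hxC hxD => ?_⟩
    rcases hDW x hxD hxA with rfl | rfl | h1
    · exact huC hxC
    · exact hv hxA
    · exact disjoint_left.1 hd (hCS x hxC h1) hxA
  · obtain ⟨x, hxX, hxA⟩ := not_subset.1 hX
    obtain ⟨C, hC, huC⟩ := h.exists_missing_u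
    obtain ⟨D, hD, hDW⟩ := h.exists_mem_of_X hxX A (by omega)
    refine ⟨C, hC, D, hD, fun y hyA hyC hyD => ?_⟩
    rcases hDW y hyD hyA with rfl | rfl | rfl
    · exact huC hyC
    · exact hv hyA
    · exact hxA hyA

/-- Each way of failing membership is answered by a dual pair: failing `q` by two tails that do not
meet inside the set and `S`, failing `p₁` or `p₂` by one tail and one member through `u`, `v`, `S`,
and failing to contain `X` by a member through a missing point of `X`. -/
theorem separate (h : StarData n k u v X S q p₁ p₂) {A : Finset ℕ} (hA : A ∈ kSubsets n k)
    (hn : A ∉ starFamily n k u v X q p₁ p₂) :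
    ∃ C ∈ starFamily n k u v X q p₁ p₂, ∃ D ∈ starFamily n k u v X q p₁ p₂,
      ∀ x ∈ A, x ∈ C → x ∉ D := by
  have hc := (mem_kSubsets.1 hA).2
  by_cases hu : u ∈ A <;> by_cases hv : v ∈ A
  · have hXA : ¬ (A ∩ X).Nonempty := fun hX =>
      hn (mem_starFamily.2 ⟨hA, Or.inl ⟨hu, hv, Or.inl hX⟩⟩)
    have hq : ¬ q A := fun hX => hn (mem_starFamily.2 ⟨hA, Or.inl ⟨hu, hv, Or.inr hX⟩⟩)
    have hXA' : ∀ x ∈ A, x ∉ X := fun x hx hxX => hXA ⟨x, mem_inter.2 ⟨hx, hxX⟩⟩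
    obtain ⟨t₁, t₂, h1, h2, h3, h4, h5, h6, h7⟩ := h.dual_q A hq
    obtain ⟨C, hC, huC, hvC, hXC, hCW, hCS⟩ := h.exists_mem_right h2 h4 h6 A (by omega)
    obtain ⟨D, hD, hvD, huD, hXD, hDW, hDS⟩ := h.symm.exists_mem_right h1 h3 h5 A (by omega)
    refine ⟨C, hC, D, by rwa [comm], fun x hxA hxC hxD => ?_⟩
    rcases hCW x hxC hxA with rfl | h' | h'
    · exact hvD hxD
    · exact hXA' x hxA h'
    · exact h7 x hxA (hDS x hxD (h2 h')) h'
  · exact h.separate_aux hA hn hu hv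
  · rw [comm] at hn ⊢
    exact h.symm.separate_aux hA hn hv hu
  -- A set missing both `u` and `v` meets the two members chosen here at most in `x` and at most in
  -- `y`, respectively.
  · obtain ⟨x, hx, y, hy, hxy⟩ := one_lt_card.1 h.X_card
    obtain ⟨C, hC, hCW⟩ := h.exists_mem_of_X hx A (by omega)
    obtain ⟨D, hD, hDW⟩ := h.exists_mem_of_X hy A (by omega)
    refine ⟨C, hC, D, hD, fun z hzA hzC hzD => ?_⟩
    rcases hCW z hzC hzA with rfl | rfl | rfl
    · exact hu hzA
    · exact hv hzA
    · rcases hDW z hzD hzA with rfl | rfl | rfl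
      · exact hu hzA
      · exact hv hzA
      · exact hxy rfl

theorem isMaxNontrivial (h : StarData n k u v X S q p₁ p₂) :
    IsMaxNontrivial n k 3 (starFamily n k u v X q p₁ p₂) where
  uniform := starFamily_subset ..
  intersecting := starFamily_intersecting (card_pos.1 (by have := h.X_card; omega)) h.inter
  nontrivial := by
    rintro ⟨y, -, hy⟩
    have := h.X_card_le
    obtain ⟨x, hx, x', hx', hne⟩ := one_lt_card.1 h.X_card
    have := h.X_card
    obtain ⟨C, hC, hCW⟩ := h.exists_mem_of_X hx {y} (by simp; omega)
    obtain ⟨D, hD, hDW⟩ := h.exists_mem_of_X hx' {y} (by simp; omega)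
    obtain ⟨A, hA, huA⟩ := h.exists_missing_u
    obtain ⟨B, hB, hvB⟩ := h.exists_missing_v
    rcases hCW y (hy C hC) (by simp) with rfl | rfl | rfl
    · exact huA (hy A hA)
    · exact hvB (hy B hB)
    · rcases hDW y (hy D hD) (by simp) with rfl | rfl | rfl
      · exact huA (hy A hA)
      · exact hvB (hy B hB)
      · exact hne rfl
  maximal := by
    intro A hA hn hi
    obtain ⟨C, hC, D, hD, hACD⟩ := h.separate hA hn
    rw [dWiseIntersecting_three] at hi
    obtain ⟨x, h1, h2, h3⟩ := hi A (by simp) C (by simp [hC]) D (by simp [hD])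
    exact hACD x h1 h2 h3

end StarData

/-- The family `𝓗`, with the roles of `1`, `2` and `[3, l + 2]` played by `u`, `v` and `X`. -/
noncomputable def starH (n k u v : ℕ) (X : Finset ℕ) : Finset (Finset ℕ) :=
  starFamily n k u v X (fun _ => False) (fun _ => True) (fun _ => True)

/-- The family `𝓖`, with the roles of `1`, `2`, `[3, k - 1]`, `k`, `k + 1` played by
`u`, `v`, `X`, `a`, `b`. -/
noncomputable def starG (n k u v : ℕ) (X : Finset ℕ) (a b : ℕ) : Finset (Finset ℕ) :=
  starFamily n k u v X (fun F => a ∈ F ∧ b ∈ F) (fun F => a ∈ F ∧ b ∈ F) (fun F => a ∈ F ∨ b ∈ F)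

/-- The family `𝓢`, with the roles of `1`, `2`, `[3, k - 1]`, `k`, `k + 1`, `k + 2` played by
`u`, `v`, `X`, `a`, `b`, `c`. -/
noncomputable def starS (n k u v : ℕ) (X : Finset ℕ) (a b c : ℕ) : Finset (Finset ℕ) :=
  starFamily n k u v X (fun F => a ∈ F ∧ b ∈ F ∧ c ∈ F)
    (fun F => (a ∈ F ∧ b ∈ F) ∨ (a ∈ F ∧ c ∈ F) ∨ (b ∈ F ∧ c ∈ F))
    (fun F => (a ∈ F ∧ b ∈ F) ∨ (a ∈ F ∧ c ∈ F) ∨ (b ∈ F ∧ c ∈ F))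

/-- The family `𝓢₁`, with the roles of `1`, `2`, `[3, k - 1]`, `k`, `k + 1`, `k + 2` played by
`u`, `v`, `X`, `a`, `b`, `c`. -/
noncomputable def starS₁ (n k u v : ℕ) (X : Finset ℕ) (a b c : ℕ) : Finset (Finset ℕ) :=
  starFamily n k u v X (fun F => a ∈ F ∧ b ∈ F ∧ c ∈ F)
    (fun F => a ∈ F ∧ (b ∈ F ∨ c ∈ F)) (fun F => a ∈ F ∨ (b ∈ F ∧ c ∈ F))

/-! ### The duality conditions for the four model families -/

section StarDataInstances

variable {n k u v : ℕ} {X : Finset ℕ}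

theorem starData_H (h : StarConfig n k u v X ∅) :
    StarData n k u v X ∅ (fun _ => False) (fun _ => True) (fun _ => True) where
  toStarConfig := h
  q_mono _ _ _ h := h
  p₁_mono _ _ _ h := h
  p₂_mono _ _ _ h := h
  inter _ _ _ h := h.elim
  not_q h := h
  dual_q A _ := by
    refine ⟨∅, ∅, ?_⟩
    have := h.X_card_le
    simp [this]
  dual_p₁ _ h := absurd trivial h
  dual_p₂ _ h := absurd trivial h

/-- "Both of `a`, `b`" and "one of `a`, `b`" are dual: a set fails one of them exactly when its
complement satisfies the other. The slack in `hX` leaves room for two points of `S` in a tail. -/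
theorem starData_G {a b : ℕ} (hX : X.card + 3 ≤ k)
    (h : StarConfig n k u v X {a, b}) :
    StarData n k u v X {a, b} (fun F => a ∈ F ∧ b ∈ F) (fun F => a ∈ F ∧ b ∈ F)
      (fun F => a ∈ F ∨ b ∈ F) where
  toStarConfig := h
  q_mono _ _ hs h := ⟨hs h.1, hs h.2⟩
  p₁_mono _ _ hs h := ⟨hs h.1, hs h.2⟩
  p₂_mono _ _ hs h := h.imp (fun h => hs h) (fun h => hs h)
  inter _ _ _ := by
    rintro ⟨h1, h2⟩ ⟨h3, h4⟩ (h5 | h5)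
    · exact ⟨a, h1, h3, h5⟩
    · exact ⟨b, h2, h4, h5⟩
  not_q := by simp
  dual_q A hA := by
    have h2 : ({a, b} : Finset ℕ).card ≤ 2 := card_le_two
    by_cases ha : a ∈ A
    · have hb : b ∉ A := fun hb => hA ⟨ha, hb⟩
      refine ⟨{a, b}, {b}, by simp, by simp, by omega, by simp; omega, by simp, by simp, ?_⟩
      rintro x hx - h
      rw [mem_singleton] at h
      exact hb (h ▸ hx)
    · refine ⟨{a, b}, {a}, by simp, by simp, by omega, by simp; omega, by simp, by simp, ?_⟩
      rintro x hx - h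
      rw [mem_singleton] at h
      exact ha (h ▸ hx)
  dual_p₁ A hA := by
    refine ⟨by simp, ?_⟩
    by_cases ha : a ∈ A
    · have hb : b ∉ A := fun hb => hA ⟨ha, hb⟩
      exact ⟨{b}, by simp, by simp; omega, by simp, by simpa⟩
    · exact ⟨{a}, by simp, by simp; omega, by simp, by simpa⟩
  dual_p₂ A hA := by
    push Not at hA
    have h2 : ({a, b} : Finset ℕ).card ≤ 2 := card_le_two
    exact ⟨by simp, {a, b}, by simp, by omega, by simp, by simp [hA.1, hA.2]⟩

/-- The majority condition on three points is self-dual. -/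
theorem starData_S {a b c : ℕ} (hX : X.card + 3 ≤ k) (hab : a ≠ b) (hac : a ≠ c) (hbc : b ≠ c)
    (h : StarConfig n k u v X {a, b, c}) :
    StarData n k u v X {a, b, c} (fun F => a ∈ F ∧ b ∈ F ∧ c ∈ F)
      (fun F => (a ∈ F ∧ b ∈ F) ∨ (a ∈ F ∧ c ∈ F) ∨ (b ∈ F ∧ c ∈ F))
      (fun F => (a ∈ F ∧ b ∈ F) ∨ (a ∈ F ∧ c ∈ F) ∨ (b ∈ F ∧ c ∈ F)) := by
  have hm : ∀ A B : Finset ℕ, A ⊆ B →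
      ((a ∈ A ∧ b ∈ A) ∨ (a ∈ A ∧ c ∈ A) ∨ (b ∈ A ∧ c ∈ A)) →
      ((a ∈ B ∧ b ∈ B) ∨ (a ∈ B ∧ c ∈ B) ∨ (b ∈ B ∧ c ∈ B)) := by
    intro A B hs
    have := @hs a; have := @hs b; have := @hs c
    tauto
  have h2 : ∀ x y : ℕ, ({x, y} : Finset ℕ).card + X.card + 1 ≤ k := fun x y => by
    have : ({x, y} : Finset ℕ).card ≤ 2 := card_le_two
    omega
  have hd : ∀ A : Finset ℕ,
      ¬ ((a ∈ A ∧ b ∈ A) ∨ (a ∈ A ∧ c ∈ A) ∨ (b ∈ A ∧ c ∈ A)) →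
      (a ∈ ({a, b, c} : Finset ℕ) ∧ b ∈ ({a, b, c} : Finset ℕ) ∧ c ∈ ({a, b, c} : Finset ℕ)) ∧
      ∃ t : Finset ℕ, t ⊆ {a, b, c} ∧ t.card + X.card + 1 ≤ k ∧
        ((a ∈ t ∧ b ∈ t) ∨ (a ∈ t ∧ c ∈ t) ∨ (b ∈ t ∧ c ∈ t)) ∧ Disjoint t A := by
    intro A hA
    refine ⟨by simp, ?_⟩
    by_cases ha : a ∈ A
    · exact ⟨{b, c}, by simp, h2 _ _, by simp, by simp; tauto⟩
    · by_cases hb : b ∈ A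
      · exact ⟨{a, c}, by simp [insert_subset_iff], h2 _ _, by simp, by simp; tauto⟩
      · exact ⟨{a, b}, by simp [insert_subset_iff], h2 _ _, by simp, by simp; tauto⟩
  refine ⟨h, ?_, hm, hm, ?_, by simp, ?_, hd, hd⟩
  · exact fun A B hs h => ⟨hs h.1, hs h.2.1, hs h.2.2⟩
  · intro A B C hA hB hC
    by_contra hx
    push Not at hx
    have := hx a; have := hx b; have := hx c
    tauto
  · intro A hA
    by_cases ha : a ∈ A
    · by_cases hb : b ∈ A
      · refine ⟨{c, a}, {c, b}, by simp [insert_subset_iff], by simp [insert_subset_iff], h2 _ _,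
          h2 _ _, by simp, by simp, ?_⟩
        simp only [mem_insert, mem_singleton]
        rintro x hx (rfl | rfl) <;> tauto
      · refine ⟨{b, a}, {b, c}, by simp [insert_subset_iff], by simp, h2 _ _,
          h2 _ _, by simp, by simp, ?_⟩
        simp only [mem_insert, mem_singleton]
        rintro x hx (rfl | rfl) <;> tauto
    · refine ⟨{a, b}, {a, c}, by simp [insert_subset_iff], by simp [insert_subset_iff], h2 _ _,
          h2 _ _, by simp, by simp, ?_⟩
      simp only [mem_insert, mem_singleton]
      rintro x hx (rfl | rfl) <;> tauto

/-- The dual of `a ∧ (b ∨ c)` is `a ∨ (b ∧ c)`. -/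
theorem starData_S₁ {a b c : ℕ} (hX : X.card + 3 ≤ k) (hab : a ≠ b) (hac : a ≠ c) (hbc : b ≠ c)
    (h : StarConfig n k u v X {a, b, c}) :
    StarData n k u v X {a, b, c} (fun F => a ∈ F ∧ b ∈ F ∧ c ∈ F)
      (fun F => a ∈ F ∧ (b ∈ F ∨ c ∈ F)) (fun F => a ∈ F ∨ (b ∈ F ∧ c ∈ F)) := by
  have h2 : ∀ x y : ℕ, ({x, y} : Finset ℕ).card + X.card + 1 ≤ k := fun x y => by
    have : ({x, y} : Finset ℕ).card ≤ 2 := card_le_two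
    omega
  have h1 : ∀ x : ℕ, ({x} : Finset ℕ).card + X.card + 1 ≤ k := fun x => by
    rw [card_singleton]
    omega
  refine ⟨h, ?_, ?_, ?_, ?_, by simp, ?_, ?_, ?_⟩
  · exact fun A B hs h => ⟨hs h.1, hs h.2.1, hs h.2.2⟩
  · exact fun A B hs h => ⟨hs h.1, h.2.imp (fun h => hs h) (fun h => hs h)⟩
  · exact fun A B hs h => h.imp (fun h => hs h) (fun h => ⟨hs h.1, hs h.2⟩)
  · intro A B C hA hB hC
    by_contra hx
    push Not at hx
    have := hx a; have := hx b; have := hx c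
    tauto
  · intro A hA
    by_cases ha : a ∈ A
    · by_cases hb : b ∈ A
      · refine ⟨{a, c}, {b, c}, by simp [insert_subset_iff], by simp, h2 _ _,
          h2 _ _, by simp, by simp, ?_⟩
        simp only [mem_insert, mem_singleton]
        rintro x hx (rfl | rfl) <;> tauto
      · refine ⟨{a, b}, {b, c}, by simp [insert_subset_iff], by simp, h2 _ _,
          h2 _ _, by simp, by simp, ?_⟩
        simp only [mem_insert, mem_singleton]
        rintro x hx (rfl | rfl) <;> tauto
    · refine ⟨{a, b}, {a}, by simp [insert_subset_iff], by simp, h2 _ _,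
          h1 _, by simp, by simp, ?_⟩
      simp only [mem_insert, mem_singleton]
      rintro x hx (rfl | rfl) <;> tauto
  · intro A hA
    refine ⟨by simp, ?_⟩
    by_cases ha : a ∈ A
    · exact ⟨{b, c}, by simp, h2 _ _, by simp, by simp; tauto⟩
    · exact ⟨{a}, by simp, h1 _, by simp, by simpa⟩
  · intro A hA
    refine ⟨by simp, ?_⟩
    by_cases hb : b ∈ A
    · exact ⟨{a, c}, by simp [insert_subset_iff], h2 _ _, by simp, by simp; tauto⟩
    · exact ⟨{a, b}, by simp [insert_subset_iff], h2 _ _, by simp, by simp; tauto⟩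

end StarDataInstances

/-! ### The families of the statement are star families -/

theorem card_Icc_one_two_inter (F : Finset ℕ) :
    (Icc 1 2 ∩ F).card = 1 ↔ (1 ∈ F ∧ 2 ∉ F) ∨ (1 ∉ F ∧ 2 ∈ F) := by
  have : Icc 1 2 = ({1, 2} : Finset ℕ) := rfl
  rw [this]
  by_cases h1 : 1 ∈ F <;> by_cases h2 : 2 ∈ F <;>
    simp [insert_inter_of_mem, insert_inter_of_notMem, singleton_inter_of_mem,
      singleton_inter_of_notMem, h1, h2]

theorem Icc_one_two_subset (F : Finset ℕ) : Icc 1 2 ⊆ F ↔ 1 ∈ F ∧ 2 ∈ F := by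
  have : Icc 1 2 = ({1, 2} : Finset ℕ) := rfl
  rw [this]
  simp [insert_subset_iff]

theorem familyH_eq (n k l : ℕ) (hl : 1 ≤ l) :
    familyH n k 3 l = starH n k 1 2 (Icc 3 (l + 2)) := by
  ext F
  have h3 : 3 + l - 1 = l + 2 := by omega
  have hX : Icc 3 (l + 2) ⊆ F → (F ∩ Icc 3 (l + 2)).Nonempty := fun h =>
    ⟨3, mem_inter.2 ⟨h (by simp; omega), by simp; omega⟩⟩
  simp only [familyH, starH, mem_starFamily, mem_union, mem_filter, h3, Nat.add_one_sub_one,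
    Nat.reduceSub, card_Icc_one_two_inter, Icc_one_two_subset]
  tauto

theorem exists_eq_insert {P F : Finset ℕ} (h : P ⊆ F) (hc : F.card = P.card + 1) :
    ∃ i ∈ F, i ∉ P ∧ F = insert i P := by
  have : (F \ P).card = 1 := by rw [card_sdiff_of_subset h]; omega
  obtain ⟨i, hi⟩ := card_eq_one.1 this
  have h1 : i ∈ F \ P := by simp [hi]
  rw [mem_sdiff] at h1
  refine ⟨i, h1.1, h1.2, ?_⟩
  rw [← sdiff_union_of_subset h, hi]
  rfl

/-- A tail has two places left besides `X` and its point of `{1, 2}`. The condition on the tails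
missing `1` fills one of them, so these sets are listed by a single free point `i`. The ranges of
`i` omit `k` and `k + 1` because sets with both belong to the last piece. -/
theorem familyG_eq (n k : ℕ) (hk : 5 ≤ k) :
    familyG n k 3 = starG n k 1 2 (Icc 3 (k - 1)) k (k + 1) := by
  ext F
  have hX : Icc 3 (k - 1) ⊆ F → (F ∩ Icc 3 (k - 1)).Nonempty := fun h =>
    ⟨3, mem_inter.2 ⟨h (by simp; omega), by simp; omega⟩⟩
  simp only [familyG, starG, mem_starFamily, mem_union, mem_filter, mem_image, Nat.add_one_sub_one,
    Nat.reduceSub, card_Icc_one_two_inter, union_subset_iff, Icc_one_two_subset]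
  constructor
  · rintro ((((h | ⟨i, hi, rfl⟩) | h) | ⟨i, hi, rfl⟩) | ⟨hF, h1, h2⟩)
    · exact ⟨h.1, Or.inl ⟨h.2.1.1, h.2.1.2, Or.inl h.2.2⟩⟩
    · simp only [mem_Icc] at hi
      refine ⟨mem_kSubsets.2 ⟨?_, ?_⟩, Or.inr (Or.inr ⟨?_, ?_, Or.inl ?_⟩)⟩
      · intro x; simp; omega
      · rw [card_union_of_disjoint (by simp; omega)]; simp; omega
      · simp; omega
      · intro x; simp; omega
      · simp; omega
    · have h1 : k ∈ F := h.2.2 (by simp)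
      have h2 : k + 1 ∈ F := h.2.2 (by simp)
      exact ⟨h.1, Or.inl ⟨h.2.1.1, h.2.1.2, Or.inr ⟨h1, h2⟩⟩⟩
    · simp only [mem_Icc] at hi
      refine ⟨mem_kSubsets.2 ⟨?_, ?_⟩, Or.inr (Or.inr ⟨?_, ?_, Or.inr ?_⟩)⟩
      · intro x; simp; omega
      · rw [card_union_of_disjoint (by simp; omega), card_pair (by omega)]; simp; omega
      · simp; omega
      · intro x; simp; omega
      · simp
    · have h3 : k ∈ F := h2 (by simp; omega)
      have h4 : k + 1 ∈ F := h2 (by simp; omega)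
      have h5 : Icc 3 (k - 1) ⊆ F := (Icc_subset_Icc_right (by omega)).trans h2
      rcases h1 with h1 | h1
      · exact ⟨hF, Or.inr (Or.inl ⟨h1.1, h5, h3, h4⟩)⟩
      · exact ⟨hF, Or.inr (Or.inr ⟨h1.2, h5, Or.inl h3⟩)⟩
  · rintro ⟨hF, h⟩
    have hF' := mem_kSubsets.1 hF
    have h35 : k ∈ F → k + 1 ∈ F → Icc 3 (k - 1) ⊆ F → Icc 3 (k + 1) ⊆ F := by
      intro h1 h2 h3 x hx
      by_cases hx1 : x ≤ k - 1
      · exact h3 (by simp at hx ⊢; omega)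
      · have : x = k ∨ x = k + 1 := by simp at hx; omega
        rcases this with rfl | rfl <;> assumption
    have h01 : k ∈ F → k + 1 ∈ F → Icc k (k + 1) ⊆ F := by
      intro h1 h2 x hx
      have : x = k ∨ x = k + 1 := by simp at hx; omega
      rcases this with rfl | rfl <;> assumption
    rcases h with ⟨h1, h2, h3 | h3⟩ | ⟨h1, h2, h3, h4⟩ | ⟨h2, h3, h4⟩
    · exact Or.inl (Or.inl (Or.inl (Or.inl ⟨hF, ⟨h1, h2⟩, h3⟩)))
    · exact Or.inl (Or.inl (Or.inr ⟨hF, ⟨h1, h2⟩, h01 h3.1 h3.2⟩))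
    · by_cases h5 : 2 ∈ F
      · exact Or.inl (Or.inl (Or.inl (Or.inl ⟨hF, ⟨h1, h5⟩, hX h2⟩)))
      · exact Or.inr ⟨hF, Or.inl ⟨h1, h5⟩, h35 h3 h4 h2⟩
    · by_cases h1 : 1 ∈ F
      · exact Or.inl (Or.inl (Or.inl (Or.inl ⟨hF, ⟨h1, h2⟩, hX h3⟩)))
      by_cases h5 : k ∈ F
      · by_cases h6 : k + 1 ∈ F
        · exact Or.inr ⟨hF, Or.inr ⟨h1, h2⟩, h35 h5 h6 h3⟩
        · obtain ⟨i, hiF, hi, rfl⟩ := exists_eq_insert (P := Icc 2 k) (F := F) (by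
            intro x hx
            by_cases hx1 : x = 2
            · rwa [hx1]
            by_cases hx2 : x = k
            · rwa [hx2]
            exact h3 (by simp at hx ⊢; omega)) (by rw [hF'.2]; simp; omega)
          refine Or.inl (Or.inl (Or.inl (Or.inr ⟨i, ?_, ?_⟩)))
          · have := hF'.1 hiF
            have h7 : i ≠ 1 := by rintro rfl; exact h1 hiF
            have h8 : i ≠ k + 1 := by rintro rfl; exact h6 hiF
            simp at this hi ⊢; omega
          · ext x; simp
      · have h6 : k + 1 ∈ F := h4.resolve_left h5
        obtain ⟨i, hiF, hi, rfl⟩ := exists_eq_insert (P := insert (k + 1) (Icc 2 (k - 1))) (F := F) (by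
            intro x hx
            by_cases hx1 : x = 2
            · rwa [hx1]
            by_cases hx2 : x = k + 1
            · rwa [hx2]
            exact h3 (by simp at hx ⊢; omega))
            (by rw [hF'.2, card_insert_of_notMem (by simp)]; simp; omega)
        refine Or.inl (Or.inr ⟨i, ?_, ?_⟩)
        · have := hF'.1 hiF
          have h7 : i ≠ 1 := by rintro rfl; exact h1 hiF
          have h8 : i ≠ k := by rintro rfl; exact h5 hiF
          simp at this hi ⊢; omega
        · ext x
          simp only [mem_union, mem_insert, mem_singleton]
          clear * -
          tauto

theorem card_Icc_inter_eq_two (k : ℕ) (F : Finset ℕ) :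
    (Icc k (k + 2) ∩ F).card = 2 ↔ ¬ (k ∈ F ∧ k + 1 ∈ F ∧ k + 2 ∈ F) ∧
      ((k ∈ F ∧ k + 1 ∈ F) ∨ (k ∈ F ∧ k + 2 ∈ F) ∨ (k + 1 ∈ F ∧ k + 2 ∈ F)) := by
  have : Icc k (k + 2) = ({k, k + 1, k + 2} : Finset ℕ) := by ext x; simp; omega
  rw [this]
  by_cases h1 : k ∈ F <;> by_cases h2 : k + 1 ∈ F <;> by_cases h3 : k + 2 ∈ F <;>
    simp [insert_inter_of_mem, insert_inter_of_notMem, singleton_inter_of_mem,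
      singleton_inter_of_notMem, h1, h2, h3]

theorem Icc_add_two_subset (k : ℕ) (F : Finset ℕ) :
    Icc k (k + 2) ⊆ F ↔ k ∈ F ∧ k + 1 ∈ F ∧ k + 2 ∈ F := by
  have : Icc k (k + 2) = ({k, k + 1, k + 2} : Finset ℕ) := by ext x; simp; omega
  rw [this]
  simp [insert_subset_iff]

theorem familyS_eq (n k : ℕ) (hk : 5 ≤ k) :
    familyS n k = starS n k 1 2 (Icc 3 (k - 1)) k (k + 1) (k + 2) := by
  ext F
  have h12 : Icc 1 2 = ({1, 2} : Finset ℕ) := rfl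
  simp only [familyS, starS, mem_starFamily, mem_union, mem_filter, union_subset_iff,
    Icc_one_two_subset, Icc_add_two_subset, mem_biUnion, card_Icc_inter_eq_two,
    singleton_subset_iff]
  simp only [h12, mem_insert, mem_singleton, exists_eq_or_imp, exists_eq_left]
  -- A tail already has `k - 2` points in `{i} ∪ [3, k - 1]`, so it cannot hold all of `k`, `k + 1`,
  -- `k + 2`: "exactly two" and "at least two" agree.
  have hmany : ∀ i, i = 1 ∨ i = 2 → F ∈ kSubsets n k → i ∈ F → Icc 3 (k - 1) ⊆ F →
      ¬ (k ∈ F ∧ k + 1 ∈ F ∧ k + 2 ∈ F) := by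
    rintro i hi hF h1 h2 h3
    have hle := card_le_card (s := insert i (Icc 3 (k + 2))) (t := F) (by
      intro x hx
      by_cases hx1 : x = i
      · rwa [hx1]
      by_cases hx2 : x ≤ k - 1
      · exact h2 (by simp at hx ⊢; omega)
      have : x = k ∨ x = k + 1 ∨ x = k + 2 := by simp at hx; omega
      rcases this with rfl | rfl | rfl
      · exact h3.1
      · exact h3.2.1
      · exact h3.2.2)
    rw [card_insert_of_notMem (by simp; omega), (mem_kSubsets.1 hF).2] at hle
    rw [Nat.card_Icc] at hle
    omega
  have hm1 := hmany 1 (by simp)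
  have hm2 := hmany 2 (by simp)
  constructor
  · rintro ((h | h) | h | h)
    · exact ⟨h.1, Or.inl ⟨h.2.1.1, h.2.1.2, Or.inl h.2.2⟩⟩
    · exact ⟨h.1, Or.inl ⟨h.2.1.1, h.2.1.2, Or.inr h.2.2⟩⟩
    · exact ⟨h.1, Or.inr (Or.inl ⟨h.2.1.1, h.2.1.2, h.2.2.2⟩)⟩
    · exact ⟨h.1, Or.inr (Or.inr ⟨h.2.1.1, h.2.1.2, h.2.2.2⟩)⟩
  · rintro ⟨hF, ⟨h1, h2, h3 | h3⟩ | h | h⟩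
    · exact Or.inl (Or.inl ⟨hF, ⟨h1, h2⟩, h3⟩)
    · exact Or.inl (Or.inr ⟨hF, ⟨h1, h2⟩, h3⟩)
    · exact Or.inr (Or.inl ⟨hF, ⟨h.1, h.2.1⟩, hm1 hF h.1 h.2.1, h.2.2⟩)
    · exact Or.inr (Or.inr ⟨hF, ⟨h.1, h.2.1⟩, hm2 hF h.1 h.2.1, h.2.2⟩)

/-- The tails containing `k` and missing `1` have one free point. In each other case the condition
fills both free places, which gives the three sets listed singly. -/
theorem familyS₁_eq (n k : ℕ) (hk : 5 ≤ k) (hn : k + 2 ≤ n) :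
    familyS₁ n k = starS₁ n k 1 2 (Icc 3 (k - 1)) k (k + 1) (k + 2) := by
  ext F
  have hX : Icc 3 (k - 1) ⊆ F → (F ∩ Icc 3 (k - 1)).Nonempty := fun h =>
    ⟨3, mem_inter.2 ⟨h (by simp; omega), by simp; omega⟩⟩
  simp only [familyS₁, starS₁, mem_starFamily, mem_union, mem_filter, union_subset_iff,
    Icc_one_two_subset, Icc_add_two_subset, mem_image, mem_insert, mem_singleton]
  constructor
  · rintro (((h | h) | ⟨i, hi, rfl⟩) | (rfl | rfl | rfl))
    · exact ⟨h.1, Or.inl ⟨h.2.1.1, h.2.1.2, Or.inl h.2.2⟩⟩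
    · exact ⟨h.1, Or.inl ⟨h.2.1.1, h.2.1.2, Or.inr h.2.2⟩⟩
    · simp only [mem_Icc] at hi
      refine ⟨mem_kSubsets.2 ⟨?_, ?_⟩, Or.inr (Or.inr ⟨?_, ?_, Or.inl ?_⟩)⟩
      · intro x; simp; omega
      · rw [card_union_of_disjoint (by simp; omega)]; simp; omega
      · simp; omega
      · intro x; simp; omega
      · simp; omega
    · refine ⟨mem_kSubsets.2 ⟨?_, ?_⟩, Or.inr (Or.inr ⟨?_, ?_, Or.inr ?_⟩)⟩
      · intro x; simp; omega
      · rw [card_sdiff_of_subset (by simp; omega)]; simp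
      · simp; omega
      · intro x; simp; omega
      · simp; omega
    · refine ⟨mem_kSubsets.2 ⟨?_, ?_⟩, Or.inr (Or.inl ⟨?_, ?_, ?_, Or.inl ?_⟩)⟩
      · intro x; simp; omega
      · rw [card_sdiff_of_subset (by simp; omega)]; simp
      · simp
      · intro x; simp; omega
      · simp; omega
      · simp; omega
    · refine ⟨mem_kSubsets.2 ⟨?_, ?_⟩, Or.inr (Or.inl ⟨?_, ?_, ?_, Or.inr ?_⟩)⟩
      · intro x; simp; omega
      · rw [card_sdiff_of_subset (by intro x; simp; omega), card_pair (by omega)]; simp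
      · simp; omega
      · intro x; simp; omega
      · simp; omega
      · simp; omega
  · rintro ⟨hF, h⟩
    have hF' := mem_kSubsets.1 hF
    have hmem : ∀ x, 3 ≤ x → x ≤ k - 1 → Icc 3 (k - 1) ⊆ F → x ∈ F := fun x h1 h2 h3 =>
      h3 (by simp; omega)
    rcases h with ⟨h1, h2, h3 | h3⟩ | ⟨h1, h2, h3, h4⟩ | ⟨h2, h3, h4⟩
    · exact Or.inl (Or.inl (Or.inl ⟨hF, ⟨h1, h2⟩, h3⟩))
    · exact Or.inl (Or.inl (Or.inr ⟨hF, ⟨h1, h2⟩, h3⟩))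
    · by_cases h5 : 2 ∈ F
      · exact Or.inl (Or.inl (Or.inl ⟨hF, ⟨h1, h5⟩, hX h2⟩))
      rcases h4 with h4 | h4
      · refine Or.inr (Or.inr (Or.inl (eq_of_subset_of_card_le ?_ ?_).symm))
        · intro x hx
          have : x = 1 ∨ (3 ≤ x ∧ x ≤ k - 1) ∨ x = k ∨ x = k + 1 := by simp at hx; omega
          rcases this with rfl | ⟨h, h'⟩ | rfl | rfl
          · exact h1
          · exact hmem x h h' h2
          · exact h3
          · exact h4
        · rw [card_sdiff_of_subset (by simp; omega)]; simp; omega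
      · refine Or.inr (Or.inr (Or.inr (eq_of_subset_of_card_le ?_ ?_).symm))
        · intro x hx
          have : x = 1 ∨ (3 ≤ x ∧ x ≤ k - 1) ∨ x = k ∨ x = k + 2 := by simp at hx; omega
          rcases this with rfl | ⟨h, h'⟩ | rfl | rfl
          · exact h1
          · exact hmem x h h' h2
          · exact h3
          · exact h4
        · rw [card_sdiff_of_subset (by intro x; simp; omega), card_pair (by omega)]; simp; omega
    · by_cases h1 : 1 ∈ F
      · exact Or.inl (Or.inl (Or.inl ⟨hF, ⟨h1, h2⟩, hX h3⟩))
      rcases h4 with h5 | ⟨h5, h6⟩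
      · obtain ⟨i, hiF, hi, rfl⟩ := exists_eq_insert (P := Icc 2 k) (F := F) (by
            intro x hx
            by_cases hx1 : x = 2
            · rwa [hx1]
            by_cases hx2 : x = k
            · rwa [hx2]
            exact h3 (by simp at hx ⊢; omega)) (by rw [hF'.2]; simp; omega)
        refine Or.inl (Or.inr ⟨i, ?_, ?_⟩)
        · have := hF'.1 hiF
          have h7 : i ≠ 1 := by rintro rfl; exact h1 hiF
          simp at this hi ⊢; omega
        · ext x; simp
      · refine Or.inr (Or.inl (eq_of_subset_of_card_le ?_ ?_).symm)
        · intro x hx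
          have : x = 2 ∨ (3 ≤ x ∧ x ≤ k - 1) ∨ x = k + 1 ∨ x = k + 2 := by simp at hx; omega
          rcases this with rfl | ⟨h, h'⟩ | rfl | rfl
          · exact h2
          · exact hmem x h h' h3
          · exact h5
          · exact h6
        · rw [card_sdiff_of_subset (by simp; omega)]; simp; omega

/-! ### Invariance under permutations, and normal forms -/

section Isomorphism

variable {n k : ℕ} {π : Equiv.Perm ℕ}

theorem perm_mem_Icc_iff (hπ : ∀ x, x ∉ Icc 1 n → π x = x) (x : ℕ) :
    π x ∈ Icc 1 n ↔ x ∈ Icc 1 n := by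
  by_cases hx : x ∈ Icc 1 n
  · simp only [hx, iff_true]
    by_contra h
    have := π.injective (hπ _ h)
    rw [this] at h
    exact h hx
  · rw [hπ x hx]

theorem perm_symm_fix (hπ : ∀ x, x ∉ Icc 1 n → π x = x) : ∀ x, x ∉ Icc 1 n → π.symm x = x := by
  intro x hx
  rw [Equiv.symm_apply_eq, hπ x hx]

theorem image_mem_kSubsets_iff (hπ : ∀ x, x ∉ Icc 1 n → π x = x) (A : Finset ℕ) :
    A.image π ∈ kSubsets n k ↔ A ∈ kSubsets n k := by
  rw [mem_kSubsets, mem_kSubsets, card_image_of_injective _ π.injective]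
  simp only [subset_iff, mem_image, forall_exists_index, and_imp, forall_apply_eq_imp_iff₂,
    perm_mem_Icc_iff hπ]

theorem image_symm_image (π : Equiv.Perm ℕ) (A : Finset ℕ) : (A.image π.symm).image π = A := by
  simp [image_image]

theorem image_image_symm (π : Equiv.Perm ℕ) (A : Finset ℕ) : (A.image π).image π.symm = A := by
  simp [image_image]

theorem FamilyIso.symm {𝓕 𝓖 : Finset (Finset ℕ)} (h : FamilyIso n 𝓕 𝓖) : FamilyIso n 𝓖 𝓕 := by
  obtain ⟨π, hπ, rfl⟩ := h
  refine ⟨π.symm, perm_symm_fix hπ, ?_⟩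
  rw [image_image]
  refine (image_congr fun A _ => image_image_symm π A).trans image_id

theorem FamilyIso.card_eq {𝓕 𝓖 : Finset (Finset ℕ)} (h : FamilyIso n 𝓕 𝓖) : 𝓕.card = 𝓖.card := by
  obtain ⟨π, -, rfl⟩ := h
  exact (card_image_of_injective _ (image_injective π.injective)).symm

theorem DWiseIntersecting.image {d : ℕ} {𝓕 : Finset (Finset ℕ)} (h : DWiseIntersecting d 𝓕)
    (π : Equiv.Perm ℕ) : DWiseIntersecting d (𝓕.image (fun A => A.image π)) := by
  intro A hA
  obtain ⟨x, hx⟩ := h (fun i => (A i).image π.symm) (fun i => by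
    obtain ⟨B, hB, hBA⟩ := mem_image.1 (hA i)
    rw [← hBA, image_image_symm]
    exact hB)
  refine ⟨π x, fun i => ?_⟩
  obtain ⟨y, hy, hyx⟩ := mem_image.1 (hx i)
  rw [← hyx]
  simpa using hy

theorem IsMaxNontrivial.of_iso {d : ℕ} {𝓕 𝓖 : Finset (Finset ℕ)} (h : IsMaxNontrivial n k d 𝓕)
    (hi : FamilyIso n 𝓕 𝓖) : IsMaxNontrivial n k d 𝓖 := by
  obtain ⟨π, hπ, rfl⟩ := hi
  refine ⟨?_, h.intersecting.image π, ?_, ?_⟩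
  · intro B hB
    obtain ⟨A, hA, rfl⟩ := mem_image.1 hB
    exact (image_mem_kSubsets_iff hπ A).2 (h.uniform hA)
  · rintro ⟨x, hx, hall⟩
    refine h.nontrivial ⟨π.symm x, (perm_mem_Icc_iff (perm_symm_fix hπ) x).2 hx, fun A hA => ?_⟩
    obtain ⟨y, hy, rfl⟩ := mem_image.1 (hall _ (mem_image_of_mem _ hA))
    simpa using hy
  · intro A hA hn hd
    refine h.maximal (A.image π.symm) ((image_mem_kSubsets_iff (perm_symm_fix hπ) A).2 hA) ?_ ?_
    · intro hm
      exact hn (mem_image.2 ⟨_, hm, image_symm_image π A⟩)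
    · have := hd.image π.symm
      rw [image_insert, image_image] at this
      rwa [show 𝓕.image ((fun A => A.image π.symm) ∘ fun A => A.image π) = 𝓕 from
        (image_congr fun A _ => image_image_symm π A).trans image_id] at this

theorem image_starFamily (hπ : ∀ x, x ∉ Icc 1 n → π x = x) (u v : ℕ) (X : Finset ℕ)
    {q p₁ p₂ q' p₁' p₂' : Finset ℕ → Prop} (hq : ∀ F, q' (F.image π) ↔ q F)
    (h₁ : ∀ F, p₁' (F.image π) ↔ p₁ F) (h₂ : ∀ F, p₂' (F.image π) ↔ p₂ F) :
    (starFamily n k u v X q p₁ p₂).image (fun A => A.image π) =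
      starFamily n k (π u) (π v) (X.image π) q' p₁' p₂' := by
  have key : ∀ A : Finset ℕ, A.image π ∈ starFamily n k (π u) (π v) (X.image π) q' p₁' p₂' ↔
      A ∈ starFamily n k u v X q p₁ p₂ := by
    intro A
    rw [mem_starFamily, mem_starFamily, image_mem_kSubsets_iff hπ, hq, h₁, h₂,
      ← image_inter _ _ π.injective, image_nonempty, image_subset_image_iff π.injective,
      π.injective.mem_finset_image, π.injective.mem_finset_image]
  ext B
  rw [← image_symm_image π B, key]
  constructor
  · intro hB
    obtain ⟨A, hA, hAB⟩ := mem_image.1 hB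
    rw [image_injective π.injective hAB] at hA
    exact hA
  · exact fun hB => mem_image_of_mem _ hB

/-- Elements are appended one by one: swapping the image of the new element with the next free value
disturbs no earlier value. -/
theorem exists_perm_map_eq_range (L : List ℕ) (hL : L.Nodup) (hn : ∀ x ∈ L, x ∈ Icc 1 n) :
    ∃ π : Equiv.Perm ℕ, (∀ x, x ∉ Icc 1 n → π x = x) ∧ L.map π = List.range' 1 L.length := by
  induction L using List.reverseRecOn with
  | nil => exact ⟨1, by simp, by simp⟩
  | append_singleton L y ih =>
    have hlen : (L ++ [y]).length ≤ n := by
      rw [← List.toFinset_card_of_nodup hL]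
      refine (card_le_card (t := Icc 1 n) fun x hx => hn x (List.mem_toFinset.1 hx)).trans (by simp)
    rw [List.nodup_append] at hL
    obtain ⟨π, hπ, hπL⟩ := ih hL.1 fun x hx => hn x (by simp [hx])
    have hyL : y ∉ L := fun hy => hL.2.2 y hy y (by simp) rfl
    have hy : π y ∈ Icc 1 n := (perm_mem_Icc_iff hπ y).2 (hn y (by simp))
    have hyL' : π y ∉ List.range' 1 L.length := by
      rw [← hπL, List.mem_map_of_injective π.injective]
      exact hyL
    simp only [List.length_append, List.length_singleton] at hlen
    rw [List.mem_range'_1] at hyL'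
    rw [mem_Icc] at hy
    refine ⟨π.trans (Equiv.swap (π y) (L.length + 1)), fun x hx => ?_, ?_⟩
    · rw [Equiv.trans_apply, hπ x hx]
      rw [mem_Icc] at hx
      exact Equiv.swap_apply_of_ne_of_ne (by omega) (by omega)
    · rw [List.length_append, List.length_singleton, List.range'_concat, List.map_append, ← hπL]
      congr 1
      · apply List.map_congr_left
        intro x hx
        have hx' : π x ∈ List.range' 1 L.length := hπL ▸ List.mem_map_of_mem hx
        rw [List.mem_range'_1] at hx'
        rw [Equiv.trans_apply]
        exact Equiv.swap_apply_of_ne_of_ne (by omega) (by omega)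
      · simp [add_comm]

theorem exists_normalizing_perm {u v : ℕ} {X : Finset ℕ} (M : List ℕ) (hu : u ∈ Icc 1 n)
    (hv : v ∈ Icc 1 n) (huv : u ≠ v) (hX : X ⊆ Icc 1 n) (hM : ∀ x ∈ M, x ∈ Icc 1 n) (huX : u ∉ X)
    (hvX : v ∉ X) (hMd : M.Nodup) (huM : u ∉ M) (hvM : v ∉ M) (hMX : ∀ x ∈ M, x ∉ X) :
    ∃ π : Equiv.Perm ℕ, (∀ x, x ∉ Icc 1 n → π x = x) ∧ π u = 1 ∧ π v = 2 ∧
      X.image π = Icc 3 (X.card + 2) ∧ M.map π = List.range' (X.card + 3) M.length := by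
  obtain ⟨π, hπ, hL⟩ := exists_perm_map_eq_range (n := n) (u :: v :: (X.toList ++ M)) (by
    simp only [List.nodup_cons, List.mem_cons, List.mem_append, mem_toList, List.nodup_append,
      X.nodup_toList]
    refine ⟨by tauto, by tauto, trivial, hMd, ?_⟩
    rintro a ha b hb rfl
    exact hMX a hb ha) (by
    simp only [List.mem_cons, List.mem_append, mem_toList]
    rintro x (rfl | rfl | h | h)
    · exact hu
    · exact hv
    · exact hX h
    · exact hM x h)
  refine ⟨π, hπ, ?_⟩
  simp only [List.map_cons, List.length_cons, List.range'_succ, List.cons.injEq, List.map_append,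
    List.length_append, length_toList, ← List.range'_append_1] at hL
  obtain ⟨h1, h2, h3⟩ := hL
  obtain ⟨h4, h5⟩ := List.append_inj h3 (by simp)
  refine ⟨h1, h2, ?_, by rw [h5]; congr 1; omega⟩
  ext x
  have : x ∈ X.toList.map π ↔ x ∈ List.range' (1 + 1 + 1) X.card := by rw [h4]
  simp only [List.mem_map, mem_toList, List.mem_range'_1] at this
  simp only [mem_image, mem_Icc, this]
  omega

variable {u v : ℕ} {X : Finset ℕ}

theorem StarConfig.iso_H (h : StarConfig n k u v X ∅) :
    FamilyIso n (starH n k u v X) (starH n k 1 2 (Icc 3 (X.card + 2))) := by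
  obtain ⟨π, hπ, h1, h2, h3, -⟩ := exists_normalizing_perm [] h.u_mem h.v_mem h.ne h.X_sub
    (by simp) h.u_X h.v_X (by simp) (by simp) (by simp) (by simp)
  refine ⟨π, hπ, ?_⟩
  have e : (starH n k u v X).image (fun A => A.image π) = starH n k (π u) (π v) (X.image π) :=
    image_starFamily hπ u v X (by simp) (by simp) (by simp)
  rw [e, h1, h2, h3]

theorem StarConfig.iso_G {a b : ℕ} (h : StarConfig n k u v X {a, b}) (hab : a ≠ b)
    (hX : X.card + 3 = k) :
    FamilyIso n (starG n k u v X a b) (starG n k 1 2 (Icc 3 (k - 1)) k (k + 1)) := by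
  have hS := h.S_sub
  have hu := h.u_S
  have hv := h.v_S
  have hd := h.S_X
  simp [insert_subset_iff] at hS hu hv hd
  obtain ⟨π, hπ, h1, h2, h3, h4⟩ := exists_normalizing_perm [a, b] h.u_mem h.v_mem h.ne h.X_sub
    (by simpa using hS) h.u_X h.v_X (by simpa using hab) (by simpa using hu) (by simpa using hv)
    (by simpa using hd)
  refine ⟨π, hπ, ?_⟩
  simp [List.range'_succ] at h4
  have hm : ∀ (x : ℕ) (F : Finset ℕ), π x ∈ F.image π ↔ x ∈ F := fun x F =>
    π.injective.mem_finset_image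
  have e : (starG n k u v X a b).image (fun A => A.image π) =
      starG n k (π u) (π v) (X.image π) (π a) (π b) :=
    image_starFamily hπ u v X (by simp [hm]) (by simp [hm]) (by simp [hm])
  subst hX
  rw [e, h1, h2, h3, h4.1, h4.2]
  rfl

theorem exists_perm_three {a b c : ℕ} (h : StarConfig n k u v X {a, b, c}) (hab : a ≠ b)
    (hac : a ≠ c) (hbc : b ≠ c) :
    ∃ π : Equiv.Perm ℕ, (∀ x, x ∉ Icc 1 n → π x = x) ∧ π u = 1 ∧ π v = 2 ∧
      X.image π = Icc 3 (X.card + 2) ∧ π a = X.card + 3 ∧ π b = X.card + 4 ∧ π c = X.card + 5 := by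
  have hS := h.S_sub
  have hu := h.u_S
  have hv := h.v_S
  have hd := h.S_X
  simp [insert_subset_iff] at hS hu hv hd
  obtain ⟨π, hπ, h1, h2, h3, h4⟩ := exists_normalizing_perm [a, b, c] h.u_mem h.v_mem h.ne h.X_sub
    (by simpa using hS) h.u_X h.v_X (by simp; tauto) (by simpa using hu) (by simpa using hv)
    (by simpa using hd)
  refine ⟨π, hπ, h1, h2, h3, ?_⟩
  simpa [List.range'_succ] using h4

theorem StarConfig.iso_S {a b c : ℕ} (h : StarConfig n k u v X {a, b, c}) (hab : a ≠ b)
    (hac : a ≠ c) (hbc : b ≠ c) (hX : X.card + 3 = k) :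
    FamilyIso n (starS n k u v X a b c)
      (starS n k 1 2 (Icc 3 (k - 1)) k (k + 1) (k + 2)) := by
  obtain ⟨π, hπ, h1, h2, h3, h4, h5, h6⟩ := exists_perm_three h hab hac hbc
  refine ⟨π, hπ, ?_⟩
  have hm : ∀ (x : ℕ) (F : Finset ℕ), π x ∈ F.image π ↔ x ∈ F := fun x F =>
    π.injective.mem_finset_image
  have e : (starS n k u v X a b c).image (fun A => A.image π) =
      starS n k (π u) (π v) (X.image π) (π a) (π b) (π c) :=
    image_starFamily hπ u v X (by simp [hm]) (by simp [hm]) (by simp [hm])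
  subst hX
  rw [e, h1, h2, h3, h4, h5, h6]
  rfl

theorem StarConfig.iso_S₁ {a b c : ℕ} (h : StarConfig n k u v X {a, b, c}) (hab : a ≠ b)
    (hac : a ≠ c) (hbc : b ≠ c) (hX : X.card + 3 = k) :
    FamilyIso n (starS₁ n k u v X a b c)
      (starS₁ n k 1 2 (Icc 3 (k - 1)) k (k + 1) (k + 2)) := by
  obtain ⟨π, hπ, h1, h2, h3, h4, h5, h6⟩ := exists_perm_three h hab hac hbc
  refine ⟨π, hπ, ?_⟩
  have hm : ∀ (x : ℕ) (F : Finset ℕ), π x ∈ F.image π ↔ x ∈ F := fun x F =>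
    π.injective.mem_finset_image
  have e : (starS₁ n k u v X a b c).image (fun A => A.image π) =
      starS₁ n k (π u) (π v) (X.image π) (π a) (π b) (π c) :=
    image_starFamily hπ u v X (by simp [hm]) (by simp [hm]) (by simp [hm])
  subst hX
  rw [e, h1, h2, h3, h4, h5, h6]
  rfl

end Isomorphism

/-! ### Sizes -/

/-- The `k`-subsets of `[n]` that contain `P` and avoid `Q`. -/
def containingAvoiding (n k : ℕ) (P Q : Finset ℕ) : Finset (Finset ℕ) :=
  {F ∈ kSubsets n k | P ⊆ F ∧ Disjoint Q F}

theorem mem_containingAvoiding {n k : ℕ} {P Q F : Finset ℕ} :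
    F ∈ containingAvoiding n k P Q ↔ F ∈ kSubsets n k ∧ P ⊆ F ∧ Disjoint Q F := by
  simp [containingAvoiding]

theorem card_containingAvoiding {n k : ℕ} {P Q : Finset ℕ} (hP : P ⊆ Icc 1 n) (hQ : Q ⊆ Icc 1 n)
    (hd : Disjoint P Q) (hk : P.card ≤ k) :
    (containingAvoiding n k P Q).card = (n - P.card - Q.card).choose (k - P.card) := by
  have he : containingAvoiding n k P Q =
      (powersetCard (k - P.card) (Icc 1 n \ (P ∪ Q))).image (fun R => P ∪ R) := by
    ext F
    simp only [mem_containingAvoiding, mem_kSubsets, mem_image, mem_powersetCard]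
    constructor
    · rintro ⟨⟨h1, h2⟩, h3, h4⟩
      refine ⟨F \ P, ⟨?_, ?_⟩, union_sdiff_of_subset h3⟩
      · intro x hx
        have hxF : x ∈ F := (mem_sdiff.1 hx).1
        have := h1 hxF
        have : x ∉ Q := fun hxQ => disjoint_left.1 h4 hxQ hxF
        simp_all
      · rw [card_sdiff_of_subset h3, h2]
    · rintro ⟨R, ⟨h1, h2⟩, rfl⟩
      have hR : ∀ x ∈ R, x ∈ Icc 1 n ∧ x ∉ P ∧ x ∉ Q := fun x hx => by
        have := h1 hx
        simpa using this
      refine ⟨⟨union_subset hP fun x hx => (hR x hx).1, ?_⟩, subset_union_left, ?_⟩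
      · rw [card_union_of_disjoint, h2]
        · omega
        · exact disjoint_right.2 fun x hx => (hR x hx).2.1
      · rw [disjoint_union_right]
        exact ⟨hd.symm, disjoint_right.2 fun x hx => (hR x hx).2.2⟩
  rw [he, card_image_of_injOn, card_powersetCard, card_sdiff_of_subset (union_subset hP hQ),
    card_union_of_disjoint hd, Nat.card_Icc]
  · congr 1
    omega
  · intro R hR R' hR' h
    rw [mem_coe, mem_powersetCard] at hR hR'
    have hd' : ∀ R : Finset ℕ, R ⊆ Icc 1 n \ (P ∪ Q) → Disjoint P R := fun R hR =>
      disjoint_right.2 fun x hx => by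
        have := hR hx
        simp at this
        tauto
    have h' : P ∪ R = P ∪ R' := h
    rw [← union_sdiff_cancel_left (hd' R hR.1), h', union_sdiff_cancel_left (hd' R' hR'.1)]

theorem card_containing {n k : ℕ} {P : Finset ℕ} (hP : P ⊆ Icc 1 n) (hk : P.card ≤ k) :
    (containingAvoiding n k P ∅).card = (n - P.card).choose (k - P.card) := by
  rw [card_containingAvoiding hP (by simp) (by simp) hk, card_empty, Nat.sub_zero]

/-- The `k`-subsets of `[n]` that contain `u` and `v` and meet `X`. -/
def starCore (n k u v : ℕ) (X : Finset ℕ) : Finset (Finset ℕ) :=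
  {F ∈ kSubsets n k | u ∈ F ∧ v ∈ F ∧ (F ∩ X).Nonempty}

theorem disjoint_iff_not_nonempty {X F : Finset ℕ} : Disjoint X F ↔ ¬ (F ∩ X).Nonempty := by
  rw [disjoint_iff_inter_eq_empty, inter_comm, not_nonempty_iff_eq_empty]

/-- The size of `starCore n k u v X` for `X.card = l`. -/
def coreCard (n k l : ℕ) : ℕ := (n - 2).choose (k - 2) - (n - 2 - l).choose (k - 2)

theorem mem_starCore {n k u v : ℕ} {X F : Finset ℕ} :
    F ∈ starCore n k u v X ↔ F ∈ kSubsets n k ∧ u ∈ F ∧ v ∈ F ∧ (F ∩ X).Nonempty := by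
  simp [starCore]

section Config

variable {n k u v : ℕ} {X S : Finset ℕ}

theorem StarConfig.symm (h : StarConfig n k u v X S) : StarConfig n k v u X S :=
  { h with
    u_mem := h.v_mem
    v_mem := h.u_mem
    ne := h.ne.symm
    u_X := h.v_X
    v_X := h.u_X
    u_S := h.v_S
    v_S := h.u_S }

theorem StarConfig.card_core (h : StarConfig n k u v X S) :
    (starCore n k u v X).card = coreCard n k X.card := by
  have huv : ({u, v} : Finset ℕ) ⊆ Icc 1 n := by
    simp only [insert_subset_iff, singleton_subset_iff]
    exact ⟨h.u_mem, h.v_mem⟩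
  have h2 : ({u, v} : Finset ℕ).card = 2 := card_pair h.ne
  have hk := h.S_card
  have hd : Disjoint ({u, v} : Finset ℕ) X := by
    simp only [disjoint_insert_left, disjoint_singleton_left]
    exact ⟨h.u_X, h.v_X⟩
  have h3 := card_containing (k := k) huv (by omega)
  have h4 := card_containingAvoiding (k := k) huv h.X_sub hd (by omega)
  have h5 : containingAvoiding n k {u, v} ∅ =
      starCore n k u v X ∪ containingAvoiding n k {u, v} X := by
    ext F
    simp only [mem_containingAvoiding, mem_union, mem_starCore, insert_subset_iff,
      singleton_subset_iff, disjoint_empty_left, and_true, disjoint_iff_not_nonempty (X := X)]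
    tauto
  have h6 : Disjoint (starCore n k u v X) (containingAvoiding n k {u, v} X) := by
    rw [disjoint_left]
    intro F hF hF'
    rw [mem_starCore] at hF
    rw [mem_containingAvoiding, disjoint_iff_not_nonempty] at hF'
    tauto
  rw [h5, card_union_of_disjoint h6, h4, h2] at h3
  rw [coreCard]
  omega

theorem StarConfig.card_tail (h : StarConfig n k u v X S) :
    (containingAvoiding n k (insert u X) {v}).card =
      (n - (X.card + 1) - 1).choose (k - (X.card + 1)) := by
  have h1 : (insert u X).card = X.card + 1 := card_insert_of_notMem h.u_X
  have := h.X_card_le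
  have := h.ne
  rw [card_containingAvoiding (insert_subset h.u_mem h.X_sub) (by simpa using h.v_mem)
    (by simp [h.v_X, this.symm]) (by omega), h1, card_singleton]

theorem StarConfig.card_tail_point (h : StarConfig n k u v X S) {a : ℕ} (ha : a ∈ S)
    (hX : X.card + 3 ≤ k) :
    (containingAvoiding n k (insert a (insert u X)) {v}).card =
      (n - (X.card + 2) - 1).choose (k - (X.card + 2)) := by
  have ha' : a ∉ insert u X := by
    rw [mem_insert]
    rintro (rfl | h')
    · exact h.u_S ha
    · exact disjoint_left.1 h.S_X ha h'
  have h1 : (insert u X).card = X.card + 1 := card_insert_of_notMem h.u_X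
  have := h.ne
  have : v ≠ a := fun h' => h.v_S (h' ▸ ha)
  rw [card_containingAvoiding (insert_subset (h.S_sub ha) (insert_subset h.u_mem h.X_sub))
    (by simpa using h.v_mem) (by simp [h.v_X, this, h.ne.symm])
    (by rw [card_insert_of_notMem ha']; omega), card_insert_of_notMem ha', h1, card_singleton]

theorem StarConfig.card_containing_tail (h : StarConfig n k u v X S) {T : Finset ℕ} (hT : T ⊆ S)
    (hX : X.card + T.card + 1 ≤ k) :
    (containingAvoiding n k (T ∪ insert u X) ∅).card =
      (n - (X.card + T.card + 1)).choose (k - (X.card + T.card + 1)) := by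
  have hd : Disjoint T (insert u X) := by
    rw [disjoint_insert_right]
    exact ⟨fun hu => h.u_S (hT hu), disjoint_of_subset_left hT h.S_X⟩
  have h1 : (T ∪ insert u X).card = X.card + T.card + 1 := by
    rw [card_union_of_disjoint hd, card_insert_of_notMem h.u_X]
    omega
  rw [card_containing (union_subset (hT.trans h.S_sub) (insert_subset h.u_mem h.X_sub)) (by omega),
    h1]

theorem StarConfig.card_middle (h : StarConfig n k u v X S) :
    (containingAvoiding n k (insert u (insert v S)) X).card =
      (n - (S.card + 2) - X.card).choose (k - (S.card + 2)) := by
  have h0 : u ∉ insert v S := by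
    rw [mem_insert]
    rintro (h' | h')
    · exact h.ne h'
    · exact h.u_S h'
  have h1 : (insert u (insert v S)).card = S.card + 2 := by
    rw [card_insert_of_notMem h0, card_insert_of_notMem h.v_S]
  rw [card_containingAvoiding (insert_subset h.u_mem (insert_subset h.v_mem h.S_sub)) h.X_sub
    (by simp [h.u_X, h.v_X, h.S_X]) (by have := h.S_card; omega), h1]

theorem starCore_subset (n k u v : ℕ) (X : Finset ℕ) (q p₁ p₂ : Finset ℕ → Prop) :
    starCore n k u v X ⊆ starFamily n k u v X q p₁ p₂ := by
  intro F hF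
  rw [mem_starCore] at hF
  rw [mem_starFamily]
  tauto

theorem disjoint_core_middle (n k u v : ℕ) (X S : Finset ℕ) :
    Disjoint (starCore n k u v X) (containingAvoiding n k (insert u (insert v S)) X) := by
  rw [disjoint_left]
  intro F hF hF'
  obtain ⟨x, hx⟩ := (mem_starCore.1 hF).2.2.2
  rw [mem_inter] at hx
  exact disjoint_left.1 (mem_containingAvoiding.1 hF').2.2 hx.2 hx.1

theorem StarConfig.card_H (h : StarConfig n k u v X S) :
    (starH n k u v X).card =
      coreCard n k X.card + 2 * (n - X.card - 2).choose (k - X.card - 1) := by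
  have h1 := h.card_core
  have h2 := h.card_tail
  have h3 := h.symm.card_tail
  have hX : X.Nonempty := card_pos.1 (by have := h.X_card; omega)
  have he : starH n k u v X = starCore n k u v X ∪
      (containingAvoiding n k (insert u X) {v} ∪ containingAvoiding n k (insert v X) {u}) := by
    ext F
    have hX' : X ⊆ F → (F ∩ X).Nonempty := fun hs => by rwa [inter_eq_right.2 hs]
    simp only [starH, mem_starFamily, mem_union, mem_starCore, mem_containingAvoiding,
      insert_subset_iff, disjoint_singleton_left]
    tauto
  rw [he, card_union_of_disjoint, card_union_of_disjoint, h1, h2, h3, ← two_mul,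
    show n - (X.card + 1) - 1 = n - X.card - 2 by omega,
    show k - (X.card + 1) = k - X.card - 1 by omega]
  · rw [disjoint_left]
    simp only [mem_containingAvoiding, insert_subset_iff, disjoint_singleton_left]
    tauto
  · rw [disjoint_left]
    simp only [mem_containingAvoiding, insert_subset_iff, disjoint_singleton_left, mem_union,
      mem_starCore]
    tauto

/-- The sizes to be ranked differ by much more than the errors made here, so one-sided estimates
replace exact counts for `𝓖`, `𝓢` and `𝓢₁`. -/
theorem StarConfig.le_card_of_q (h : StarConfig n k u v X S) {q p₁ p₂ : Finset ℕ → Prop}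
    (hq : ∀ F, S ⊆ F → q F) :
    coreCard n k X.card + (n - (S.card + 2) - X.card).choose (k - (S.card + 2)) ≤
      (starFamily n k u v X q p₁ p₂).card := by
  rw [← h.card_core, ← h.card_middle, ← card_union_of_disjoint (disjoint_core_middle ..)]
  refine card_le_card (union_subset (starCore_subset ..) fun F hF => ?_)
  rw [mem_containingAvoiding, insert_subset_iff, insert_subset_iff] at hF
  exact mem_starFamily.2 ⟨hF.1, Or.inl ⟨hF.2.1.1, hF.2.1.2.1, Or.inr (hq F hF.2.1.2.2)⟩⟩

theorem StarConfig.le_card_of_q_of_p (h : StarConfig n k u v X S) {q p₁ p₂ : Finset ℕ → Prop}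
    (hq : ∀ F, S ⊆ F → q F) {a : ℕ} (ha : a ∈ S) (hp : ∀ F, a ∈ F → p₂ F) (hX : X.card + 3 = k) :
    coreCard n k X.card + (n - (S.card + 2) - X.card).choose (k - (S.card + 2)) + (n - k) ≤
      (starFamily n k u v X q p₁ p₂).card := by
  have h1 := h.symm.card_tail_point ha hX.le
  rw [show k - (X.card + 2) = 1 by omega, Nat.choose_one_right] at h1
  rw [show n - k = n - (X.card + 2) - 1 by omega, ← h1, ← h.card_core, ← h.card_middle,
    ← card_union_of_disjoint (disjoint_core_middle ..), ← card_union_of_disjoint]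
  · refine card_le_card (union_subset (union_subset (starCore_subset ..) fun F hF => ?_)
      fun F hF => ?_)
    · rw [mem_containingAvoiding, insert_subset_iff, insert_subset_iff] at hF
      exact mem_starFamily.2 ⟨hF.1, Or.inl ⟨hF.2.1.1, hF.2.1.2.1, Or.inr (hq F hF.2.1.2.2)⟩⟩
    · rw [mem_containingAvoiding, insert_subset_iff, insert_subset_iff] at hF
      exact mem_starFamily.2 ⟨hF.1, Or.inr (Or.inr ⟨hF.2.1.2.1, hF.2.1.2.2, hp F hF.2.1.1⟩)⟩
  · rw [disjoint_left]
    simp only [mem_containingAvoiding, insert_subset_iff, disjoint_singleton_left, mem_union,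
      mem_starCore]
    tauto

/-- `T₁` and `T₂` list minimal sets satisfying `p₁` and `p₂`. Tails are counted once for each
minimal set that they contain, and this overcount is harmless. -/
theorem StarConfig.card_le_of_cover (h : StarConfig n k u v X S) {q p₁ p₂ : Finset ℕ → Prop}
    (hq : ∀ F, q F → S ⊆ F) {T₁ T₂ : Finset (Finset ℕ)} (h₁ : ∀ F, p₁ F → ∃ T ∈ T₁, T ⊆ F)
    (h₂ : ∀ F, p₂ F → ∃ T ∈ T₂, T ⊆ F) (hT₁ : ∀ T ∈ T₁, T ⊆ S ∧ X.card + T.card + 1 ≤ k)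
    (hT₂ : ∀ T ∈ T₂, T ⊆ S ∧ X.card + T.card + 1 ≤ k) :
    (starFamily n k u v X q p₁ p₂).card ≤
      coreCard n k X.card + (n - (S.card + 2) - X.card).choose (k - (S.card + 2)) +
      (∑ T ∈ T₁, (n - (X.card + T.card + 1)).choose (k - (X.card + T.card + 1)) +
      ∑ T ∈ T₂, (n - (X.card + T.card + 1)).choose (k - (X.card + T.card + 1))) := by
  have hs : starFamily n k u v X q p₁ p₂ ⊆
      starCore n k u v X ∪ containingAvoiding n k (insert u (insert v S)) X ∪
      (T₁.biUnion (fun T => containingAvoiding n k (T ∪ insert u X) ∅) ∪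
      T₂.biUnion (fun T => containingAvoiding n k (T ∪ insert v X) ∅)) := by
    intro F hF
    rw [mem_starFamily] at hF
    simp only [mem_union, mem_biUnion, mem_starCore, mem_containingAvoiding, insert_subset_iff,
      union_subset_iff, disjoint_empty_left, and_true, disjoint_iff_not_nonempty (X := X)]
    obtain ⟨hF, ⟨hu, hv, hF'⟩ | ⟨hu, hX, hp⟩ | ⟨hv, hX, hp⟩⟩ := hF
    · have := hq F
      tauto
    · obtain ⟨T, hT, hTF⟩ := h₁ F hp
      exact Or.inr (Or.inl ⟨T, hT, hF, hTF, hu, hX⟩)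
    · obtain ⟨T, hT, hTF⟩ := h₂ F hp
      exact Or.inr (Or.inr ⟨T, hT, hF, hTF, hv, hX⟩)
  refine (card_le_card hs).trans ((card_union_le _ _).trans (add_le_add ?_ ?_))
  · rw [← h.card_core, ← h.card_middle]
    exact card_union_le _ _
  · refine (card_union_le _ _).trans (add_le_add ?_ ?_)
    · refine card_biUnion_le.trans (sum_le_sum fun T hT => ?_)
      rw [h.card_containing_tail (hT₁ T hT).1 (hT₁ T hT).2]
    · refine card_biUnion_le.trans (sum_le_sum fun T hT => ?_)
      rw [h.symm.card_containing_tail (hT₂ T hT).1 (hT₂ T hT).2]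

/-- The single points `a` and `b` contribute `n - k + 1` each and the pair contributes `1`; all of
this is absorbed into `2 * n`. -/
theorem StarConfig.card_G_le {a b : ℕ} (h : StarConfig n k u v X {a, b}) (hab : a ≠ b)
    (hX : X.card + 3 = k) :
    (starG n k u v X a b).card ≤ coreCard n k (k - 3) + (n - k - 1).choose (k - 4) + 2 * n := by
  have h2 : ({a, b} : Finset ℕ).card = 2 := card_pair hab
  have := h.card_le_of_cover (q := fun F => a ∈ F ∧ b ∈ F) (p₁ := fun F => a ∈ F ∧ b ∈ F)
    (p₂ := fun F => a ∈ F ∨ b ∈ F) (T₁ := {{a, b}}) (T₂ := {{a}, {b}})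
    (by simp [insert_subset_iff]) (by simp [insert_subset_iff]) (by simp)
    (by simp [h2]; omega) (by simp; omega)
  have hne : ({a} : Finset ℕ) ≠ {b} := by simpa using hab
  rw [sum_singleton, sum_pair hne, h2, card_singleton, card_singleton,
    show k - (X.card + 2 + 1) = 0 by omega, show k - (X.card + 1 + 1) = 1 by omega,
    Nat.choose_zero_right, Nat.choose_one_right, show n - (2 + 2) - X.card = n - k - 1 by omega] at this
  rw [starG]
  have := h.n_large
  rw [show k - 3 = X.card by omega]
  simp only [Nat.reduceAdd] at *
  omega

theorem StarConfig.le_card_G {a b : ℕ} (h : StarConfig n k u v X {a, b}) (hab : a ≠ b)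
    (hX : X.card + 3 = k) :
    coreCard n k (k - 3) + (n - k - 1).choose (k - 4) + (n - k) ≤ (starG n k u v X a b).card := by
  have h2 : ({a, b} : Finset ℕ).card = 2 := card_pair hab
  have := h.le_card_of_q_of_p (q := fun F => a ∈ F ∧ b ∈ F) (p₁ := fun F => a ∈ F ∧ b ∈ F)
    (p₂ := fun F => a ∈ F ∨ b ∈ F) (by simp [insert_subset_iff]) (a := a) (by simp)
    (fun F hF => Or.inl hF) hX
  rwa [h2, show n - (2 + 2) - X.card = n - k - 1 by omega, show X.card = k - 3 by omega] at this

/-- The term `n - k + 4` is `n - k + 1` for the point `a` plus `1` for each of the three pairs. -/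
theorem StarConfig.card_S₁_le {a b c : ℕ} (h : StarConfig n k u v X {a, b, c}) (hab : a ≠ b)
    (hac : a ≠ c) (hbc : b ≠ c) (hX : X.card + 3 = k) :
    (starS₁ n k u v X a b c).card ≤
      coreCard n k (k - 3) + (n - k - 2).choose (k - 5) + (n - k + 4) := by
  have h3 : ({a, b, c} : Finset ℕ).card = 3 := card_eq_three.2 ⟨a, b, c, hab, hac, hbc, rfl⟩
  have h2 := card_pair hab
  have h2' := card_pair hac
  have h2'' := card_pair hbc
  have := h.card_le_of_cover (q := fun F => a ∈ F ∧ b ∈ F ∧ c ∈ F)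
    (p₁ := fun F => a ∈ F ∧ (b ∈ F ∨ c ∈ F)) (p₂ := fun F => a ∈ F ∨ (b ∈ F ∧ c ∈ F))
    (T₁ := {{a, b}, {a, c}}) (T₂ := {{a}, {b, c}})
    (by simp [insert_subset_iff]) (by simp [insert_subset_iff]; tauto)
    (by simp [insert_subset_iff])
    (by simp [h2, h2', insert_subset_iff]; omega) (by simp [h2'']; omega)
  have hne : ({a, b} : Finset ℕ) ≠ {a, c} := fun h => by
    have : b ∈ ({a, c} : Finset ℕ) := h ▸ (by simp)
    simp at this
    tauto
  have hne' : ({a} : Finset ℕ) ≠ {b, c} := fun h => by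
    have : a ∈ ({b, c} : Finset ℕ) := h ▸ (by simp)
    simp at this
    tauto
  rw [sum_pair hne, sum_pair hne', h2, h2', h2'', h3, card_singleton,
    show k - (X.card + 2 + 1) = 0 by omega, show k - (X.card + 1 + 1) = 1 by omega,
    Nat.choose_zero_right, Nat.choose_one_right,
    show n - (3 + 2) - X.card = n - k - 2 by omega] at this
  rw [starS₁]
  have := h.n_large
  rw [show k - 3 = X.card by omega]
  simp only [Nat.reduceAdd] at *
  omega

theorem StarConfig.le_card_S₁ {a b c : ℕ} (h : StarConfig n k u v X {a, b, c}) (hab : a ≠ b)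
    (hac : a ≠ c) (hbc : b ≠ c) (hX : X.card + 3 = k) :
    coreCard n k (k - 3) + (n - k - 2).choose (k - 5) + (n - k) ≤
      (starS₁ n k u v X a b c).card := by
  have h3 : ({a, b, c} : Finset ℕ).card = 3 := card_eq_three.2 ⟨a, b, c, hab, hac, hbc, rfl⟩
  have := h.le_card_of_q_of_p (q := fun F => a ∈ F ∧ b ∈ F ∧ c ∈ F)
    (p₁ := fun F => a ∈ F ∧ (b ∈ F ∨ c ∈ F)) (p₂ := fun F => a ∈ F ∨ (b ∈ F ∧ c ∈ F))
    (by simp [insert_subset_iff]) (a := a) (by simp) (fun F hF => Or.inl hF) hX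
  rwa [h3, show n - (3 + 2) - X.card = n - k - 2 by omega, show X.card = k - 3 by omega] at this

theorem StarConfig.card_S_le {a b c : ℕ} (h : StarConfig n k u v X {a, b, c}) (hab : a ≠ b)
    (hac : a ≠ c) (hbc : b ≠ c) (hX : X.card + 3 = k) :
    (starS n k u v X a b c).card ≤ coreCard n k (k - 3) + (n - k - 2).choose (k - 5) + 6 := by
  have h3 : ({a, b, c} : Finset ℕ).card = 3 := card_eq_three.2 ⟨a, b, c, hab, hac, hbc, rfl⟩
  have h2 := card_pair hab
  have h2' := card_pair hac
  have h2'' := card_pair hbc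
  have := h.card_le_of_cover (q := fun F => a ∈ F ∧ b ∈ F ∧ c ∈ F)
    (p₁ := fun F => (a ∈ F ∧ b ∈ F) ∨ (a ∈ F ∧ c ∈ F) ∨ (b ∈ F ∧ c ∈ F))
    (p₂ := fun F => (a ∈ F ∧ b ∈ F) ∨ (a ∈ F ∧ c ∈ F) ∨ (b ∈ F ∧ c ∈ F))
    (T₁ := {{a, b}, {a, c}, {b, c}}) (T₂ := {{a, b}, {a, c}, {b, c}})
    (by simp [insert_subset_iff]) (by simp [insert_subset_iff]) (by simp [insert_subset_iff])
    (by simp [h2, h2', h2'', insert_subset_iff]; omega)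
    (by simp [h2, h2', h2'', insert_subset_iff]; omega)
  have hsum : ∑ T ∈ ({{a, b}, {a, c}, {b, c}} : Finset (Finset ℕ)),
      (n - (X.card + T.card + 1)).choose (k - (X.card + T.card + 1)) ≤ 3 := by
    refine (sum_le_card_nsmul _ _ 1 fun T hT => ?_).trans ?_
    · have hT2 : T.card = 2 := by
        simp only [mem_insert, mem_singleton] at hT
        rcases hT with rfl | rfl | rfl <;> assumption
      rw [hT2, show k - (X.card + 2 + 1) = 0 by omega, Nat.choose_zero_right]
    · simpa using card_le_three
  rw [h3, show n - (3 + 2) - X.card = n - k - 2 by omega] at this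
  rw [starS]
  rw [show k - 3 = X.card by omega]
  simp only [Nat.reduceAdd] at *
  omega

theorem StarConfig.le_card_S {a b c : ℕ} (h : StarConfig n k u v X {a, b, c}) (hab : a ≠ b)
    (hac : a ≠ c) (hbc : b ≠ c) (hX : X.card + 3 = k) :
    coreCard n k (k - 3) + (n - k - 2).choose (k - 5) ≤ (starS n k u v X a b c).card := by
  have h3 : ({a, b, c} : Finset ℕ).card = 3 := card_eq_three.2 ⟨a, b, c, hab, hac, hbc, rfl⟩
  have := h.le_card_of_q (q := fun F => a ∈ F ∧ b ∈ F ∧ c ∈ F)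
    (p₁ := fun F => (a ∈ F ∧ b ∈ F) ∨ (a ∈ F ∧ c ∈ F) ∨ (b ∈ F ∧ c ∈ F))
    (p₂ := fun F => (a ∈ F ∧ b ∈ F) ∨ (a ∈ F ∧ c ∈ F) ∨ (b ∈ F ∧ c ∈ F))
    (by simp [insert_subset_iff])
  rwa [h3, show n - (3 + 2) - X.card = n - k - 2 by omega, show X.card = k - 3 by omega] at this

end Config

/-! ### Cross-intersecting graphs -/

/-- `Y` meets `e₁ ∩ e₂` for all `e₁ ∈ E₁` and `e₂ ∈ E₂`. -/
def CrossTransversal (E₁ E₂ : Finset (Finset ℕ)) (Y : Finset ℕ) : Prop :=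
  ∀ e₁ ∈ E₁, ∀ e₂ ∈ E₂, ∃ x, x ∈ e₁ ∧ x ∈ e₂ ∧ x ∈ Y

theorem CrossTransversal.symm {E₁ E₂ : Finset (Finset ℕ)} {Y : Finset ℕ}
    (h : CrossTransversal E₁ E₂ Y) : CrossTransversal E₂ E₁ Y := fun e₁ h₁ e₂ h₂ => by
  obtain ⟨x, h3, h4, h5⟩ := h e₂ h₂ e₁ h₁
  exact ⟨x, h4, h3, h5⟩

theorem CrossTransversal.mem {E₁ E₂ : Finset (Finset ℕ)} {Y e₁ e₂ : Finset ℕ}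
    (h : CrossTransversal E₁ E₂ Y) (h₁ : e₁ ∈ E₁) (h₂ : e₂ ∈ E₂) {a : ℕ}
    (ha : ∀ x, x ∈ e₁ → x ∈ e₂ → x = a) : a ∈ Y := by
  obtain ⟨x, hx1, hx2, hxY⟩ := h e₁ h₁ e₂ h₂
  rwa [← ha x hx1 hx2]

/-- Two nonempty cross-intersecting graphs such that no vertex is common to all the edges of
both. -/
structure CrossPair (E₁ E₂ : Finset (Finset ℕ)) : Prop where
  card₁ : ∀ e ∈ E₁, e.card = 2
  card₂ : ∀ e ∈ E₂, e.card = 2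
  ne₁ : E₁.Nonempty
  ne₂ : E₂.Nonempty
  cross : ∀ e₁ ∈ E₁, ∀ e₂ ∈ E₂, ∃ x, x ∈ e₁ ∧ x ∈ e₂
  not_common : ∀ w, ∃ e₁ ∈ E₁, ∃ e₂ ∈ E₂, ¬ (w ∈ e₁ ∧ w ∈ e₂)

theorem CrossPair.symm {E₁ E₂ : Finset (Finset ℕ)} (h : CrossPair E₁ E₂) : CrossPair E₂ E₁ where
  card₁ := h.card₂
  card₂ := h.card₁
  ne₁ := h.ne₂
  ne₂ := h.ne₁
  cross e₁ h₁ e₂ h₂ := by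
    obtain ⟨x, hx⟩ := h.cross e₂ h₂ e₁ h₁
    exact ⟨x, hx.symm⟩
  not_common w := by
    obtain ⟨e₁, h₁, e₂, h₂, hw⟩ := h.not_common w
    exact ⟨e₂, h₂, e₁, h₁, fun hw' => hw hw'.symm⟩

/-- The pattern of the tails in `𝓖`. -/
def PatternG (E₁ E₂ : Finset (Finset ℕ)) : Prop :=
  ∃ a b, a ≠ b ∧ (∀ e ∈ E₁, a ∈ e ∧ b ∈ e) ∧ (∀ e ∈ E₂, a ∈ e ∨ b ∈ e) ∧
    ∀ Y, CrossTransversal E₁ E₂ Y → a ∈ Y ∧ b ∈ Y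

/-- The pattern of the tails in `𝓢₁`. -/
def PatternS₁ (E₁ E₂ : Finset (Finset ℕ)) : Prop :=
  ∃ a b c, a ≠ b ∧ a ≠ c ∧ b ≠ c ∧ (∀ e ∈ E₁, a ∈ e ∧ (b ∈ e ∨ c ∈ e)) ∧
    (∀ e ∈ E₂, a ∈ e ∨ (b ∈ e ∧ c ∈ e)) ∧
    ∀ Y, CrossTransversal E₁ E₂ Y → a ∈ Y ∧ b ∈ Y ∧ c ∈ Y

/-- The pattern of the tails in `𝓢`. -/
def PatternS (E₁ E₂ : Finset (Finset ℕ)) : Prop :=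
  ∃ a b c, a ≠ b ∧ a ≠ c ∧ b ≠ c ∧
    (∀ e ∈ E₁, (a ∈ e ∧ b ∈ e) ∨ (a ∈ e ∧ c ∈ e) ∨ (b ∈ e ∧ c ∈ e)) ∧
    (∀ e ∈ E₂, (a ∈ e ∧ b ∈ e) ∨ (a ∈ e ∧ c ∈ e) ∨ (b ∈ e ∧ c ∈ e)) ∧
    ∀ Y, CrossTransversal E₁ E₂ Y → a ∈ Y ∧ b ∈ Y ∧ c ∈ Y

/-- The graphs are small, and four vertices lie in every cross transversal. -/
def PatternSmall (E₁ E₂ : Finset (Finset ℕ)) : Prop :=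
  ∃ W : Finset ℕ, W.card = 4 ∧ E₁.card ≤ 4 ∧ E₂.card ≤ 4 ∧ ∀ Y, CrossTransversal E₁ E₂ Y → W ⊆ Y

theorem pair_of_card_two {e : Finset ℕ} (h : e.card = 2) {a b : ℕ} (ha : a ∈ e) (hb : b ∈ e)
    (hab : a ≠ b) : e = {a, b} :=
  (eq_of_subset_of_card_le (by simp [insert_subset_iff, ha, hb]) (by rw [h, card_pair hab])).symm

theorem exists_pair_of_card_two {e : Finset ℕ} (h : e.card = 2) {a : ℕ} (ha : a ∈ e) :
    ∃ b, b ≠ a ∧ e = {a, b} := by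
  obtain ⟨b, hb, hba⟩ := exists_mem_ne (by omega : 1 < e.card) a
  exact ⟨b, hba, pair_of_card_two h ha hb hba.symm⟩

namespace CrossPair

variable {E₁ E₂ : Finset (Finset ℕ)}

/-- Let `{a, b}` be the only edge of `E₁`. Since `b` is not common to all edges, some edge of `E₂`
misses it and meets `{a, b}` in `a` alone, which forces `a` into every cross transversal. The same
holds with `a` and `b` exchanged. -/
theorem patternG_of_subsingleton (h : CrossPair E₁ E₂) (hs : ∀ e ∈ E₁, ∀ f ∈ E₁, e = f) :
    PatternG E₁ E₂ := by
  obtain ⟨e, he⟩ := h.ne₁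
  obtain ⟨a, b, hab, rfl⟩ := card_eq_two.1 (h.card₁ e he)
  refine ⟨a, b, hab, fun f hf => by simp [hs f hf _ he], fun f hf => ?_, fun Y hY => ⟨?_, ?_⟩⟩
  · obtain ⟨x, hx, hxf⟩ := h.cross _ he f hf
    simp only [mem_insert, mem_singleton] at hx
    rcases hx with rfl | rfl
    · exact Or.inl hxf
    · exact Or.inr hxf
  · obtain ⟨e₁, h₁, e₂, h₂, hw⟩ := h.not_common b
    obtain ⟨x, hx1, hx2, hxY⟩ := hY e₁ h₁ e₂ h₂
    rw [hs e₁ h₁ _ he] at hw hx1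
    simp only [mem_insert, mem_singleton] at hw hx1
    rcases hx1 with rfl | rfl
    · exact hxY
    · tauto
  · obtain ⟨e₁, h₁, e₂, h₂, hw⟩ := h.not_common a
    obtain ⟨x, hx1, hx2, hxY⟩ := hY e₁ h₁ e₂ h₂
    rw [hs e₁ h₁ _ he] at hw hx1
    simp only [mem_insert, mem_singleton] at hw hx1
    rcases hx1 with rfl | rfl
    · tauto
    · exact hxY

/-- Each edge of the other graph takes one endpoint from each of the two disjoint edges. -/
theorem card_le_four (h : CrossPair E₁ E₂) {a b c d : ℕ} (h1 : {a, b} ∈ E₁) (h2 : {c, d} ∈ E₁)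
    (hac : a ≠ c) (had : a ≠ d) (hbc : b ≠ c) (hbd : b ≠ d) : E₂.card ≤ 4 := by
  refine (card_le_card (t := {{a, c}, {a, d}, {b, c}, {b, d}}) fun e he => ?_).trans Finset.card_le_four
  obtain ⟨x, hx, hxe⟩ := h.cross _ h1 e he
  obtain ⟨y, hy, hye⟩ := h.cross _ h2 e he
  have hc := h.card₂ e he
  simp only [mem_insert, mem_singleton] at hx hy ⊢
  rcases hx with rfl | rfl <;> rcases hy with rfl | rfl
  · exact Or.inl (pair_of_card_two hc hxe hye hac)
  · exact Or.inr (Or.inl (pair_of_card_two hc hxe hye had))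
  · exact Or.inr (Or.inr (Or.inl (pair_of_card_two hc hxe hye hbc)))
  · exact Or.inr (Or.inr (Or.inr (pair_of_card_two hc hxe hye hbd)))

/-- The four edges form a 4-cycle in which each vertex is the intersection of an edge of `E₁` with
an edge of `E₂`. -/
theorem patternSmall_of_disjoint (h : CrossPair E₁ E₂) {e f e' f' : Finset ℕ} (he : e ∈ E₁)
    (hf : f ∈ E₁) (hef : Disjoint e f) (he' : e' ∈ E₂) (hf' : f' ∈ E₂) (hef' : Disjoint e' f') :
    PatternSmall E₁ E₂ := by
  obtain ⟨a, ha, ha'⟩ := h.cross e he e' he'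
  obtain ⟨b, hb, hb'⟩ := h.cross e he f' hf'
  obtain ⟨c, hc, hc'⟩ := h.cross f hf e' he'
  obtain ⟨d, hd, hd'⟩ := h.cross f hf f' hf'
  rw [disjoint_left] at hef hef'
  have hab : a ≠ b := by rintro rfl; exact hef' ha' hb'
  have hac : a ≠ c := by rintro rfl; exact hef ha hc
  have had : a ≠ d := by rintro rfl; exact hef ha hd
  have hbc : b ≠ c := by rintro rfl; exact hef hb hc
  have hbd : b ≠ d := by rintro rfl; exact hef hb hd
  have hcd : c ≠ d := by rintro rfl; exact hef' hc' hd'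
  obtain rfl := pair_of_card_two (h.card₁ _ he) ha hb hab
  obtain rfl := pair_of_card_two (h.card₁ _ hf) hc hd hcd
  obtain rfl := pair_of_card_two (h.card₂ _ he') ha' hc' hac
  obtain rfl := pair_of_card_two (h.card₂ _ hf') hb' hd' hbd
  refine ⟨{a, b, c, d}, ?_, h.symm.card_le_four he' hf' hab had hbc.symm hcd,
    h.card_le_four he hf hac had hbc hbd, fun Y hY => ?_⟩
  · rw [card_insert_of_notMem (by simp [hab, hac, had]),
      card_insert_of_notMem (by simp [hbc, hbd]), card_pair hcd]
  · simp only [insert_subset_iff, singleton_subset_iff]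
    exact ⟨hY.mem he he' (by simp only [mem_insert, mem_singleton]; omega),
      hY.mem he hf' (by simp only [mem_insert, mem_singleton]; omega),
      hY.mem hf he' (by simp only [mem_insert, mem_singleton]; omega),
      hY.mem hf hf' (by simp only [mem_insert, mem_singleton]; omega)⟩

/-- `E₂` contains two edges `{a, c}`, `{a, d}`, and two disjoint edges meeting both of these must be
`{a, b}` and `{c, d}`. An edge of `E₂` missing `a` would have to contain `b`, `c` and `d`. -/
theorem patternS₁_of_disjoint (h : CrossPair E₁ E₂) {e f : Finset ℕ} (he : e ∈ E₁)
    (hf : f ∈ E₁) (hef : Disjoint e f) (hi : ∀ e ∈ E₂, ∀ f ∈ E₂, ¬ Disjoint e f)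
    (hs : ¬ ∀ e ∈ E₂, ∀ f ∈ E₂, e = f) : PatternS₁ E₂ E₁ := by
  push Not at hs
  obtain ⟨e', he', f', hf', hne⟩ := hs
  obtain ⟨a, ha, ha'⟩ := not_disjoint_iff.1 (hi e' he' f' hf')
  obtain ⟨c, hca, rfl⟩ := exists_pair_of_card_two (h.card₂ _ he') ha
  obtain ⟨d, hda, rfl⟩ := exists_pair_of_card_two (h.card₂ _ hf') ha'
  have hcd : c ≠ d := by rintro rfl; exact hne rfl
  -- one of the two disjoint edges contains `a`, the other is `{c, d}`
  obtain ⟨b, hab, hcd', hba, hbc, hbd⟩ : ∃ b, {a, b} ∈ E₁ ∧ {c, d} ∈ E₁ ∧ b ≠ a ∧ b ≠ c ∧ b ≠ d := by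
    have key : ∀ e ∈ E₁, ∀ f ∈ E₁, Disjoint e f → a ∈ e →
        ∃ b, {a, b} ∈ E₁ ∧ {c, d} ∈ E₁ ∧ b ≠ a ∧ b ≠ c ∧ b ≠ d := by
      intro e he f hf hd hae
      have haf := disjoint_left.1 hd hae
      obtain ⟨x, hx, hx'⟩ := h.cross f hf _ he'
      obtain ⟨y, hy, hy'⟩ := h.cross f hf _ hf'
      simp only [mem_insert, mem_singleton] at hx' hy'
      have hxc : x = c := hx'.resolve_left fun h => haf (h ▸ hx)
      have hyd : y = d := hy'.resolve_left fun h => haf (h ▸ hy)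
      subst hxc hyd
      obtain ⟨b, hb, rfl⟩ := exists_pair_of_card_two (h.card₁ _ he) hae
      have hb' := disjoint_left.1 hd (show b ∈ ({a, b} : Finset ℕ) by simp)
      refine ⟨b, he, ?_, hb, ?_, ?_⟩
      · rwa [← pair_of_card_two (h.card₁ _ hf) hx hy hcd]
      · rintro rfl
        exact hb' hx
      · rintro rfl
        exact hb' hy
    by_cases hae : a ∈ e
    · exact key e he f hf hef hae
    by_cases haf : a ∈ f
    · exact key f hf e he hef.symm haf
    obtain ⟨x, hx, hx'⟩ := h.cross e he _ he'
    obtain ⟨y, hy, hy'⟩ := h.cross f hf _ he'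
    simp only [mem_insert, mem_singleton] at hx' hy'
    rw [disjoint_left] at hef
    grind
  refine ⟨a, c, d, hca.symm, hda.symm, hcd, fun e he => ?_, fun e he => ?_, fun Y hY => ?_⟩
  · obtain ⟨x, hx, hx'⟩ := h.cross _ hab e he
    obtain ⟨y, hy, hy'⟩ := h.cross _ hcd' e he
    obtain ⟨z, hz, hz'⟩ := not_disjoint_iff.1 (hi _ he _ he')
    obtain ⟨w, hw, hw'⟩ := not_disjoint_iff.1 (hi _ he _ hf')
    have hsub : ∀ p q r, p ∈ e → q ∈ e → r ∈ e → p ≠ q → r = p ∨ r = q := by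
      intro p q r hp hq hr hpq
      rw [pair_of_card_two (h.card₂ _ he) hp hq hpq] at hr
      simpa using hr
    simp only [mem_insert, mem_singleton] at hx hy hz' hw'
    grind
  · obtain ⟨x, hx, hx'⟩ := h.cross _ he _ he'
    obtain ⟨y, hy, hy'⟩ := h.cross _ he _ hf'
    simp only [mem_insert, mem_singleton] at hx' hy'
    grind
  · exact ⟨hY.mem he' hab (by simp only [mem_insert, mem_singleton]; omega),
      hY.mem he' hcd' (by simp only [mem_insert, mem_singleton]; omega),
      hY.mem hf' hcd' (by simp only [mem_insert, mem_singleton]; omega)⟩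

/-- All edges of both graphs turn out to lie in one triangle `a b c`, where `{a, b}` and `{a, c}`
belong to `E₁`. Each vertex is the intersection of an edge of `E₁` with an edge of `E₂`. -/
theorem patternS_of_intersecting (h : CrossPair E₁ E₂)
    (hi₁ : ∀ e ∈ E₁, ∀ f ∈ E₁, ¬ Disjoint e f) (hi₂ : ∀ e ∈ E₂, ∀ f ∈ E₂, ¬ Disjoint e f)
    (hs₁ : ¬ ∀ e ∈ E₁, ∀ f ∈ E₁, e = f) (hs₂ : ¬ ∀ e ∈ E₂, ∀ f ∈ E₂, e = f) :
    PatternS E₁ E₂ := by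
  push Not at hs₁ hs₂
  obtain ⟨e, he, f, hf, hne⟩ := hs₁
  obtain ⟨a, ha, ha'⟩ := not_disjoint_iff.1 (hi₁ e he f hf)
  obtain ⟨b, hba, rfl⟩ := exists_pair_of_card_two (h.card₁ _ he) ha
  obtain ⟨c, hca, rfl⟩ := exists_pair_of_card_two (h.card₁ _ hf) ha'
  have hbc : b ≠ c := by rintro rfl; exact hne rfl
  have hmeet : ∀ (x y : ℕ) (e : Finset ℕ), (∃ z, z ∈ ({x, y} : Finset ℕ) ∧ z ∈ e) →
      x ∈ e ∨ y ∈ e := by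
    rintro x y e ⟨z, hz, hze⟩
    simp only [mem_insert, mem_singleton] at hz
    rcases hz with rfl | rfl
    · exact Or.inl hze
    · exact Or.inr hze
  have h₁ab : ∀ e ∈ E₁, a ∈ e ∨ b ∈ e := fun e he' =>
    hmeet _ _ _ (not_disjoint_iff.1 (hi₁ _ he _ he'))
  have h₁ac : ∀ e ∈ E₁, a ∈ e ∨ c ∈ e := fun e he' =>
    hmeet _ _ _ (not_disjoint_iff.1 (hi₁ _ hf _ he'))
  have h₂ab : ∀ e ∈ E₂, a ∈ e ∨ b ∈ e := fun e he' => hmeet _ _ _ (h.cross _ he _ he')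
  have h₂ac : ∀ e ∈ E₂, a ∈ e ∨ c ∈ e := fun e he' => hmeet _ _ _ (h.cross _ hf _ he')
  have majority : ∀ {p q r : Prop}, p ∨ q → p ∨ r → q ∨ r → (p ∧ q) ∨ (p ∧ r) ∨ (q ∧ r) := by
    clear * -
    tauto
  by_cases hbcE : {b, c} ∈ E₂
  · have h₁bc : ∀ e ∈ E₁, b ∈ e ∨ c ∈ e := fun e he' => hmeet _ _ _ (h.symm.cross _ hbcE _ he')
    have h₂bc : ∀ e ∈ E₂, b ∈ e ∨ c ∈ e := fun e he' =>
      hmeet _ _ _ (not_disjoint_iff.1 (hi₂ _ hbcE _ he'))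
    have hg : {a, b} ∈ E₂ ∨ {a, c} ∈ E₂ := by
      obtain ⟨g, hg, hgne⟩ : ∃ g ∈ E₂, g ≠ {b, c} := by
        obtain ⟨e', he', f', hf', hne'⟩ := hs₂
        by_cases h' : e' = {b, c}
        · exact ⟨f', hf', fun h'' => hne' (h'.trans h''.symm)⟩
        · exact ⟨e', he', h'⟩
      have hag : a ∈ g := by
        by_contra hag
        have := h₂ab g hg
        have := h₂ac g hg
        exact hgne (pair_of_card_two (h.card₂ g hg) (by tauto) (by tauto) hbc)
      rcases h₂bc g hg with hb | hc
      · left; rwa [← pair_of_card_two (h.card₂ g hg) hag hb hba.symm]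
      · right; rwa [← pair_of_card_two (h.card₂ g hg) hag hc hca.symm]
    refine ⟨a, b, c, hba.symm, hca.symm, hbc, fun e he => ?_, fun e he => ?_, fun Y hY => ?_⟩
    · exact majority (h₁ab e he) (h₁ac e he) (h₁bc e he)
    · exact majority (h₂ab e he) (h₂ac e he) (h₂bc e he)
    · refine ⟨?_, hY.mem he hbcE (by simp only [mem_insert, mem_singleton]; omega),
        hY.mem hf hbcE (by simp only [mem_insert, mem_singleton]; omega)⟩
      rcases hg with hg | hg
      · exact hY.mem hf hg (by simp only [mem_insert, mem_singleton]; omega)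
      · exact hY.mem he hg (by simp only [mem_insert, mem_singleton]; omega)
  -- Without `{b, c}` in `E₂`, all edges of `E₂` contain `a`. Then some edge of `E₁` must miss `a`,
  -- and it can only be `{b, c}`.
  · have h₂a : ∀ e ∈ E₂, a ∈ e := by
      intro e he
      by_contra hae
      have := h₂ab e he
      have := h₂ac e he
      refine hbcE ?_
      rwa [← pair_of_card_two (h.card₂ e he) (by tauto) (by tauto) hbc]
    have hbcE₁ : {b, c} ∈ E₁ := by
      obtain ⟨e₁, h₁, e₂, h₂, hw⟩ := h.not_common a
      have hae : a ∉ e₁ := fun h' => hw ⟨h', h₂a _ h₂⟩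
      have := h₁ab _ h₁
      have := h₁ac _ h₁
      rwa [← pair_of_card_two (h.card₁ _ h₁) (by tauto) (by tauto) hbc]
    have h₂bc : ∀ e ∈ E₂, b ∈ e ∨ c ∈ e := fun e he' => hmeet _ _ _ (h.cross _ hbcE₁ _ he')
    have h₁bc : ∀ e ∈ E₁, b ∈ e ∨ c ∈ e := fun e he' =>
      hmeet _ _ _ (not_disjoint_iff.1 (hi₁ _ hbcE₁ _ he'))
    have hE₂ : ∀ e ∈ E₂, e = {a, b} ∨ e = {a, c} := by
      intro e he
      rcases h₂bc e he with hb | hc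
      · exact Or.inl (pair_of_card_two (h.card₂ e he) (h₂a e he) hb hba.symm)
      · exact Or.inr (pair_of_card_two (h.card₂ e he) (h₂a e he) hc hca.symm)
    obtain ⟨hab₂, hac₂⟩ : {a, b} ∈ E₂ ∧ {a, c} ∈ E₂ := by
      obtain ⟨e', he', f', hf', hne'⟩ := hs₂
      rcases hE₂ e' he' with rfl | rfl <;> rcases hE₂ f' hf' with rfl | rfl
      · exact absurd rfl hne'
      · exact ⟨he', hf'⟩
      · exact ⟨hf', he'⟩
      · exact absurd rfl hne'
    refine ⟨a, b, c, hba.symm, hca.symm, hbc, fun e he => ?_, fun e he => ?_, fun Y hY => ?_⟩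
    · exact majority (h₁ab e he) (h₁ac e he) (h₁bc e he)
    · have h1 := h₂a e he
      exact (h₂bc e he).imp (fun h => ⟨h1, h⟩) (fun h => Or.inl ⟨h1, h⟩)
    · exact ⟨hY.mem he hac₂ (by simp only [mem_insert, mem_singleton]; omega),
        hY.mem hbcE₁ hab₂ (by simp only [mem_insert, mem_singleton]; omega),
        hY.mem hbcE₁ hac₂ (by simp only [mem_insert, mem_singleton]; omega)⟩

theorem classification (h : CrossPair E₁ E₂) : PatternG E₁ E₂ ∨ PatternG E₂ E₁ ∨
    PatternS₁ E₁ E₂ ∨ PatternS₁ E₂ E₁ ∨ PatternS E₁ E₂ ∨ PatternSmall E₁ E₂ := by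
  by_cases hs₁ : ∀ e ∈ E₁, ∀ f ∈ E₁, e = f
  · exact Or.inl (h.patternG_of_subsingleton hs₁)
  by_cases hs₂ : ∀ e ∈ E₂, ∀ f ∈ E₂, e = f
  · exact Or.inr (Or.inl (h.symm.patternG_of_subsingleton hs₂))
  refine Or.inr (Or.inr ?_)
  by_cases hi₁ : ∀ e ∈ E₁, ∀ f ∈ E₁, ¬ Disjoint e f <;>
    by_cases hi₂ : ∀ e ∈ E₂, ∀ f ∈ E₂, ¬ Disjoint e f
  · exact Or.inr (Or.inr (Or.inl (h.patternS_of_intersecting hi₁ hi₂ hs₁ hs₂)))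
  · push Not at hi₂
    obtain ⟨e, he, f, hf, hef⟩ := hi₂
    exact Or.inl (h.symm.patternS₁_of_disjoint he hf hef hi₁ hs₁)
  · push Not at hi₁
    obtain ⟨e, he, f, hf, hef⟩ := hi₁
    exact Or.inr (Or.inl (h.patternS₁_of_disjoint he hf hef hi₂ hs₂))
  · push Not at hi₁ hi₂
    obtain ⟨e, he, f, hf, hef⟩ := hi₁
    obtain ⟨e', he', f', hf', hef'⟩ := hi₂
    exact Or.inr (Or.inr (Or.inr (h.patternSmall_of_disjoint he hf hef he' hf' hef')))

end CrossPair

/-! ### Transversals of a maximal family -/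

/-- `T` is a set of at most `k` elements of `[n]` that meets `A ∩ B` for all `A, B ∈ 𝓕`. -/
structure IsTransversal (n k : ℕ) (𝓕 : Finset (Finset ℕ)) (T : Finset ℕ) : Prop where
  subset : T ⊆ Icc 1 n
  card_le : T.card ≤ k
  meets : ∀ A ∈ 𝓕, ∀ B ∈ 𝓕, ∃ x, x ∈ T ∧ x ∈ A ∧ x ∈ B

namespace IsMaxNontrivial

variable {n k : ℕ} {𝓕 : Finset (Finset ℕ)}

theorem exists_notMem (h : IsMaxNontrivial n k 3 𝓕) (hn : 1 ≤ n) (x : ℕ) : ∃ A ∈ 𝓕, x ∉ A := by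
  by_contra hx
  push Not at hx
  by_cases hx1 : x ∈ Icc 1 n
  · exact h.nontrivial ⟨x, hx1, hx⟩
  · refine h.nontrivial ⟨1, by simp [hn], fun A hA => ?_⟩
    exact absurd ((mem_kSubsets.1 (h.uniform hA)).1 (hx A hA)) hx1

theorem isTransversal_of_mem (h : IsMaxNontrivial n k 3 𝓕) {A : Finset ℕ} (hA : A ∈ 𝓕) :
    IsTransversal n k 𝓕 A where
  subset := (mem_kSubsets.1 (h.uniform hA)).1
  card_le := (mem_kSubsets.1 (h.uniform hA)).2.le
  meets B hB C hC := dWiseIntersecting_three.1 h.intersecting A hA B hB C hC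

/-- Adding `A` keeps the family intersecting; when `A` is repeated among the three sets, fewer
conditions are left to check. -/
theorem mem_of_transversal_subset (h : IsMaxNontrivial n k 3 𝓕) (hn1 : 1 ≤ n) {T A : Finset ℕ}
    (hT : IsTransversal n k 𝓕 T) (hA : A ∈ kSubsets n k) (hTA : T ⊆ A) : A ∈ 𝓕 := by
  by_contra hn
  refine h.maximal A hA hn (dWiseIntersecting_three.2 ?_)
  have h1 : ∀ B ∈ 𝓕, ∀ C ∈ 𝓕, ∃ x, x ∈ A ∧ x ∈ B ∧ x ∈ C := fun B hB C hC => by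
    obtain ⟨x, hx, hx'⟩ := hT.meets B hB C hC
    exact ⟨x, hTA hx, hx'⟩
  have h2 : ∀ B ∈ 𝓕, ∃ x, x ∈ A ∧ x ∈ B := fun B hB => by
    obtain ⟨x, hx, hx', -⟩ := h1 B hB B hB
    exact ⟨x, hx, hx'⟩
  have h3 : ∃ x, x ∈ A := by
    obtain ⟨B, hB, -⟩ := h.exists_notMem hn1 0
    obtain ⟨x, hx, -⟩ := h2 B hB
    exact ⟨x, hx⟩
  intro B hB C hC D hD
  rw [mem_insert] at hB hC hD
  rcases hB with rfl | hB <;> rcases hC with rfl | hC <;> rcases hD with rfl | hD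
  · obtain ⟨x, hx⟩ := h3
    exact ⟨x, hx, hx, hx⟩
  · obtain ⟨x, hx, hx'⟩ := h2 D hD
    exact ⟨x, hx, hx, hx'⟩
  · obtain ⟨x, hx, hx'⟩ := h2 C hC
    exact ⟨x, hx, hx', hx⟩
  · exact h1 C hC D hD
  · obtain ⟨x, hx, hx'⟩ := h2 B hB
    exact ⟨x, hx', hx, hx⟩
  · obtain ⟨x, hx, hx1, hx2⟩ := h1 B hB D hD
    exact ⟨x, hx1, hx, hx2⟩
  · obtain ⟨x, hx, hx1, hx2⟩ := h1 B hB C hC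
    exact ⟨x, hx1, hx2, hx⟩
  · exact dWiseIntersecting_three.1 h.intersecting B hB C hC D hD

/-- Extend `T₂` and `T₃` to members that pick up no new point of `T₁`. Then `T₁` meets the
intersection of these members. -/
theorem transversal_inter_three (h : IsMaxNontrivial n k 3 𝓕) (hn : 3 * k ≤ n) (hn1 : 1 ≤ n)
    {T₁ T₂ T₃ : Finset ℕ} (h₁ : IsTransversal n k 𝓕 T₁) (h₂ : IsTransversal n k 𝓕 T₂)
    (h₃ : IsTransversal n k 𝓕 T₃) : ∃ x, x ∈ T₁ ∧ x ∈ T₂ ∧ x ∈ T₃ := by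
  have := h₁.card_le
  obtain ⟨A, hA, hTA, hA'⟩ := exists_kSubset_avoiding T₁ h₂.subset h₂.card_le (by omega)
  obtain ⟨B, hB, hTB, hB'⟩ := exists_kSubset_avoiding T₁ h₃.subset h₃.card_le (by omega)
  obtain ⟨x, hx, hxA, hxB⟩ := h₁.meets A (h.mem_of_transversal_subset hn1 h₂ hA hTA) B
    (h.mem_of_transversal_subset hn1 h₃ hB hTB)
  exact ⟨x, hx, hA' x hxA hx, hB' x hxB hx⟩

/-- The third transversal is a member that misses `z`. -/
theorem transversal_inter_ne (h : IsMaxNontrivial n k 3 𝓕) (hn : 3 * k ≤ n) (hn1 : 1 ≤ n)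
    {T₁ T₂ : Finset ℕ} (h₁ : IsTransversal n k 𝓕 T₁) (h₂ : IsTransversal n k 𝓕 T₂) (z : ℕ) :
    ∃ x, x ∈ T₁ ∧ x ∈ T₂ ∧ x ≠ z := by
  obtain ⟨A, hA, hz⟩ := h.exists_notMem hn1 z
  obtain ⟨x, hx1, hx2, hxA⟩ := h.transversal_inter_three hn hn1 h₁ h₂ (h.isTransversal_of_mem hA)
  exact ⟨x, hx1, hx2, by rintro rfl; exact hz hxA⟩

theorem three_le_card_transversal (h : IsMaxNontrivial n k 3 𝓕) (hn : 3 * k ≤ n) (hn1 : 1 ≤ n)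
    {T : Finset ℕ} (hT : IsTransversal n k 𝓕 T) : 3 ≤ T.card := by
  obtain ⟨x, hx, -, -⟩ := h.transversal_inter_ne hn hn1 hT hT 0
  obtain ⟨A, hA, hxA⟩ := h.exists_notMem hn1 x
  have hAT := h.isTransversal_of_mem hA
  obtain ⟨y, hy, hyA, -⟩ := h.transversal_inter_ne hn hn1 hT hAT 0
  obtain ⟨z, hz, hzA, hzy⟩ := h.transversal_inter_ne hn hn1 hT hAT y
  have hxy : x ≠ y := by rintro rfl; exact hxA hyA
  have hxz : x ≠ z := by rintro rfl; exact hxA hzA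
  rw [← card_eq_three.2 ⟨x, y, z, hxy, hxz, hzy.symm, rfl⟩]
  exact card_le_card (by simp [insert_subset_iff, hx, hy, hz])

/-! ### The branching bound -/

/-- Every member containing a set `P` of at most three points has one of at most `k` further points.
Four rounds starting from `∅` leave at most `k ^ 4` sets of four points. -/
theorem card_le_of_branching {𝓖 : Finset (Finset ℕ)} (h𝓖 : 𝓖 ⊆ kSubsets n k) (hk : 4 ≤ k)
    (hD : ∀ P : Finset ℕ, P.card ≤ 3 → ∃ D : Finset ℕ, D.card ≤ k ∧
      ∀ F ∈ 𝓖, P ⊆ F → ∃ x ∈ D, x ∈ F ∧ x ∉ P) :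
    𝓖.card ≤ k ^ 4 * (n - 4).choose (k - 4) := by
  have key : ∀ j : ℕ, ∀ P : Finset ℕ, P.card + j = 4 →
      (𝓖.filter (fun F => P ⊆ F)).card ≤ k ^ j * (n - 4).choose (k - 4) := by
    intro j
    induction j with
    | zero =>
      intro P hP
      by_cases hPn : P ⊆ Icc 1 n
      · rw [pow_zero, one_mul, ← show P.card = 4 from hP, ← card_containing hPn (by omega)]
        refine card_le_card fun F hF => ?_
        rw [mem_filter] at hF
        exact mem_containingAvoiding.2 ⟨h𝓖 hF.1, hF.2, by simp⟩
      · rw [filter_eq_empty_iff.2]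
        · simp
        · exact fun F hF hPF => hPn (hPF.trans (mem_kSubsets.1 (h𝓖 hF)).1)
    | succ j ih =>
      intro P hP
      obtain ⟨D, hDk, hD⟩ := hD P (by omega)
      have hsub : 𝓖.filter (fun F => P ⊆ F) ⊆
          (D.filter (· ∉ P)).biUnion (fun x => 𝓖.filter (fun F => insert x P ⊆ F)) := by
        intro F hF
        rw [mem_filter] at hF
        obtain ⟨x, hx, hxF, hxP⟩ := hD F hF.1 hF.2
        exact mem_biUnion.2 ⟨x, mem_filter.2 ⟨hx, hxP⟩, mem_filter.2
          ⟨hF.1, insert_subset hxF hF.2⟩⟩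
      refine (card_le_card hsub).trans ((card_biUnion_le_card_mul _ _
        (k ^ j * (n - 4).choose (k - 4)) fun x hx => ih _ ?_).trans ?_)
      · rw [card_insert_of_notMem (mem_filter.1 hx).2]
        omega
      · rw [pow_succ', mul_assoc]
        exact Nat.mul_le_mul_right _ ((card_filter_le _ _).trans hDk)
  have := key 4 ∅ (by simp)
  rwa [filter_true_of_mem (fun F _ => empty_subset F)] at this

open Classical in
theorem card_le_of_triples (h : IsMaxNontrivial n k 3 𝓕) (hn : 3 * k ≤ n) (hk : 4 ≤ k) :
    𝓕.card ≤ {T ∈ powersetCard 3 (Icc 1 n) | IsTransversal n k 𝓕 T}.card *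
      (n - 3).choose (k - 3) + k ^ 4 * (n - 4).choose (k - 4) := by
  set 𝓣 := {T ∈ powersetCard 3 (Icc 1 n) | IsTransversal n k 𝓕 T} with h𝓣
  have hT : ∀ T, T ∈ 𝓣 ↔ T.card = 3 ∧ IsTransversal n k 𝓕 T := fun T => by
    rw [h𝓣, mem_filter, mem_powersetCard]
    exact ⟨fun h => ⟨h.1.2, h.2⟩, fun h => ⟨⟨h.2.subset, h.1⟩, h.2⟩⟩
  have hsub : 𝓕 ⊆ 𝓣.biUnion (fun T => containingAvoiding n k T ∅) ∪
      𝓕.filter (fun F => ∀ T ∈ 𝓣, ¬ T ⊆ F) := by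
    intro F hF
    rw [mem_union, mem_biUnion, mem_filter]
    by_cases hF' : ∀ T ∈ 𝓣, ¬ T ⊆ F
    · exact Or.inr ⟨hF, hF'⟩
    · push Not at hF'
      obtain ⟨T, hT, hTF⟩ := hF'
      exact Or.inl ⟨T, hT, mem_containingAvoiding.2 ⟨h.uniform hF, hTF, by simp⟩⟩
  refine (card_le_card hsub).trans ((card_union_le _ _).trans (add_le_add ?_ ?_))
  · refine card_biUnion_le_card_mul _ _ _ fun T hT' => ?_
    obtain ⟨h3, hT'⟩ := (hT T).1 hT'
    rw [card_containing hT'.subset hT'.card_le, h3]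
  · refine card_le_of_branching ((filter_subset _ _).trans h.uniform) hk fun P hP => ?_
    by_cases hPT : IsTransversal n k 𝓕 P
    · refine ⟨∅, by simp, fun F hF hPF => ?_⟩
      have := h.three_le_card_transversal hn (by omega) hPT
      exact absurd hPF ((mem_filter.1 hF).2 P ((hT P).2 ⟨by omega, hPT⟩))
    by_cases hPn : P ⊆ Icc 1 n
    -- A failing pair `A`, `B` gives the branching set `A ∩ B`: it is disjoint from `P` but meets
    -- every member.
    · have hm : ¬ ∀ A ∈ 𝓕, ∀ B ∈ 𝓕, ∃ x, x ∈ P ∧ x ∈ A ∧ x ∈ B := fun hm =>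
        hPT ⟨hPn, by omega, hm⟩
      push Not at hm
      obtain ⟨A, hA, B, hB, hAB⟩ := hm
      refine ⟨A ∩ B, (card_le_card inter_subset_left).trans (h.isTransversal_of_mem hA).card_le,
        fun F hF _ => ?_⟩
      obtain ⟨x, hxF, hxA, hxB⟩ := (h.isTransversal_of_mem (mem_filter.1 hF).1).meets A hA B hB
      exact ⟨x, mem_inter.2 ⟨hxA, hxB⟩, hxF, fun hxP => hAB x hxP hxA hxB⟩
    · exact ⟨∅, by simp, fun F hF hPF =>
        absurd (hPF.trans (mem_kSubsets.1 (h.uniform (mem_filter.1 hF).1)).1) hPn⟩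

end IsMaxNontrivial

/-! ### Families with many transversal triples -/

theorem IsMaxNontrivial.two_of_three {n k : ℕ} {𝓕 : Finset (Finset ℕ)}
    (h : IsMaxNontrivial n k 3 𝓕) (hn : 3 * k ≤ n) (hn1 : 1 ≤ n) {p q r : ℕ}
    (hT : IsTransversal n k 𝓕 {p, q, r}) {A : Finset ℕ} (hA : IsTransversal n k 𝓕 A) :
    (p ∈ A ∧ q ∈ A) ∨ (p ∈ A ∧ r ∈ A) ∨ (q ∈ A ∧ r ∈ A) := by
  obtain ⟨x, hx, hxA, -⟩ := h.transversal_inter_ne hn hn1 hT hA 0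
  obtain ⟨y, hy, hyA, hyx⟩ := h.transversal_inter_ne hn hn1 hT hA x
  simp only [mem_insert, mem_singleton] at hx hy
  rcases hx with rfl | rfl | rfl <;> rcases hy with rfl | rfl | rfl <;> simp_all

/-- The third triple must be `{v, x, y}`. Sharing two points with each of the three triples means
containing at least three of `u`, `v`, `x`, `y`. -/
theorem IsMaxNontrivial.eq_starH_of_three_triples {n k : ℕ} {𝓕 : Finset (Finset ℕ)}
    (h : IsMaxNontrivial n k 3 𝓕) (hk : 3 ≤ k) (hn : 6 * k ≤ n) {u v x y : ℕ} (huv : u ≠ v)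
    (hux : u ≠ x) (hvx : v ≠ x) (huy : u ≠ y) (hvy : v ≠ y) (hxy : x ≠ y)
    (h₁ : IsTransversal n k 𝓕 {u, v, x}) (h₂ : IsTransversal n k 𝓕 {u, v, y}) {T : Finset ℕ}
    (hT : IsTransversal n k 𝓕 T) (hT3 : T.card = 3) (huT : u ∉ T) :
    StarConfig n k u v {x, y} ∅ ∧ 𝓕 = starH n k u v {x, y} := by
  have hn3 : 3 * k ≤ n := by omega
  have hn1 : 1 ≤ n := by omega
  have hs := h₁.subset
  have hs' := h₂.subset
  simp only [insert_subset_iff, singleton_subset_iff] at hs hs'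
  have hc : StarConfig n k u v {x, y} ∅ :=
    { u_mem := hs.1
      v_mem := hs.2.1
      ne := huv
      X_sub := by simp only [insert_subset_iff, singleton_subset_iff]; exact ⟨hs.2.2, hs'.2.2⟩
      S_sub := by simp
      u_X := by simp [hux, huy]
      v_X := by simp [hvx, hvy]
      u_S := by simp
      v_S := by simp
      S_X := by simp
      S_card := by simp; omega
      X_card := by rw [card_pair hxy]
      X_card_le := by rw [card_pair hxy]; omega
      n_large := hn }
  have hTe : T = {v, x, y} := by
    have h3 := h.two_of_three hn3 hn1 h₁ hT
    have h4 := h.two_of_three hn3 hn1 h₂ hT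
    refine (eq_of_subset_of_card_le ?_ ?_).symm
    · simp only [insert_subset_iff, singleton_subset_iff]
      tauto
    · rw [hT3, card_eq_three.2 ⟨v, x, y, hvx, hvy, hxy, rfl⟩]
  subst hTe
  refine ⟨hc, h.eq_of_subset (fun A hA => ?_) (starFamily_subset ..)
    (starData_H hc).isMaxNontrivial.intersecting⟩
  have hA' := h.isTransversal_of_mem hA
  have h3 := h.two_of_three hn3 hn1 h₁ hA'
  have h4 := h.two_of_three hn3 hn1 h₂ hA'
  have h5 := h.two_of_three hn3 hn1 hT hA'
  refine mem_starFamily.2 ⟨h.uniform hA, ?_⟩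
  have hne : (A ∩ {x, y}).Nonempty ↔ x ∈ A ∨ y ∈ A := by
    simp [Finset.Nonempty, and_or_left, exists_or]
  rw [hne, insert_subset_iff, singleton_subset_iff]
  clear * - h3 h4 h5
  tauto

/-! ### Families whose transversal triples share two points -/

/-- The elements of `X` are those that form a transversal triple with `u` and `v`, and there are
at least two of them. -/
structure StarAt (n k : ℕ) (𝓕 : Finset (Finset ℕ)) (u v : ℕ) (X : Finset ℕ) : Prop where
  max : IsMaxNontrivial n k 3 𝓕
  k_large : 5 ≤ k
  n_large : 6 * k ≤ n
  ne : u ≠ v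
  mem_X : ∀ x, x ∈ X ↔ x ≠ u ∧ x ≠ v ∧ IsTransversal n k 𝓕 {u, v, x}
  X_card : 2 ≤ X.card

/-- The sets `A \ ({u} ∪ X)` for the members `A` of `𝓕` that miss `v`. -/
def tails (𝓕 : Finset (Finset ℕ)) (u v : ℕ) (X : Finset ℕ) : Finset (Finset ℕ) :=
  (𝓕.filter (fun A => v ∉ A)).image (fun A => A \ insert u X)

theorem mem_tails {𝓕 : Finset (Finset ℕ)} {u v : ℕ} {X e : Finset ℕ} :
    e ∈ tails 𝓕 u v X ↔ ∃ A ∈ 𝓕, v ∉ A ∧ A \ insert u X = e := by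
  simp [tails, and_assoc]

namespace StarAt

variable {n k : ℕ} {𝓕 : Finset (Finset ℕ)} {u v : ℕ} {X : Finset ℕ}

theorem symm (h : StarAt n k 𝓕 u v X) : StarAt n k 𝓕 v u X :=
  { h with
    ne := h.ne.symm
    mem_X := fun x => by rw [h.mem_X, insert_comm]; tauto }

theorem of_notMem_u (h : StarAt n k 𝓕 u v X) {A : Finset ℕ} (hA : A ∈ 𝓕) (hu : u ∉ A) :
    v ∈ A ∧ X ⊆ A := by
  have hn := h.n_large
  have hk := h.k_large
  have key : ∀ x ∈ X, v ∈ A ∧ x ∈ A := fun x hx => by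
    have := h.max.two_of_three (by omega) (by omega) ((h.mem_X x).1 hx).2.2
      (h.max.isTransversal_of_mem hA)
    tauto
  have hX := h.X_card
  obtain ⟨x, hx⟩ : X.Nonempty := card_pos.1 (by omega)
  exact ⟨(key x hx).1, fun y hy => (key y hy).2⟩

theorem of_notMem_v (h : StarAt n k 𝓕 u v X) {A : Finset ℕ} (hA : A ∈ 𝓕) (hv : v ∉ A) :
    u ∈ A ∧ X ⊆ A := h.symm.of_notMem_u hA hv

theorem u_notMem (h : StarAt n k 𝓕 u v X) : u ∉ X := fun hu => ((h.mem_X u).1 hu).1 rfl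

theorem config (h : StarAt n k 𝓕 u v X) : StarConfig n k u v X ∅ := by
  have hn := h.n_large
  have hk := h.k_large
  have hX := h.X_card
  obtain ⟨x, hx⟩ : X.Nonempty := card_pos.1 (by omega)
  have hs := ((h.mem_X x).1 hx).2.2.subset
  simp only [insert_subset_iff, singleton_subset_iff] at hs
  exact
    { u_mem := hs.1
      v_mem := hs.2.1
      ne := h.ne
      X_sub := fun y hy => ((h.mem_X y).1 hy).2.2.subset (by simp)
      S_sub := by simp
      u_X := h.u_notMem
      v_X := h.symm.u_notMem
      u_S := by simp
      v_S := by simp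
      S_X := by simp
      S_card := by simp; omega
      X_card := hX
      X_card_le := by
        obtain ⟨A, hA, hu⟩ := h.max.exists_notMem (by omega) u
        obtain ⟨hv, hXA⟩ := h.of_notMem_u hA hu
        rw [← card_insert_of_notMem h.symm.u_notMem, ← (mem_kSubsets.1 (h.max.uniform hA)).2]
        exact card_le_card (insert_subset hv hXA)
      n_large := hn }

theorem eq_starH (h : StarAt n k 𝓕 u v X)
    (hm : ∀ A ∈ 𝓕, u ∈ A → v ∈ A → (A ∩ X).Nonempty) : 𝓕 = starH n k u v X := by
  refine h.max.eq_of_subset (fun A hA => mem_starFamily.2 ⟨h.max.uniform hA, ?_⟩)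
    (starFamily_subset ..) (starData_H h.config).isMaxNontrivial.intersecting
  by_cases hu : u ∈ A
  · by_cases hv : v ∈ A
    · exact Or.inl ⟨hu, hv, Or.inl (hm A hA hu hv)⟩
    · exact Or.inr (Or.inl ⟨hu, (h.of_notMem_v hA hv).2, trivial⟩)
  · exact Or.inr (Or.inr ⟨(h.of_notMem_u hA hu).1, (h.of_notMem_u hA hu).2, trivial⟩)

theorem card_tail (h : StarAt n k 𝓕 u v X) {e : Finset ℕ} (he : e ∈ tails 𝓕 u v X) :
    e.card = k - (X.card + 1) := by
  obtain ⟨A, hA, hv, rfl⟩ := mem_tails.1 he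
  obtain ⟨hu, hX⟩ := h.of_notMem_v hA hv
  rw [card_sdiff_of_subset (insert_subset hu hX), (mem_kSubsets.1 (h.max.uniform hA)).2,
    card_insert_of_notMem h.u_notMem]

theorem tails_nonempty (h : StarAt n k 𝓕 u v X) : (tails 𝓕 u v X).Nonempty := by
  have := h.n_large
  have := h.k_large
  obtain ⟨A, hA, hv⟩ := h.max.exists_notMem (by omega) v
  exact ⟨_, mem_tails.2 ⟨A, hA, hv, rfl⟩⟩

theorem crossTransversal (h : StarAt n k 𝓕 u v X) {Y : Finset ℕ} (hY : Y ∈ 𝓕)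
    (hX : ¬ (Y ∩ X).Nonempty) :
    CrossTransversal (tails 𝓕 u v X) (tails 𝓕 v u X) (Y \ {u, v}) := by
  intro e₁ h₁ e₂ h₂
  obtain ⟨A, hA, hv, rfl⟩ := mem_tails.1 h₁
  obtain ⟨B, hB, hu, rfl⟩ := mem_tails.1 h₂
  obtain ⟨x, hxA, hxB, hxY⟩ := dWiseIntersecting_three.1 h.max.intersecting A hA B hB Y hY
  have hxX : x ∉ X := fun hx => hX ⟨x, mem_inter.2 ⟨hxY, hx⟩⟩
  have hxu : x ≠ u := by rintro rfl; exact hu hxB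
  have hxv : x ≠ v := by rintro rfl; exact hv hxA
  refine ⟨x, ?_, ?_, ?_⟩ <;> simp [hxA, hxB, hxY, hxX, hxu, hxv]

/-- A point common to all tails would make `{u, v, w}` a transversal triple and hence lie in `X`,
which the tails avoid. -/
theorem tails_not_common (h : StarAt n k 𝓕 u v X) (w : ℕ) :
    ∃ e₁ ∈ tails 𝓕 u v X, ∃ e₂ ∈ tails 𝓕 v u X, ¬ (w ∈ e₁ ∧ w ∈ e₂) := by
  have hc := h.config
  have hk := h.k_large
  by_cases hw : w = u ∨ w = v ∨ w ∈ X ∨ w ∉ Icc 1 n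
  · obtain ⟨e₁, he₁⟩ := h.tails_nonempty
    obtain ⟨e₂, he₂⟩ := h.symm.tails_nonempty
    refine ⟨e₁, he₁, e₂, he₂, ?_⟩
    obtain ⟨A, hA, hv, rfl⟩ := mem_tails.1 he₁
    obtain ⟨B, hB, hu, rfl⟩ := mem_tails.1 he₂
    rintro ⟨h1, h2⟩
    simp only [mem_sdiff, mem_insert] at h1 h2
    rcases hw with rfl | rfl | hw | hw
    · tauto
    · tauto
    · tauto
    · exact hw ((mem_kSubsets.1 (h.max.uniform hA)).1 h1.1)
  · push Not at hw
    obtain ⟨hwu, hwv, hwX, hwn⟩ := hw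
    have hnT : ¬ IsTransversal n k 𝓕 {u, v, w} := fun hT => hwX ((h.mem_X w).2 ⟨hwu, hwv, hT⟩)
    have hm : ¬ ∀ A ∈ 𝓕, ∀ B ∈ 𝓕, ∃ x, x ∈ ({u, v, w} : Finset ℕ) ∧ x ∈ A ∧ x ∈ B := fun hm =>
      hnT ⟨by simp only [insert_subset_iff, singleton_subset_iff]; exact ⟨hc.u_mem, hc.v_mem, hwn⟩,
        card_le_three.trans (by omega), hm⟩
    push Not at hm
    obtain ⟨A, hA, B, hB, hAB⟩ := hm
    have hu := hAB u (by simp)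
    have hv := hAB v (by simp)
    have hw := hAB w (by simp)
    by_cases huA : u ∈ A
    · have huB := hu huA
      have hvA : v ∉ A := fun hvA => hv hvA (h.of_notMem_u hB huB).1
      exact ⟨_, mem_tails.2 ⟨A, hA, hvA, rfl⟩, _, mem_tails.2 ⟨B, hB, huB, rfl⟩, fun h' =>
        hw (mem_sdiff.1 h'.1).1 (mem_sdiff.1 h'.2).1⟩
    · have hvB : v ∉ B := hv (h.of_notMem_u hA huA).1
      exact ⟨_, mem_tails.2 ⟨B, hB, hvB, rfl⟩, _, mem_tails.2 ⟨A, hA, huA, rfl⟩, fun h' =>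
        hw (mem_sdiff.1 h'.2).1 (mem_sdiff.1 h'.1).1⟩

/-- Otherwise tails have at most one point. Since they cross-intersect, they would all be the same
singleton, contradicting `tails_not_common`. -/
theorem card_X_le (h : StarAt n k 𝓕 u v X) {Y : Finset ℕ} (hY : Y ∈ 𝓕)
    (hX : ¬ (Y ∩ X).Nonempty) : X.card + 3 ≤ k := by
  by_contra hk
  have hle : ∀ (e : Finset ℕ) (x y : ℕ), e.card = k - (X.card + 1) → x ∈ e → y ∈ e → x = y := by
    intro e x y he hx hy
    exact card_le_one.1 (by omega) x hx y hy
  have hc := h.crossTransversal hY hX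
  obtain ⟨e₁, he₁⟩ := h.tails_nonempty
  obtain ⟨e₂, he₂⟩ := h.symm.tails_nonempty
  obtain ⟨x, hx₁, hx₂, -⟩ := hc e₁ he₁ e₂ he₂
  obtain ⟨f₁, hf₁, f₂, hf₂, hx⟩ := h.tails_not_common x
  obtain ⟨y, hy₁, hy₂, -⟩ := hc f₁ hf₁ e₂ he₂
  obtain ⟨z, hz₁, hz₂, -⟩ := hc e₁ he₁ f₂ hf₂
  rw [hle e₂ y x (h.symm.card_tail he₂) hy₂ hx₂] at hy₁
  rw [hle e₁ z x (h.card_tail he₁) hz₁ hx₁] at hz₂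
  exact hx ⟨hy₁, hz₂⟩

theorem crossPair (h : StarAt n k 𝓕 u v X) {Y : Finset ℕ} (hY : Y ∈ 𝓕)
    (hX : ¬ (Y ∩ X).Nonempty) (hXk : X.card + 3 = k) :
    CrossPair (tails 𝓕 u v X) (tails 𝓕 v u X) where
  card₁ e he := by rw [h.card_tail he]; omega
  card₂ e he := by rw [h.symm.card_tail he]; omega
  ne₁ := h.tails_nonempty
  ne₂ := h.symm.tails_nonempty
  cross e₁ h₁ e₂ h₂ := by
    obtain ⟨x, hx₁, hx₂, -⟩ := h.crossTransversal hY hX e₁ h₁ e₂ h₂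
    exact ⟨x, hx₁, hx₂⟩
  not_common := h.tails_not_common

theorem config_of_subset (h : StarAt n k 𝓕 u v X) {Y S : Finset ℕ} (hY : Y ∈ 𝓕) (hu : u ∈ Y)
    (hv : v ∈ Y) (hX : ¬ (Y ∩ X).Nonempty) (hS : S ⊆ Y \ {u, v}) : StarConfig n k u v X S := by
  have hY' := mem_kSubsets.1 (h.max.uniform hY)
  have huv : ({u, v} : Finset ℕ) ⊆ Y := by simp [insert_subset_iff, hu, hv]
  exact
  { h.config with
    S_sub := hS.trans (sdiff_subset.trans hY'.1)
    u_S := fun h' => by have := hS h'; simp at this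
    v_S := fun h' => by have := hS h'; simp at this
    S_X := disjoint_left.2 fun x hx hxX =>
      hX ⟨x, mem_inter.2 ⟨(mem_sdiff.1 (hS hx)).1, hxX⟩⟩
    S_card := by
      have h1 := card_le_card hS
      rw [card_sdiff_of_subset huv, card_pair h.ne, hY'.2] at h1
      have := h.k_large
      omega }

theorem subset_starFamily (h : StarAt n k 𝓕 u v X) {q p₁ p₂ : Finset ℕ → Prop}
    (q_mono : ∀ A B, A ⊆ B → q A → q B) (p₁_mono : ∀ A B, A ⊆ B → p₁ A → p₁ B)
    (p₂_mono : ∀ A B, A ⊆ B → p₂ A → p₂ B) (h₁ : ∀ e ∈ tails 𝓕 u v X, p₁ e)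
    (h₂ : ∀ e ∈ tails 𝓕 v u X, p₂ e)
    (hq : ∀ Y, CrossTransversal (tails 𝓕 u v X) (tails 𝓕 v u X) Y → q Y) :
    𝓕 ⊆ starFamily n k u v X q p₁ p₂ := by
  refine fun A hA => mem_starFamily.2 ⟨h.max.uniform hA, ?_⟩
  by_cases hu : u ∈ A
  · by_cases hv : v ∈ A
    · refine Or.inl ⟨hu, hv, ?_⟩
      by_cases hX : (A ∩ X).Nonempty
      · exact Or.inl hX
      · exact Or.inr (q_mono _ _ sdiff_subset (hq _ (h.crossTransversal hA hX)))
    · exact Or.inr (Or.inl ⟨hu, (h.of_notMem_v hA hv).2,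
        p₁_mono _ _ sdiff_subset (h₁ _ (mem_tails.2 ⟨A, hA, hv, rfl⟩))⟩)
  · exact Or.inr (Or.inr ⟨(h.of_notMem_u hA hu).1, (h.of_notMem_u hA hu).2,
      p₂_mono _ _ sdiff_subset (h₂ _ (mem_tails.2 ⟨A, hA, hu, rfl⟩))⟩)

theorem eq_starFamily (h : StarAt n k 𝓕 u v X) {S : Finset ℕ} {q p₁ p₂ : Finset ℕ → Prop}
    (hd : StarData n k u v X S q p₁ p₂) (h₁ : ∀ e ∈ tails 𝓕 u v X, p₁ e)
    (h₂ : ∀ e ∈ tails 𝓕 v u X, p₂ e)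
    (hq : ∀ Y, CrossTransversal (tails 𝓕 u v X) (tails 𝓕 v u X) Y → q Y) :
    𝓕 = starFamily n k u v X q p₁ p₂ :=
  h.max.eq_of_subset (h.subset_starFamily hd.q_mono hd.p₁_mono hd.p₂_mono h₁ h₂ hq)
    (starFamily_subset ..) hd.isMaxNontrivial.intersecting

theorem eq_starG (h : StarAt n k 𝓕 u v X) {Y : Finset ℕ} (hY : Y ∈ 𝓕) (hu : u ∈ Y)
    (hv : v ∈ Y) (hX : ¬ (Y ∩ X).Nonempty) (hXk : X.card + 3 = k)
    (hp : PatternG (tails 𝓕 u v X) (tails 𝓕 v u X)) :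
    ∃ a b, a ≠ b ∧ StarConfig n k u v X {a, b} ∧ 𝓕 = starG n k u v X a b := by
  obtain ⟨a, b, hab, h₁, h₂, hq⟩ := hp
  have hS := hq _ (h.crossTransversal hY hX)
  have hc : StarConfig n k u v X {a, b} := h.config_of_subset hY hu hv hX (by
    simpa only [insert_subset_iff, singleton_subset_iff] using hS)
  exact ⟨a, b, hab, hc, h.eq_starFamily (starData_G hXk.le hc) h₁ h₂ hq⟩

theorem eq_starS₁ (h : StarAt n k 𝓕 u v X) {Y : Finset ℕ} (hY : Y ∈ 𝓕) (hu : u ∈ Y)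
    (hv : v ∈ Y) (hX : ¬ (Y ∩ X).Nonempty) (hXk : X.card + 3 = k)
    (hp : PatternS₁ (tails 𝓕 u v X) (tails 𝓕 v u X)) :
    ∃ a b c, a ≠ b ∧ a ≠ c ∧ b ≠ c ∧ StarConfig n k u v X {a, b, c} ∧
      𝓕 = starS₁ n k u v X a b c := by
  obtain ⟨a, b, c, hab, hac, hbc, h₁, h₂, hq⟩ := hp
  have hS := hq _ (h.crossTransversal hY hX)
  have hc : StarConfig n k u v X {a, b, c} := h.config_of_subset hY hu hv hX (by
    simpa only [insert_subset_iff, singleton_subset_iff] using hS)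
  exact ⟨a, b, c, hab, hac, hbc, hc,
    h.eq_starFamily (starData_S₁ hXk.le hab hac hbc hc) h₁ h₂ hq⟩

theorem eq_starS (h : StarAt n k 𝓕 u v X) {Y : Finset ℕ} (hY : Y ∈ 𝓕) (hu : u ∈ Y)
    (hv : v ∈ Y) (hX : ¬ (Y ∩ X).Nonempty) (hXk : X.card + 3 = k)
    (hp : PatternS (tails 𝓕 u v X) (tails 𝓕 v u X)) :
    ∃ a b c, a ≠ b ∧ a ≠ c ∧ b ≠ c ∧ StarConfig n k u v X {a, b, c} ∧
      𝓕 = starS n k u v X a b c := by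
  obtain ⟨a, b, c, hab, hac, hbc, h₁, h₂, hq⟩ := hp
  have hS := hq _ (h.crossTransversal hY hX)
  have hc : StarConfig n k u v X {a, b, c} := h.config_of_subset hY hu hv hX (by
    simpa only [insert_subset_iff, singleton_subset_iff] using hS)
  exact ⟨a, b, c, hab, hac, hbc, hc,
    h.eq_starFamily (starData_S hXk.le hab hac hbc hc) h₁ h₂ hq⟩

theorem card_filter_le_tails (h : StarAt n k 𝓕 u v X) :
    (𝓕.filter (fun A => v ∉ A)).card ≤ (tails 𝓕 u v X).card := by
  refine (card_image_of_injOn ?_).ge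
  intro A hA B hB hAB
  rw [mem_coe, mem_filter] at hA hB
  obtain ⟨hu, hX⟩ := h.of_notMem_v hA.1 hA.2
  obtain ⟨hu', hX'⟩ := h.of_notMem_v hB.1 hB.2
  rw [← sdiff_union_of_subset (insert_subset hu hX), ← sdiff_union_of_subset (insert_subset hu' hX')]
  exact congrArg (· ∪ insert u X) hAB

/-- A member through `u`, `v` avoiding `X` must contain all four points of `W`, so `k ≥ 6`. At most
`4 + 4` members miss `u` or `v`, because a member missing `v` is determined by its tail, and
likewise for `u`. -/
theorem card_le_of_patternSmall (h : StarAt n k 𝓕 u v X) {Y : Finset ℕ} (hY : Y ∈ 𝓕)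
    (hu : u ∈ Y) (hv : v ∈ Y) (hX : ¬ (Y ∩ X).Nonempty) (hXk : X.card + 3 = k)
    (hp : PatternSmall (tails 𝓕 u v X) (tails 𝓕 v u X)) :
    6 ≤ k ∧ 𝓕.card ≤ coreCard n k (k - 3) + (n - k - 3).choose (k - 6) + 8 := by
  obtain ⟨W, hW, h₁, h₂, hq⟩ := hp
  have hc : StarConfig n k u v X W := h.config_of_subset hY hu hv hX
    (hq _ (h.crossTransversal hY hX))
  have hk := hc.S_card
  have hsub : 𝓕 ⊆ (starCore n k u v X ∪ containingAvoiding n k (insert u (insert v W)) X) ∪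
      (𝓕.filter (fun A => v ∉ A) ∪ 𝓕.filter (fun A => u ∉ A)) := by
    intro A hA
    simp only [mem_union, mem_filter]
    by_cases huA : u ∈ A
    · by_cases hvA : v ∈ A
      · by_cases hXA : (A ∩ X).Nonempty
        · exact Or.inl (Or.inl (mem_starCore.2 ⟨h.max.uniform hA, huA, hvA, hXA⟩))
        · refine Or.inl (Or.inr (mem_containingAvoiding.2 ⟨h.max.uniform hA, ?_, ?_⟩))
          · exact insert_subset huA (insert_subset hvA
              ((hq _ (h.crossTransversal hA hXA)).trans sdiff_subset))
          · rwa [disjoint_iff_not_nonempty]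
      · exact Or.inr (Or.inl ⟨hA, hvA⟩)
    · exact Or.inr (Or.inr ⟨hA, huA⟩)
  have h3 := card_le_card hsub
  have h4 := card_union_le (starCore n k u v X ∪ containingAvoiding n k (insert u (insert v W)) X)
    (𝓕.filter (fun A => v ∉ A) ∪ 𝓕.filter (fun A => u ∉ A))
  have h5 := card_union_le (starCore n k u v X) (containingAvoiding n k (insert u (insert v W)) X)
  have h6 := card_union_le (𝓕.filter (fun A => v ∉ A)) (𝓕.filter (fun A => u ∉ A))
  have h7 := h.card_filter_le_tails
  have h8 := h.symm.card_filter_le_tails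
  rw [hc.card_core, hc.card_middle, hW, show n - (4 + 2) - X.card = n - k - 3 by omega,
    show X.card = k - 3 by omega] at h5
  simp only [Nat.reduceAdd] at h5
  omega

theorem classification (h : StarAt n k 𝓕 u v X) (hXk : k ≤ X.card + 3) :
    (6 ≤ k ∧ 𝓕.card ≤ coreCard n k (k - 3) + (n - k - 3).choose (k - 6) + 8) ∨
    (∃ u v, StarConfig n k u v X ∅ ∧ 𝓕 = starH n k u v X) ∨
    (∃ u v a b, X.card + 3 = k ∧ a ≠ b ∧ StarConfig n k u v X {a, b} ∧
      𝓕 = starG n k u v X a b) ∨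
    (∃ u v a b c, X.card + 3 = k ∧ a ≠ b ∧ a ≠ c ∧ b ≠ c ∧ StarConfig n k u v X {a, b, c} ∧
      𝓕 = starS₁ n k u v X a b c) ∨
    (∃ u v a b c, X.card + 3 = k ∧ a ≠ b ∧ a ≠ c ∧ b ≠ c ∧ StarConfig n k u v X {a, b, c} ∧
      𝓕 = starS n k u v X a b c) := by
  by_cases hm : ∀ A ∈ 𝓕, u ∈ A → v ∈ A → (A ∩ X).Nonempty
  · exact Or.inr (Or.inl ⟨u, v, h.config, h.eq_starH hm⟩)
  push Not at hm
  obtain ⟨Y, hY, hu, hv, hX⟩ := hm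
  rw [← not_nonempty_iff_eq_empty] at hX
  have hXk' : X.card + 3 = k := le_antisymm (h.card_X_le hY hX) hXk
  rcases (h.crossPair hY hX hXk').classification with hp | hp | hp | hp | hp | hp
  · exact Or.inr (Or.inr (Or.inl ⟨u, v, by
      obtain ⟨a, b, h'⟩ := h.eq_starG hY hu hv hX hXk' hp
      exact ⟨a, b, hXk', h'⟩⟩))
  · exact Or.inr (Or.inr (Or.inl ⟨v, u, by
      obtain ⟨a, b, h'⟩ := h.symm.eq_starG hY hv hu hX hXk' hp
      exact ⟨a, b, hXk', h'⟩⟩))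
  · exact Or.inr (Or.inr (Or.inr (Or.inl ⟨u, v, by
      obtain ⟨a, b, c, h'⟩ := h.eq_starS₁ hY hu hv hX hXk' hp
      exact ⟨a, b, c, hXk', h'⟩⟩)))
  · exact Or.inr (Or.inr (Or.inr (Or.inl ⟨v, u, by
      obtain ⟨a, b, c, h'⟩ := h.symm.eq_starS₁ hY hv hu hX hXk' hp
      exact ⟨a, b, c, hXk', h'⟩⟩)))
  · exact Or.inr (Or.inr (Or.inr (Or.inr ⟨u, v, by
      obtain ⟨a, b, c, h'⟩ := h.eq_starS hY hu hv hX hXk' hp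
      exact ⟨a, b, c, hXk', h'⟩⟩)))
  · exact Or.inl (h.card_le_of_patternSmall hY hu hv hX hXk' hp)

end StarAt

open Classical in
theorem IsMaxNontrivial.exists_starAt {n k : ℕ} {𝓕 : Finset (Finset ℕ)}
    (h : IsMaxNontrivial n k 3 𝓕) (hk : 5 ≤ k) (hn : 6 * k ≤ n)
    (h2 : 2 ≤ {T ∈ powersetCard 3 (Icc 1 n) | IsTransversal n k 𝓕 T}.card) :
    (∃ u v X, X.card = 2 ∧ StarConfig n k u v X ∅ ∧ 𝓕 = starH n k u v X) ∨
    ∃ u v X, {T ∈ powersetCard 3 (Icc 1 n) | IsTransversal n k 𝓕 T}.card ≤ X.card ∧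
      StarAt n k 𝓕 u v X := by
  set 𝓣 := {T ∈ powersetCard 3 (Icc 1 n) | IsTransversal n k 𝓕 T} with h𝓣
  have hn3 : 3 * k ≤ n := by omega
  have hn1 : 1 ≤ n := by omega
  have hT : ∀ T, T ∈ 𝓣 ↔ T.card = 3 ∧ IsTransversal n k 𝓕 T := fun T => by
    rw [h𝓣, mem_filter, mem_powersetCard]
    exact ⟨fun h => ⟨h.1.2, h.2⟩, fun h => ⟨⟨h.2.subset, h.1⟩, h.2⟩⟩
  obtain ⟨T₁, hT₁, T₂, hT₂, hne⟩ := one_lt_card.1 h2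
  rw [hT] at hT₁ hT₂
  obtain ⟨u, hu₁, hu₂, -⟩ := h.transversal_inter_ne hn3 hn1 hT₁.2 hT₂.2 0
  obtain ⟨v, hv₁, hv₂, hvu⟩ := h.transversal_inter_ne hn3 hn1 hT₁.2 hT₂.2 u
  have hthird : ∀ T : Finset ℕ, T.card = 3 → u ∈ T → v ∈ T → ∃ x, x ≠ u ∧ x ≠ v ∧ T = {u, v, x} := by
    intro T hT3 hu hv
    obtain ⟨x, hx, hx', rfl⟩ := exists_eq_insert (P := {u, v}) (F := T)
      (by simp [insert_subset_iff, hu, hv]) (by rw [hT3, card_pair hvu.symm])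
    simp only [mem_insert, mem_singleton, not_or] at hx'
    exact ⟨x, hx'.1, hx'.2, by ext y; simp; tauto⟩
  -- The dichotomy: either all triples contain `u` and `v`, or a triple missing one of them closes
  -- up on four points.
  by_cases hall : ∀ T ∈ 𝓣, u ∈ T ∧ v ∈ T
  · right
    set X := (Icc 1 n).filter (fun x => x ≠ u ∧ x ≠ v ∧ IsTransversal n k 𝓕 {u, v, x}) with hX
    have hXc : 𝓣.card ≤ X.card := by
      refine (card_le_card (t := X.image (fun x => ({u, v, x} : Finset ℕ))) fun T hT' => ?_).trans
        card_image_le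
      obtain ⟨hu, hv⟩ := hall T hT'
      rw [hT] at hT'
      obtain ⟨x, hxu, hxv, rfl⟩ := hthird T hT'.1 hu hv
      exact mem_image.2 ⟨x, mem_filter.2 ⟨hT'.2.subset (by simp), hxu, hxv, hT'.2⟩, rfl⟩
    refine ⟨u, v, X, hXc, h, hk, hn, hvu.symm, fun x => ?_, by omega⟩
    rw [hX, mem_filter]
    exact ⟨fun h => h.2, fun h => ⟨h.2.2.subset (by simp), h⟩⟩
  · left
    obtain ⟨x, hxu, hxv, rfl⟩ := hthird T₁ hT₁.1 hu₁ hv₁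
    obtain ⟨y, hyu, hyv, rfl⟩ := hthird T₂ hT₂.1 hu₂ hv₂
    have hxy : x ≠ y := by rintro rfl; exact hne rfl
    push Not at hall
    obtain ⟨T, hT', hnot⟩ := hall
    rw [hT] at hT'
    by_cases hu : u ∈ T
    · have hv := hnot hu
      have h1 := hT₁.2
      have h2 := hT₂.2
      rw [insert_comm] at h1 h2
      exact ⟨v, u, {x, y}, card_pair hxy, h.eq_starH_of_three_triples (by omega) hn hvu hxv.symm
        hxu.symm hyv.symm hyu.symm hxy h1 h2 hT'.2 hT'.1 hv⟩
    · exact ⟨u, v, {x, y}, card_pair hxy, h.eq_starH_of_three_triples (by omega) hn hvu.symm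
        hxu.symm hxv.symm hyu.symm hyv.symm hxy hT₁.2 hT₂.2 hT'.2 hT'.1 hu⟩

/-! ### Numerical estimates -/

/-- Only a polynomial bound is used later. The factor `240` is `2 * 5!`. -/
theorem lt_of_nOne_lt {n k : ℕ} (hk : 5 ≤ k) (hn : nOne k 3 < n) : 240 * (k - 3) * k ^ 5 < n := by
  refine lt_of_le_of_lt ?_ hn
  have h1 : k ≤ k ^ (k - 3) - 1 := by
    have h2 : k ^ 2 ≤ k ^ (k - 3) := Nat.pow_le_pow_right (by omega) (by omega)
    have h3 : k + 1 ≤ k ^ 2 := by nlinarith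
    omega
  have h2 : k ^ 5 ≤ (k ^ (k - 3) - 1) ^ k :=
    (Nat.pow_le_pow_right (by omega) hk).trans (Nat.pow_le_pow_left h1 k)
  have h3 : 120 ≤ k.factorial := Nat.factorial_le hk
  have h4 : k - 3 ≤ (k - 3) ^ 2 := Nat.le_self_pow (by norm_num) _
  have h5 := Nat.mul_le_mul (Nat.mul_le_mul h4 h2) h3
  rw [nOne]
  nlinarith

theorem mul_choose_le_choose_succ {m j c : ℕ} (h : (c + 1) * (j + 1) ≤ m) :
    c * m.choose j ≤ m.choose (j + 1) := by
  have h1 := Nat.choose_succ_right_eq m j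
  have h2 : c * (j + 1) ≤ m - j := by
    have : (c + 1) * (j + 1) = c * (j + 1) + j + 1 := by ring
    omega
  refine Nat.le_of_mul_le_mul_right ?_ (Nat.succ_pos j)
  calc c * m.choose j * (j + 1) = m.choose j * (c * (j + 1)) := by ring
    _ ≤ m.choose j * (m - j) := Nat.mul_le_mul_left _ h2
    _ = _ := h1.symm

theorem choose_le_choose_of_le_of_large {m i j : ℕ} (hij : i ≤ j) (h : 2 * j ≤ m) :
    m.choose i ≤ m.choose j := by
  induction j, hij using Nat.le_induction with
  | base => exact le_rfl
  | succ j hij ih =>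
    refine (ih (by omega)).trans ?_
    simpa using mul_choose_le_choose_succ (c := 1) (m := m) (j := j) (by omega)

theorem coreCard_succ {n k l : ℕ} (hk : 3 ≤ k) (hl : l + 3 ≤ n) :
    coreCard n k (l + 1) = coreCard n k l + (n - 3 - l).choose (k - 3) := by
  have h1 : (n - 2 - l).choose (k - 2) =
      (n - 3 - l).choose (k - 3) + (n - 3 - l).choose (k - 2) := by
    rw [show n - 2 - l = n - 3 - l + 1 by omega, show k - 2 = k - 3 + 1 by omega,
      Nat.choose_succ_succ']
  have h2 : (n - 2 - l).choose (k - 2) ≤ (n - 2).choose (k - 2) :=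
    Nat.choose_le_choose _ (by omega)
  rw [coreCard, coreCard, show n - 2 - (l + 1) = n - 3 - l by omega]
  omega

theorem choose_le_choose_sub_add {m j l : ℕ} (hl : l ≤ m) :
    m.choose (j + 1) ≤ (m - l).choose (j + 1) + l * (m - 1).choose j := by
  induction l with
  | zero => simp
  | succ l ih =>
    have h1 := ih (by omega)
    have h2 : (m - l).choose (j + 1) = (m - (l + 1)).choose j + (m - (l + 1)).choose (j + 1) := by
      rw [show m - l = m - (l + 1) + 1 by omega, Nat.choose_succ_succ']
    have h3 : (m - (l + 1)).choose j ≤ (m - 1).choose j := Nat.choose_le_choose _ (by omega)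
    rw [add_mul]
    omega

/-- A truncated inclusion-exclusion: the `l` points of `X` each contribute `C(n-3, k-3)`, up to an
error of order `C(n-4, k-4)`. -/
theorem mul_choose_le_coreCard_add {n k l : ℕ} (hk : 4 ≤ k) (hl : l + 3 ≤ n) :
    l * (n - 3).choose (k - 3) ≤ coreCard n k l + l * l * (n - 4).choose (k - 4) := by
  induction l with
  | zero => simp
  | succ l ih =>
    have h1 := ih (by omega)
    have h2 := coreCard_succ (n := n) (k := k) (l := l) (by omega) (by omega)
    have h3 := choose_le_choose_sub_add (m := n - 3) (j := k - 4) (l := l) (by omega)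
    rw [show k - 4 + 1 = k - 3 by omega, show n - 3 - 1 = n - 4 by omega] at h3
    rw [h2]
    nlinarith [Nat.zero_le ((n - 4).choose (k - 4)), Nat.zero_le l]

theorem triples_bound_lt {n k : ℕ} (hk : 5 ≤ k) (hn : 240 * (k - 3) * k ^ 5 < n) :
    (k - 4) * (n - 3).choose (k - 3) + k ^ 4 * (n - 4).choose (k - 4) < coreCard n k (k - 3) := by
  obtain ⟨j, rfl⟩ : ∃ j, k = j + 4 := ⟨k - 4, by omega⟩
  have e3 : j + 4 - 3 = j + 1 := by omega
  have e4 : j + 4 - 4 = j := by omega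
  rw [e3] at hn
  rw [e3, e4]
  have hn1 : j + 4 < n := by
    refine lt_of_le_of_lt ?_ hn
    have : (j + 4) ^ 1 ≤ (j + 4) ^ 5 := Nat.pow_le_pow_right (by omega) (by omega)
    nlinarith
  have h1 := mul_choose_le_coreCard_add (n := n) (k := j + 4) (l := j + 1) (by omega) (by omega)
  rw [e3, e4] at h1
  have h2 := Nat.add_one_mul_choose_eq (n - 4) j
  rw [show n - 4 + 1 = n - 3 by omega] at h2
  have hB : 0 < (n - 4).choose j := Nat.choose_pos (by omega)
  -- The ratio of `C(n-3, j+1)` to `C(n-4, j)` is `(n-3)/(j+1)`. It has to exceed the combined error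
  -- coefficients of the branching bound and of `mul_choose_le_coreCard_add`.
  have h3 : ((j + 4) ^ 4 + (j + 1) * (j + 1)) * (j + 1) < n - 3 := by
    have h4 : (j + 4) ^ 4 + (j + 1) * (j + 1) + 3 ≤ 240 * (j + 4) ^ 5 := by
      have : (j + 4) ^ 5 = (j + 4) * (j + 4) ^ 4 := by ring
      nlinarith [Nat.pow_le_pow_right (show 1 ≤ j + 4 by omega) (show 2 ≤ 4 by norm_num)]
    have h5 := Nat.mul_le_mul_right (j + 1) h4
    have h6 : 3 ≤ 3 * (j + 1) := by omega
    have h7 : 240 * (j + 4) ^ 5 * (j + 1) = 240 * (j + 1) * (j + 4) ^ 5 := by ring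
    rw [add_mul] at h5
    omega
  have h4 : ((j + 4) ^ 4 + (j + 1) * (j + 1)) * (n - 4).choose j < (n - 3).choose (j + 1) := by
    refine Nat.lt_of_mul_lt_mul_right (a := j + 1) ?_
    rw [← h2]
    nlinarith
  have h5 : (j + 1) * (n - 3).choose (j + 1) = j * (n - 3).choose (j + 1) +
    (n - 3).choose (j + 1) := by ring
  rw [add_mul] at h4
  omega

section Comparisons

variable {n k : ℕ}

/-- The size of the family `𝓗(k, 3, l)`. -/
def sizeH (n k l : ℕ) : ℕ := coreCard n k l + 2 * (n - l - 2).choose (k - l - 1)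

theorem large_of_bound (hk : 5 ≤ k) (hn : 240 * (k - 3) * k ^ 5 < n) : 1000 * k ≤ n := by
  have h1 : 1 ≤ k - 3 := by omega
  have h2 : 5 ^ 4 ≤ k ^ 4 := Nat.pow_le_pow_left hk 4
  have h3 : k ^ 5 = k ^ 4 * k := by ring
  have h4 : 240 * 1 * k ^ 5 ≤ 240 * (k - 3) * k ^ 5 := by gcongr
  nlinarith

theorem ten_mul_lt_choose {m j : ℕ} (hj : 2 ≤ j) (hm : 30 * j ≤ m) : 10 * m ≤ m.choose j := by
  have h1 := mul_choose_le_choose_succ (m := m) (j := 1) (c := 10) (by omega)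
  rw [Nat.choose_one_right] at h1
  exact h1.trans (choose_le_choose_of_le_of_large hj (by omega))

theorem sizeH_pred_lt (hk : 5 ≤ k) (hn : 1000 * k ≤ n) : sizeH n k (k - 2) < sizeH n k (k - 1) := by
  have h1 := coreCard_succ (n := n) (k := k) (l := k - 2) (by omega) (by omega)
  have h2 := ten_mul_lt_choose (m := n - k - 1) (j := k - 3) (by omega) (by omega)
  rw [show k - 2 + 1 = k - 1 by omega, show n - 3 - (k - 2) = n - k - 1 by omega] at h1
  rw [sizeH, sizeH, h1, show k - (k - 2) - 1 = 1 by omega, show n - (k - 2) - 2 = n - k by omega,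
    Nat.choose_one_right]
  omega

theorem bound_G_lt_sizeH (hk : 5 ≤ k) (hn : 1000 * k ≤ n) :
    coreCard n k (k - 3) + (n - k - 1).choose (k - 4) + 2 * n < sizeH n k (k - 2) := by
  have h1 := coreCard_succ (n := n) (k := k) (l := k - 3) (by omega) (by omega)
  have h2 := ten_mul_lt_choose (m := n - k - 1) (j := k - 3) (by omega) (by omega)
  have h3 := Nat.choose_succ_succ' (n - k - 1) (k - 4)
  rw [show k - 3 + 1 = k - 2 by omega, show n - 3 - (k - 3) = n - k by omega] at h1
  rw [show n - k - 1 + 1 = n - k by omega, show k - 4 + 1 = k - 3 by omega] at h3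
  rw [sizeH, h1]
  omega

theorem bound_S₁_lt_bound_G (hk : 5 ≤ k) (hn : 1000 * k ≤ n) :
    coreCard n k (k - 3) + (n - k - 2).choose (k - 5) + (n - k + 4) <
      coreCard n k (k - 3) + (n - k - 1).choose (k - 4) + (n - k) := by
  have h2 := choose_le_choose_of_le_of_large (m := n - k - 2) (i := 1) (j := k - 4) (by omega)
    (by omega)
  have h3 := Nat.choose_succ_succ' (n - k - 2) (k - 5)
  rw [show n - k - 2 + 1 = n - k - 1 by omega, show k - 5 + 1 = k - 4 by omega] at h3
  rw [Nat.choose_one_right] at h2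
  omega

theorem bound_small_lt_bound_S (hk : 6 ≤ k) (hn : 1000 * k ≤ n) :
    coreCard n k (k - 3) + (n - k - 3).choose (k - 6) + 8 <
      coreCard n k (k - 3) + (n - k - 2).choose (k - 5) := by
  have h2 := choose_le_choose_of_le_of_large (m := n - k - 3) (i := 1) (j := k - 5) (by omega)
    (by omega)
  have h3 := Nat.choose_succ_succ' (n - k - 3) (k - 6)
  rw [show n - k - 3 + 1 = n - k - 2 by omega, show k - 6 + 1 = k - 5 by omega] at h3
  rw [Nat.choose_one_right] at h2
  omega

theorem choose_two_add (m : ℕ) : (m + 1).choose 2 = m + m.choose 2 := by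
  rw [Nat.choose_succ_succ', Nat.choose_one_right]

/-- The extra term of `𝓗(k, 3, k - 3)` is quadratic in `n`, while `C(n-k-2, k-5)` has degree at
least three once `k ≥ 8`. -/
theorem sizeH_lt_bound_S (hk : 8 ≤ k) (hn : 1000 * k ≤ n) :
    sizeH n k (k - 3) < coreCard n k (k - 3) + (n - k - 2).choose (k - 5) := by
  obtain ⟨m, hm⟩ : ∃ m, m = n - k - 2 := ⟨_, rfl⟩
  have h1 := choose_le_choose_of_le_of_large (m := m) (i := 3) (j := k - 5) (by omega) (by omega)
  have h2 := mul_choose_le_choose_succ (m := m) (j := 2) (c := 10) (by omega)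
  have h3 := ten_mul_lt_choose (m := m) (j := 2) (by omega) (by omega)
  have h4 := choose_two_add m
  have h5 := choose_two_add (m + 1)
  have h6 := choose_two_add (m + 2)
  rw [sizeH, show k - (k - 3) - 1 = 2 by omega, show n - (k - 3) - 2 = m + 3 by omega, ← hm]
  simp only [Nat.reduceAdd, Nat.add_assoc] at *
  omega

/-- The size of `𝓗(k, 3, 2)` is at most `4 * C(n-3, k-3)`, and `4 ≤ k - 4`. -/
theorem sizeH_two_lt (hk : 8 ≤ k) (hn : 240 * (k - 3) * k ^ 5 < n) :
    sizeH n k 2 < coreCard n k (k - 3) := by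
  have hn' := large_of_bound (by omega) hn
  have h1 := coreCard_succ (n := n) (k := k) (l := 0) (by omega) (by omega)
  have h2 := coreCard_succ (n := n) (k := k) (l := 1) (by omega) (by omega)
  have h0 : coreCard n k 0 = 0 := by simp [coreCard]
  have h3 : (n - 4).choose (k - 3) ≤ (n - 3).choose (k - 3) := Nat.choose_le_choose _ (by omega)
  have h4 := triples_bound_lt (by omega) hn
  have h5 : 4 * (n - 3).choose (k - 3) ≤ (k - 4) * (n - 3).choose (k - 3) :=
    Nat.mul_le_mul_right _ (by omega)
  rw [sizeH, show k - 2 - 1 = k - 3 by omega, show n - 2 - 2 = n - 4 by omega]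
  simp only [Nat.sub_zero, Nat.zero_add, Nat.reduceAdd, Nat.sub_sub] at *
  omega

/-- For `k = 5, 6, 7` the families `𝓗(k, 3, 2)` and `𝓗(k, 3, 4)` tie in the leading term. All
binomials are therefore expanded by Pascal's rule from a common base `m` and compared linearly. -/
theorem sizeH_five (hn : 5000 ≤ n) : sizeH n 5 4 < sizeH n 5 2 := by
  obtain ⟨m, rfl⟩ : ∃ m, n = m + 6 := ⟨n - 6, by omega⟩
  have h1 := coreCard_succ (n := m + 6) (k := 5) (l := 2) (by omega) (by omega)
  have h2 := coreCard_succ (n := m + 6) (k := 5) (l := 3) (by omega) (by omega)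
  have h4 := choose_two_add m
  have h5 := choose_two_add (m + 1)
  simp only [sizeH, Nat.reduceAdd, Nat.reduceSub, Nat.reduceSubDiff, Nat.add_sub_cancel, Nat.choose_zero_right,
    Nat.add_assoc] at *
  omega

theorem sizeH_six (hn : 6000 ≤ n) : sizeH n 6 2 < sizeH n 6 5 ∧ sizeH n 6 4 < sizeH n 6 2 ∧
    sizeH n 6 3 < sizeH n 6 4 ∧
    coreCard n 6 3 + (n - 7).choose 2 + 2 * n < sizeH n 6 3 := by
  obtain ⟨m, rfl⟩ : ∃ m, n = m + 7 := ⟨n - 7, by omega⟩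
  have h1 := coreCard_succ (n := m + 7) (k := 6) (l := 2) (by omega) (by omega)
  have h2 := coreCard_succ (n := m + 7) (k := 6) (l := 3) (by omega) (by omega)
  have h3 := coreCard_succ (n := m + 7) (k := 6) (l := 4) (by omega) (by omega)
  have h4 := choose_two_add m
  have h5 := choose_two_add (m + 1)
  have h6 := Nat.choose_succ_succ' m 2
  have h7 := Nat.choose_succ_succ' (m + 1) 2
  have h8 := Nat.choose_succ_succ' (m + 2) 2
  have h9 := mul_choose_le_choose_succ (m := m) (j := 2) (c := 10) (by omega)
  have h10 := ten_mul_lt_choose (m := m) (j := 2) (by omega) (by omega)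
  simp only [sizeH, Nat.reduceAdd, Nat.reduceSub, Nat.reduceSubDiff, Nat.add_sub_cancel,
    Nat.choose_zero_right, Nat.choose_one_right, Nat.add_assoc] at *
  omega

theorem sizeH_seven (hn : 7000 ≤ n) : sizeH n 7 2 < sizeH n 7 5 ∧
    coreCard n 7 4 + (n - 8).choose 3 + 2 * n < sizeH n 7 2 ∧
    sizeH n 7 4 < coreCard n 7 4 + (n - 8).choose 3 + (n - 7) ∧
    coreCard n 7 4 + (n - 9).choose 2 + (n - 7 + 4) < sizeH n 7 4 := by
  obtain ⟨m, rfl⟩ : ∃ m, n = m + 9 := ⟨n - 9, by omega⟩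
  have h1 := coreCard_succ (n := m + 9) (k := 7) (l := 2) (by omega) (by omega)
  have h2 := coreCard_succ (n := m + 9) (k := 7) (l := 3) (by omega) (by omega)
  have h3 := coreCard_succ (n := m + 9) (k := 7) (l := 4) (by omega) (by omega)
  have h4 := choose_two_add m
  have h5 := choose_two_add (m + 1)
  have h5' := choose_two_add (m + 2)
  have h5'' := choose_two_add (m + 3)
  have h6 := Nat.choose_succ_succ' m 2
  have h7 := Nat.choose_succ_succ' (m + 1) 2
  have h8 := Nat.choose_succ_succ' (m + 2) 2
  have h8' := Nat.choose_succ_succ' (m + 3) 2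
  have g6 := Nat.choose_succ_succ' m 3
  have g7 := Nat.choose_succ_succ' (m + 1) 3
  have g8 := Nat.choose_succ_succ' (m + 2) 3
  have g8' := Nat.choose_succ_succ' (m + 3) 3
  have g8'' := Nat.choose_succ_succ' (m + 4) 3
  have h9 := mul_choose_le_choose_succ (m := m) (j := 2) (c := 10) (by omega)
  have h9' := mul_choose_le_choose_succ (m := m) (j := 3) (c := 20) (by omega)
  have h10 := ten_mul_lt_choose (m := m) (j := 2) (by omega) (by omega)
  simp only [sizeH, Nat.reduceAdd, Nat.reduceSub, Nat.reduceSubDiff, Nat.add_sub_cancel,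
    Nat.choose_one_right, Nat.add_assoc] at *
  omega

end Comparisons

/-! ### The families of the statement -/

section Frozen

variable {n k : ℕ}

theorem starConfig_standard {l : ℕ} {S : Finset ℕ} (hn : 6 * k ≤ n) (hl : 2 ≤ l)
    (hlk : l + 1 ≤ k) (hS : S ⊆ Icc (l + 3) (k + 2)) (hSk : S.card + 2 ≤ k) :
    StarConfig n k 1 2 (Icc 3 (l + 2)) S where
  u_mem := by simp; omega
  v_mem := by simp; omega
  ne := by norm_num
  X_sub := by intro x; simp; omega
  S_sub := hS.trans (by intro x; simp; omega)
  u_X := by simp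
  v_X := by simp
  u_S h := by have := hS h; simp at this
  v_S h := by have := hS h; simp at this
  S_X := disjoint_left.2 fun x hx hx' => by
    have := hS hx
    simp at this hx'
    omega
  S_card := hSk
  X_card := by simp; omega
  X_card_le := by simp; omega
  n_large := hn

theorem starConfig_two (hk : 5 ≤ k) (hn : 6 * k ≤ n) :
    StarConfig n k 1 2 (Icc 3 (k - 1)) {k, k + 1} := by
  have := starConfig_standard (l := k - 3) (S := {k, k + 1}) hn (by omega) (by omega)
    (by intro x; simp; omega) (by have := card_le_two (a := k) (b := k + 1); omega)
  rwa [show k - 3 + 2 = k - 1 by omega] at this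

theorem starConfig_three (hk : 5 ≤ k) (hn : 6 * k ≤ n) :
    StarConfig n k 1 2 (Icc 3 (k - 1)) {k, k + 1, k + 2} := by
  have := starConfig_standard (l := k - 3) (S := {k, k + 1, k + 2}) hn (by omega) (by omega)
    (by intro x; simp; omega)
    (by have := card_le_three (a := k) (b := k + 1) (c := k + 2); omega)
  rwa [show k - 3 + 2 = k - 1 by omega] at this

theorem card_Icc_three (hk : 5 ≤ k) : (Icc 3 (k - 1)).card + 3 = k := by
  rw [Nat.card_Icc]
  omega

theorem isMaxNontrivial_familyH {l : ℕ} (hk : 5 ≤ k) (hn : 6 * k ≤ n) (hl : 2 ≤ l)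
    (hlk : l + 1 ≤ k) : IsMaxNontrivial n k 3 (familyH n k 3 l) := by
  rw [familyH_eq n k l (by omega)]
  exact (starData_H (starConfig_standard hn hl hlk (by simp) (by simp; omega))).isMaxNontrivial

theorem card_familyH {l : ℕ} (hk : 5 ≤ k) (hn : 6 * k ≤ n) (hl : 2 ≤ l) (hlk : l + 1 ≤ k) :
    (familyH n k 3 l).card = sizeH n k l := by
  rw [familyH_eq n k l (by omega), sizeH,
    (starConfig_standard (S := ∅) hn hl hlk (by simp) (by simp; omega)).card_H, Nat.card_Icc,
    show l + 2 + 1 - 3 = l by omega]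

theorem isMaxNontrivial_familyG (hk : 5 ≤ k) (hn : 6 * k ≤ n) :
    IsMaxNontrivial n k 3 (familyG n k 3) := by
  rw [familyG_eq n k hk]
  exact (starData_G (card_Icc_three hk).le (starConfig_two hk hn)).isMaxNontrivial

theorem isMaxNontrivial_familyS (hk : 5 ≤ k) (hn : 6 * k ≤ n) :
    IsMaxNontrivial n k 3 (familyS n k) := by
  rw [familyS_eq n k hk]
  exact (starData_S (card_Icc_three hk).le (by omega) (by omega) (by omega)
    (starConfig_three hk hn)).isMaxNontrivial

theorem isMaxNontrivial_familyS₁ (hk : 5 ≤ k) (hn : 6 * k ≤ n) :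
    IsMaxNontrivial n k 3 (familyS₁ n k) := by
  rw [familyS₁_eq n k hk (by omega)]
  exact (starData_S₁ (card_Icc_three hk).le (by omega) (by omega) (by omega)
    (starConfig_three hk hn)).isMaxNontrivial

theorem card_familyG_le (hk : 5 ≤ k) (hn : 6 * k ≤ n) : (familyG n k 3).card ≤
    coreCard n k (k - 3) + (n - k - 1).choose (k - 4) + 2 * n := by
  rw [familyG_eq n k hk]
  exact (starConfig_two hk hn).card_G_le (by omega) (card_Icc_three hk)

theorem le_card_familyG (hk : 5 ≤ k) (hn : 6 * k ≤ n) :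
    coreCard n k (k - 3) + (n - k - 1).choose (k - 4) + (n - k) ≤ (familyG n k 3).card := by
  rw [familyG_eq n k hk]
  exact (starConfig_two hk hn).le_card_G (by omega) (card_Icc_three hk)

theorem card_familyS₁_le (hk : 5 ≤ k) (hn : 6 * k ≤ n) : (familyS₁ n k).card ≤
    coreCard n k (k - 3) + (n - k - 2).choose (k - 5) + (n - k + 4) := by
  rw [familyS₁_eq n k hk (by omega)]
  exact (starConfig_three hk hn).card_S₁_le (by omega) (by omega) (by omega) (card_Icc_three hk)

theorem le_card_familyS₁ (hk : 5 ≤ k) (hn : 6 * k ≤ n) :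
    coreCard n k (k - 3) + (n - k - 2).choose (k - 5) + (n - k) ≤ (familyS₁ n k).card := by
  rw [familyS₁_eq n k hk (by omega)]
  exact (starConfig_three hk hn).le_card_S₁ (by omega) (by omega) (by omega) (card_Icc_three hk)

theorem card_familyS_le (hk : 5 ≤ k) (hn : 6 * k ≤ n) : (familyS n k).card ≤
    coreCard n k (k - 3) + (n - k - 2).choose (k - 5) + 6 := by
  rw [familyS_eq n k hk]
  exact (starConfig_three hk hn).card_S_le (by omega) (by omega) (by omega) (card_Icc_three hk)

theorem le_card_familyS (hk : 5 ≤ k) (hn : 6 * k ≤ n) :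
    coreCard n k (k - 3) + (n - k - 2).choose (k - 5) ≤ (familyS n k).card := by
  rw [familyS_eq n k hk]
  exact (starConfig_three hk hn).le_card_S (by omega) (by omega) (by omega) (card_Icc_three hk)

open Classical in
/-- A maximal non-trivial `3`-wise intersecting family is smaller than `𝓢(k, 3)` or isomorphic to
one of the families of the statement. -/
theorem IsMaxNontrivial.classification {𝓕 : Finset (Finset ℕ)} (h : IsMaxNontrivial n k 3 𝓕)
    (hk : 5 ≤ k) (hn : 240 * (k - 3) * k ^ 5 < n) :
    𝓕.card < coreCard n k (k - 3) + (n - k - 2).choose (k - 5) ∨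
    (∃ l, 2 ≤ l ∧ l + 1 ≤ k ∧ (l = 2 ∨ k ≤ l + 3) ∧ FamilyIso n 𝓕 (familyH n k 3 l)) ∨
    FamilyIso n 𝓕 (familyG n k 3) ∨ FamilyIso n 𝓕 (familyS₁ n k) ∨
    FamilyIso n 𝓕 (familyS n k) := by
  have hn' := large_of_bound hk hn
  -- With at most `k - 4` transversal triples the family is already smaller than `coreCard n k (k -
  -- 3)`.
  by_cases hb : {T ∈ powersetCard 3 (Icc 1 n) | IsTransversal n k 𝓕 T}.card ≤ k - 4
  · left
    have h1 := h.card_le_of_triples (by omega) (by omega)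
    have h2 := triples_bound_lt hk hn
    have h3 := Nat.mul_le_mul_right ((n - 3).choose (k - 3)) hb
    omega
  push Not at hb
  have hH : ∀ u v X, StarConfig n k u v X ∅ → (X.card = 2 ∨ k ≤ X.card + 3) →
      𝓕 = starH n k u v X →
      ∃ l, 2 ≤ l ∧ l + 1 ≤ k ∧ (l = 2 ∨ k ≤ l + 3) ∧ FamilyIso n 𝓕 (familyH n k 3 l) := by
    rintro u v X hc hX rfl
    have := hc.X_card
    refine ⟨X.card, hc.X_card, hc.X_card_le, hX, ?_⟩
    rw [familyH_eq n k _ (by omega)]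
    exact hc.iso_H
  rcases h.exists_starAt hk (by omega) (by omega) with ⟨u, v, X, hX, hc, he⟩ | ⟨u, v, X, hX, hs⟩
  · exact Or.inr (Or.inl (hH u v X hc (Or.inl hX) he))
  · rcases hs.classification (by omega) with ⟨hk6, hle⟩ | ⟨u, v, hc, he⟩ |
      ⟨u, v, a, b, hXk, hab, hc, rfl⟩ | ⟨u, v, a, b, c, hXk, hab, hac, hbc, hc, rfl⟩ |
      ⟨u, v, a, b, c, hXk, hab, hac, hbc, hc, rfl⟩
    · exact Or.inl (hle.trans_lt (bound_small_lt_bound_S hk6 hn'))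
    · exact Or.inr (Or.inl (hH u v X hc (Or.inr (by omega)) he))
    · rw [familyG_eq n k hk]
      exact Or.inr (Or.inr (Or.inl (hc.iso_G hab hXk)))
    · rw [familyS₁_eq n k hk (by omega)]
      exact Or.inr (Or.inr (Or.inr (Or.inl (hc.iso_S₁ hab hac hbc hXk))))
    · rw [familyS_eq n k hk]
      exact Or.inr (Or.inr (Or.inr (Or.inr (hc.iso_S hab hac hbc hXk))))

/-! ### Ranking by size and conclusion -/

theorem isNthLargest_five_iff {d : ℕ} {𝓖₁ 𝓖₂ 𝓖₃ 𝓖₄ 𝓖₅ : Finset (Finset ℕ)}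
    (h₁ : IsMaxNontrivial n k d 𝓖₁) (h₂ : IsMaxNontrivial n k d 𝓖₂)
    (h₃ : IsMaxNontrivial n k d 𝓖₃) (h₄ : IsMaxNontrivial n k d 𝓖₄)
    (h₅ : IsMaxNontrivial n k d 𝓖₅) (h₂₁ : 𝓖₂.card < 𝓖₁.card) (h₃₂ : 𝓖₃.card < 𝓖₂.card)
    (h₄₃ : 𝓖₄.card < 𝓖₃.card) (h₅₄ : 𝓖₅.card < 𝓖₄.card)
    (hall : ∀ 𝓖, IsMaxNontrivial n k d 𝓖 → 𝓖.card < 𝓖₅.card ∨ FamilyIso n 𝓖 𝓖₁ ∨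
      FamilyIso n 𝓖 𝓖₂ ∨ FamilyIso n 𝓖 𝓖₃ ∨ FamilyIso n 𝓖 𝓖₄ ∨ FamilyIso n 𝓖 𝓖₅)
    (𝓕 : Finset (Finset ℕ)) : IsNthLargest 5 n k d 𝓕 ↔ FamilyIso n 𝓕 𝓖₅ := by
  have hsize : ∀ 𝓖, IsMaxNontrivial n k d 𝓖 → 𝓖.card < 𝓖₅.card ∨ 𝓖.card = 𝓖₁.card ∨
      𝓖.card = 𝓖₂.card ∨ 𝓖.card = 𝓖₃.card ∨ 𝓖.card = 𝓖₄.card ∨ 𝓖.card = 𝓖₅.card := by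
    intro 𝓖 h
    rcases hall 𝓖 h with h | h | h | h | h | h
    · exact Or.inl h
    all_goals have := h.card_eq; omega
  constructor
  · rintro ⟨hm, hc⟩
    have hfin : {s : ℕ | 𝓕.card < s ∧ ∃ 𝓖, IsMaxNontrivial n k d 𝓖 ∧ 𝓖.card = s}.Finite := by
      refine (Set.finite_Iic (kSubsets n k).card).subset ?_
      rintro s ⟨-, 𝓖, h𝓖, rfl⟩
      exact card_le_card h𝓖.uniform
    -- A family at least as large as `𝓖₄` has at most three sizes above it.
    have hlt : 𝓖₄.card ≤ 𝓕.card → False := by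
      intro hle
      have hs : {s : ℕ | 𝓕.card < s ∧ ∃ 𝓖, IsMaxNontrivial n k d 𝓖 ∧ 𝓖.card = s} ⊆
          (({𝓖₁.card, 𝓖₂.card, 𝓖₃.card} : Finset ℕ) : Set ℕ) := by
        rintro s ⟨hs, 𝓖, h𝓖, rfl⟩
        have := hsize 𝓖 h𝓖
        simp only [coe_insert, coe_singleton, Set.mem_insert_iff, Set.mem_singleton_iff]
        omega
      have h' := Set.ncard_le_ncard hs (finite_toSet _)
      rw [Set.ncard_coe_finset] at h'
      have := card_le_three (a := 𝓖₁.card) (b := 𝓖₂.card) (c := 𝓖₃.card)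
      omega
    rcases hall 𝓕 hm with h | h | h | h | h | h
    · exfalso
      -- A family smaller than `𝓖₅` has at least five sizes above it.
      have hs : ((({𝓖₁.card, 𝓖₂.card, 𝓖₃.card, 𝓖₄.card, 𝓖₅.card} : Finset ℕ)) : Set ℕ) ⊆
          {s : ℕ | 𝓕.card < s ∧ ∃ 𝓖, IsMaxNontrivial n k d 𝓖 ∧ 𝓖.card = s} := by
        intro s hs
        simp only [coe_insert, coe_singleton, Set.mem_insert_iff, Set.mem_singleton_iff] at hs
        rcases hs with rfl | rfl | rfl | rfl | rfl
        · exact ⟨by omega, _, h₁, rfl⟩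
        · exact ⟨by omega, _, h₂, rfl⟩
        · exact ⟨by omega, _, h₃, rfl⟩
        · exact ⟨by omega, _, h₄, rfl⟩
        · exact ⟨by omega, _, h₅, rfl⟩
      have h' := Set.ncard_le_ncard hs hfin
      rw [Set.ncard_coe_finset, card_insert_of_notMem (by simp; omega),
        card_insert_of_notMem (by simp; omega), card_insert_of_notMem (by simp; omega),
        card_insert_of_notMem (by simp; omega), card_singleton] at h'
      omega
    · exact (hlt (by have := h.card_eq; omega)).elim
    · exact (hlt (by have := h.card_eq; omega)).elim
    · exact (hlt (by have := h.card_eq; omega)).elim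
    · exact (hlt (by have := h.card_eq; omega)).elim
    · exact h
  · intro h
    have hc := h.card_eq
    refine ⟨h₅.of_iso h.symm, ?_⟩
    have hs : {s : ℕ | 𝓕.card < s ∧ ∃ 𝓖, IsMaxNontrivial n k d 𝓖 ∧ 𝓖.card = s} =
        ((({𝓖₁.card, 𝓖₂.card, 𝓖₃.card, 𝓖₄.card} : Finset ℕ)) : Set ℕ) := by
      ext s
      simp only [coe_insert, coe_singleton, Set.mem_insert_iff, Set.mem_singleton_iff]
      constructor
      · rintro ⟨hs, 𝓖, h𝓖, rfl⟩
        have := hsize 𝓖 h𝓖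
        omega
      · rintro (rfl | rfl | rfl | rfl)
        · exact ⟨by omega, _, h₁, rfl⟩
        · exact ⟨by omega, _, h₂, rfl⟩
        · exact ⟨by omega, _, h₃, rfl⟩
        · exact ⟨by omega, _, h₄, rfl⟩
    rw [hs, Set.ncard_coe_finset, card_insert_of_notMem (by simp; omega),
      card_insert_of_notMem (by simp; omega), card_insert_of_notMem (by simp; omega),
      card_singleton]

end Frozen

theorem mainTheorem6 (k n : ℕ) (hk : 5 ≤ k) (hn : nOne k 3 < n)
    (𝓕 : Finset (Finset ℕ)) (h𝓕 : 𝓕 ⊆ kSubsets n k) :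
    (k = 5 → (IsNthLargest 5 n k 3 𝓕 ↔ FamilyIso n 𝓕 (familyS₁ n 5))) ∧
    (k = 6 → (IsNthLargest 5 n k 3 𝓕 ↔ FamilyIso n 𝓕 (familyG n 6 3))) ∧
    (k = 7 → (IsNthLargest 5 n k 3 𝓕 ↔ FamilyIso n 𝓕 (familyH n 7 3 4))) ∧
    (8 ≤ k → (IsNthLargest 5 n k 3 𝓕 ↔ FamilyIso n 𝓕 (familyS n k))) := by
  have hb := lt_of_nOne_lt hk hn
  have hN := large_of_bound hk hb
  have h6 : 6 * k ≤ n := by omega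
  have cG := card_familyG_le hk h6
  have cG' := le_card_familyG hk h6
  have cS₁ := card_familyS₁_le hk h6
  have cS₁' := le_card_familyS₁ hk h6
  have cS := card_familyS_le hk h6
  have cS' := le_card_familyS hk h6
  have cH := fun l => card_familyH (l := l) hk h6
  have b1 := sizeH_pred_lt hk hN
  have b2 := bound_G_lt_sizeH hk hN
  have b3 := bound_S₁_lt_bound_G hk hN
  refine ⟨?_, ?_, ?_, ?_⟩
  · rintro rfl
    have h2 := cH 2 (by omega) (by omega)
    have h3 := cH 3 (by omega) (by omega)
    have h4 := cH 4 (by omega) (by omega)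
    have b4 := sizeH_five (n := n) (by omega)
    simp only [Nat.reduceSub] at *
    -- Here `𝓗(5,3,2) > 𝓗(5,3,4) > 𝓗(5,3,3) > 𝓖 > 𝓢₁`; the family `𝓢` has only a bounded surplus
    -- over the core and comes after.
    refine isNthLargest_five_iff (isMaxNontrivial_familyH hk h6 (l := 2) (by omega) (by omega))
      (isMaxNontrivial_familyH hk h6 (l := 4) (by omega) (by omega))
      (isMaxNontrivial_familyH hk h6 (l := 3) (by omega) (by omega))
      (isMaxNontrivial_familyG hk h6) (isMaxNontrivial_familyS₁ hk h6) (by omega) (by omega)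
      (by omega) (by omega) (fun 𝓖 h𝓖 => ?_) 𝓕
    rcases h𝓖.classification hk hb with h | ⟨l, hl, hlk, hl', h⟩ | h | h | h
    · left
      simp only [Nat.reduceSub] at h
      omega
    · obtain rfl | rfl | rfl : l = 2 ∨ l = 3 ∨ l = 4 := by omega
      all_goals simp only [h, true_or, or_true]
    · simp only [h, true_or, or_true]
    · simp only [h, or_true]
    · left
      rw [h.card_eq]
      omega
  · rintro rfl
    have h2 := cH 2 (by omega) (by omega)
    have h3 := cH 3 (by omega) (by omega)
    have h4 := cH 4 (by omega) (by omega)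
    have h5 := cH 5 (by omega) (by omega)
    have b4 := sizeH_six (n := n) (by omega)
    simp only [Nat.reduceSub, Nat.sub_sub, Nat.reduceAdd] at *
    -- Now `𝓗(6,3,5)` overtakes `𝓗(6,3,2)`, and four families `𝓗` precede `𝓖`.
    refine isNthLargest_five_iff (isMaxNontrivial_familyH hk h6 (l := 5) (by omega) (by omega))
      (isMaxNontrivial_familyH hk h6 (l := 2) (by omega) (by omega))
      (isMaxNontrivial_familyH hk h6 (l := 4) (by omega) (by omega))
      (isMaxNontrivial_familyH hk h6 (l := 3) (by omega) (by omega))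
      (isMaxNontrivial_familyG hk h6) (by omega) (by omega)
      (by omega) (by omega) (fun 𝓖 h𝓖 => ?_) 𝓕
    rcases h𝓖.classification hk hb with h | ⟨l, hl, hlk, hl', h⟩ | h | h | h
    · left
      simp only [Nat.reduceSub, Nat.sub_sub, Nat.reduceAdd] at h
      omega
    · obtain rfl | rfl | rfl | rfl : l = 2 ∨ l = 3 ∨ l = 4 ∨ l = 5 := by omega
      all_goals simp only [h, true_or, or_true]
    · simp only [h, or_true]
    · left
      rw [h.card_eq]
      omega
    · left
      rw [h.card_eq]
      omega
  · rintro rfl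
    have h2 := cH 2 (by omega) (by omega)
    have h4 := cH 4 (by omega) (by omega)
    have h5 := cH 5 (by omega) (by omega)
    have h6' := cH 6 (by omega) (by omega)
    have b4 := sizeH_seven (n := n) (by omega)
    simp only [Nat.reduceSub, Nat.sub_sub, Nat.reduceAdd] at *
    -- The cubic surplus of `𝓖` over the core beats the quadratic one of `𝓗(7,3,4)`, which in turn
    -- beats that of `𝓢₁`.
    refine isNthLargest_five_iff (isMaxNontrivial_familyH hk h6 (l := 6) (by omega) (by omega))
      (isMaxNontrivial_familyH hk h6 (l := 5) (by omega) (by omega))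
      (isMaxNontrivial_familyH hk h6 (l := 2) (by omega) (by omega))
      (isMaxNontrivial_familyG hk h6)
      (isMaxNontrivial_familyH hk h6 (l := 4) (by omega) (by omega)) (by omega) (by omega)
      (by omega) (by omega) (fun 𝓖 h𝓖 => ?_) 𝓕
    rcases h𝓖.classification hk hb with h | ⟨l, hl, hlk, hl', h⟩ | h | h | h
    · left
      simp only [Nat.reduceSub, Nat.sub_sub, Nat.reduceAdd] at h
      omega
    · obtain rfl | rfl | rfl | rfl : l = 2 ∨ l = 4 ∨ l = 5 ∨ l = 6 := by omega
      all_goals simp only [h, true_or, or_true]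
    · simp only [h, true_or, or_true]
    · left
      rw [h.card_eq]
      omega
    · left
      rw [h.card_eq]
      omega
  · intro hk8
    have h1 := cH (k - 1) (by omega) (by omega)
    have h2 := cH (k - 2) (by omega) (by omega)
    have h3 := cH (k - 3) (by omega) (by omega)
    have h4 := cH 2 (by omega) (by omega)
    have b4 := sizeH_lt_bound_S hk8 hN
    have b5 := sizeH_two_lt hk8 hb
    -- Both `𝓗(k,3,2)` and `𝓗(k,3,k-3)` are now smaller than `𝓢`.
    refine isNthLargest_five_iff
      (isMaxNontrivial_familyH hk h6 (l := k - 1) (by omega) (by omega))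
      (isMaxNontrivial_familyH hk h6 (l := k - 2) (by omega) (by omega))
      (isMaxNontrivial_familyG hk h6) (isMaxNontrivial_familyS₁ hk h6)
      (isMaxNontrivial_familyS hk h6) (by omega) (by omega)
      (by omega) (by omega) (fun 𝓖 h𝓖 => ?_) 𝓕
    rcases h𝓖.classification hk hb with h | ⟨l, hl, hlk, hl', h⟩ | h | h | h
    · left
      omega
    · obtain rfl | rfl | rfl | rfl : l = 2 ∨ l = k - 3 ∨ l = k - 2 ∨ l = k - 1 := by omega
      · left
        rw [h.card_eq]
        omega
      · left
        rw [h.card_eq]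
        omega
      all_goals simp only [h, true_or, or_true]
    · simp only [h, true_or, or_true]
    · simp only [h, true_or, or_true]
    · simp only [h, or_true]
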